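/- Let $d \ge 2$ and $\alpha \in (1,2)$. Let $(X_t)_{t \ge 0}$ be the symmetric $\alpha$-stable Lévy process on $\mathbb{R}^d$ (with càdlàg paths), $\mathbb{E}^x e^{i\xi\cdot(X_t-x)} = e^{-t|\xi|^\alpha}$. Write $x=(\bar x,x_d)$ with $\bar x\in\mathbb{R}^{d-1}$ and $x_d\in\mathbb{R}$, let $e_d=(0,\dots,0,1)$, $\mathbf{L}=\{x\in\mathbb{R}^d : x_d=0\}$, identified with $\mathbb{R}^{d-1}$ through $\bar y\mapsto(\bar y,0)$, and $\mathbb{H}=\mathbb{R}^d\setminus\mathbf{L}$. Let $\tau=\inf\{t>0: X_t\notin\mathbb{H}\}$, let $\omega^x(A)=\mathbb{P}^x(X_\tau\in A;\ \tau<\infty)$ be the $\alpha$-harmonic measure of $\mathbb{H}$ for the starting point $x\in\mathbb{H}$, and let $\omega_\alpha=\omega^{e_d}$, regarded as a measure on $\mathbb{R}^{d-1}$. Let $$G_{\mathbb H}(x,y)=\mathcal{A}_{d,\alpha}\Big(|x-y|^{\alpha-d}-\int_{\mathbf L}|y-z|^{\alpha-d}\,\omega^x(dz)\Big),\qquad \mathcal{A}_{d,\alpha}=\frac{\Gamma((d-\alpha)/2)}{2^{\alpha}\pi^{d/2}|\Gamma(\alpha/2)|},$$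 be the Green function of $\mathbb{H}$, for $x, y\in\mathbb{H}$ with $x\ne y$, and let $$M_{\mathbb H}(x,\bar y)=\lim_{\mathbb H\ni w\to(\bar y,0)}\frac{G_{\mathbb H}(x,w)}{G_{\mathbb H}(e_d,w)},\qquad x\in\mathbb{H},\ \bar y\in\mathbb{R}^{d-1},$$ be its Martin kernel. For a finite signed Borel measure $\mu$ on $\mathbb{R}^{d-1}$ let $M_{\mathbb H}[\mu](x)=\int_{\mathbb{R}^{d-1}}M_{\mathbb H}(x,\bar y)\,\mu(d\bar y)$, $x\in\mathbb{H}$. For $y\in\mathbf{L}$ and $\beta>0$ let $\Gamma_\beta(y)=\{x\in\mathbb{H}:|x-y|<(1+\beta)|x_d|\}$; a function $u$ on $\mathbb{H}$ has the nontangential limit $\ell$ at $y\in\mathbf{L}$ if $\lim_{\Gamma_\beta(y)\ni x\to y}u(x)=\ell$ for every $\beta>0$. **Theorem 4.18.** Let $\mu$ be a finite signed Borel measure on $\mathbb{R}^{d-1}$ and let $\mu(d\bar x)=f(\bar x)\,\omega_\alpha(d\bar x)+\nu(d\bar x)$ be its Lebesgue decomposition with respect to $\omega_\alpha$, that is, $f\in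 L^1(\omega_\alpha)$ and $\nu$ is a finite signed measure singular to $\omega_\alpha$. Then the limit defining $M_{\mathbb H}(x,\bar y)$ exists for all $x\in\mathbb{H}$ and $\bar y\in\mathbb{R}^{d-1}$, the integral defining $M_{\mathbb H}[\mu](x)$ converges absolutely for all $x\in\mathbb{H}$, and, for almost every $\bar y\in\mathbb{R}^{d-1}$ with respect to the $(d-1)$-dimensional Lebesgue measure, $M_{\mathbb H}[\mu]$ has the nontangential limit $f(\bar y)$ at $y=(\bar y,0)\in\mathbf{L}$. -/

import Mathlib

open MeasureTheory ProbabilityTheory Filter Topology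
open scoped ENNReal NNReal

noncomputable section

namespace AlphaStable

/-- `X` is a symmetric `α`-stable Lévy process on `ℝ^d` started at `0`: it has independent
increments, `E exp (i ξ·(X_t - X_s)) = exp (-(t - s) |ξ|^α)` for `s ≤ t`, and almost all of its
paths are right-continuous with left limits. The process started at `x` is `x + X`. -/
structure IsSymmetricStable {Ω : Type*} [MeasurableSpace Ω] (P : Measure Ω) {d : ℕ} (α : ℝ)
    (X : ℝ≥0 → Ω → EuclideanSpace ℝ (Fin d)) : Prop where
  measurable : ∀ t, Measurable (X t)
  start_zero : ∀ᵐ ω ∂P, X 0 ω = 0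
  indep_increments : HasIndepIncrements X P
  charFun_increment : ∀ s t : ℝ≥0, s ≤ t → ∀ ξ : EuclideanSpace ℝ (Fin d),
    charFun (P.map (fun ω => X t ω - X s ω)) ξ
      = Complex.exp (((-(((t : ℝ) - (s : ℝ)) * ‖ξ‖ ^ α) : ℝ)) : ℂ)
  cadlag : ∀ᵐ ω ∂P, ∀ t : ℝ≥0,
    ContinuousWithinAt (fun s => X s ω) (Set.Ici t) t ∧
      ∃ l, Tendsto (fun s => X s ω) (𝓝[<] t) (𝓝 l)

section Potential

variable {Ω : Type*} {d : ℕ}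

/-- First exit time `τ_D = inf {t > 0 : x + X_t ∉ D}` from `D` of the process started at `x`
(with value `∞` if there is no such `t`). -/
def exitTime (X : ℝ≥0 → Ω → EuclideanSpace ℝ (Fin d)) (D : Set (EuclideanSpace ℝ (Fin d)))
    (x : EuclideanSpace ℝ (Fin d)) (ω : Ω) : ℝ≥0∞ :=
  ⨅ (t : ℝ≥0) (_ : 0 < t ∧ x + X t ω ∉ D), (t : ℝ≥0∞)

/-- Position `x + X_{τ_D}` at the first exit time (only used where `τ_D < ∞`). -/
def exitPosition (X : ℝ≥0 → Ω → EuclideanSpace ℝ (Fin d))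
    (D : Set (EuclideanSpace ℝ (Fin d))) (x : EuclideanSpace ℝ (Fin d)) (ω : Ω) :
    EuclideanSpace ℝ (Fin d) :=
  x + X (exitTime X D x ω).toNNReal ω

variable [MeasurableSpace Ω]

/-- The `α`-harmonic measure `ω^x(A, D) = P^x(X_{τ_D} ∈ A; τ_D < ∞)`. -/
def harmonicMeasure (P : Measure Ω) (X : ℝ≥0 → Ω → EuclideanSpace ℝ (Fin d))
    (D : Set (EuclideanSpace ℝ (Fin d))) (x : EuclideanSpace ℝ (Fin d)) :
    Measure (EuclideanSpace ℝ (Fin d)) :=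
  (P.restrict {ω | exitTime X D x ω < ∞}).map (exitPosition X D x)

/-- The constant `𝒜_{d,γ} = Γ((d - γ)/2) / (2^γ π^{d/2} |Γ(γ/2)|)`. -/
def rieszConst (d : ℕ) (γ : ℝ) : ℝ :=
  Real.Gamma (((d : ℝ) - γ) / 2) / (2 ^ γ * Real.pi ^ ((d : ℝ) / 2) * |Real.Gamma (γ / 2)|)

/-- The Green function
`G_D(x, y) = 𝒜_{d,α} (|x - y|^{α-d} - ∫_{D^c} |y - z|^{α-d} ω^x(dz, D))`.
It is used for `x ≠ y` only (on the diagonal the real power `0 ^ (α - d)` is not meaningful). -/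
def greenFunction (P : Measure Ω) (α : ℝ) (X : ℝ≥0 → Ω → EuclideanSpace ℝ (Fin d))
    (D : Set (EuclideanSpace ℝ (Fin d))) (x y : EuclideanSpace ℝ (Fin d)) : ℝ :=
  rieszConst d α * (‖x - y‖ ^ (α - (d : ℝ))
    - ∫ z in Dᶜ, ‖y - z‖ ^ (α - (d : ℝ)) ∂(harmonicMeasure P X D x))

/-- The Martin kernel of `D` with reference point `x₀`:
`M_D(x, z) = lim_{D ∋ y → z} G_D(x, y) / G_D(x₀, y)`. -/
def martinKernel (P : Measure Ω) (α : ℝ) (X : ℝ≥0 → Ω → EuclideanSpace ℝ (Fin d))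
    (D : Set (EuclideanSpace ℝ (Fin d))) (x₀ x z : EuclideanSpace ℝ (Fin d)) : ℝ :=
  limUnder (𝓝[D] z) (fun y => greenFunction P α X D x y / greenFunction P α X D x₀ y)

end Potential

/-! ### The complement of the hyperplane; the ambient dimension is `d = n + 1` -/

section Hyperplane

variable {n : ℕ}

/-- `ℍ`, the complement of the hyperplane `𝐋 = {x : x_d = 0}` in `ℝ^d`. -/
def hyperplaneCompl (n : ℕ) : Set (EuclideanSpace ℝ (Fin (n + 1))) :=
  {x | x (Fin.last n) ≠ 0}

/-- The point `(ȳ, 0)` of the hyperplane `𝐋` that is identified with `ȳ ∈ ℝ^{d-1}`. -/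
def boundaryPoint (y : EuclideanSpace ℝ (Fin n)) : EuclideanSpace ℝ (Fin (n + 1)) :=
  WithLp.toLp 2 (Fin.snoc (α := fun _ => ℝ) (fun i => y i) 0)

/-- The first `d - 1` coordinates `x̄` of a point `x = (x̄, x_d)` of `ℝ^d`. -/
def horizontalPart (x : EuclideanSpace ℝ (Fin (n + 1))) : EuclideanSpace ℝ (Fin n) :=
  WithLp.toLp 2 (fun i : Fin n => x i.castSucc)

/-- The reference point `e_d = (0, …, 0, 1)`. -/
def referencePoint (n : ℕ) : EuclideanSpace ℝ (Fin (n + 1)) :=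
  EuclideanSpace.single (Fin.last n) 1

variable {Ω : Type*} [MeasurableSpace Ω]

/-- `ω_α`, the `α`-harmonic measure for `ℍ` with starting point `e_d`. It lives on `𝐋` and is
regarded as a measure on `ℝ^{d-1}` through `(x̄, 0) ↦ x̄`. -/
def hyperplaneHarmonicMeasure (P : Measure Ω)
    (X : ℝ≥0 → Ω → EuclideanSpace ℝ (Fin (n + 1))) : Measure (EuclideanSpace ℝ (Fin n)) :=
  (harmonicMeasure P X (hyperplaneCompl n) (referencePoint n)).map horizontalPart

/-- The Martin kernel `M_ℍ(x, ȳ)` of `ℍ` with reference point `e_d`, for `x ∈ ℍ` and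
`ȳ ∈ ℝ^{d-1}` identified with `(ȳ, 0) ∈ 𝐋`. -/
def hyperplaneMartinKernel (P : Measure Ω) (α : ℝ)
    (X : ℝ≥0 → Ω → EuclideanSpace ℝ (Fin (n + 1))) (x : EuclideanSpace ℝ (Fin (n + 1)))
    (y : EuclideanSpace ℝ (Fin n)) : ℝ :=
  martinKernel P α X (hyperplaneCompl n) (referencePoint n) x (boundaryPoint y)

/-- The Martin integral `M_ℍ[μ](x) = ∫ M_ℍ(x, ȳ) μ(dȳ)` of a finite signed measure `μ`. -/
def martinIntegral (P : Measure Ω) (α : ℝ)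
    (X : ℝ≥0 → Ω → EuclideanSpace ℝ (Fin (n + 1)))
    (μ : SignedMeasure (EuclideanSpace ℝ (Fin n))) (x : EuclideanSpace ℝ (Fin (n + 1))) : ℝ :=
  ∫ᵛ y, hyperplaneMartinKernel P α X x y ∂•μ

/-- The cone `Γ_β(y) = {x ∈ ℍ : |x - y| < (1 + β) |x_d|}`. -/
def cone (β : ℝ) (y : EuclideanSpace ℝ (Fin (n + 1))) :
    Set (EuclideanSpace ℝ (Fin (n + 1))) :=
  {x | x ∈ hyperplaneCompl n ∧ ‖x - y‖ < (1 + β) * |x (Fin.last n)|}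

/-- `u` has the nontangential limit `l` at `y ∈ 𝐋`: for every `β > 0`, `u(x) → l` as `x → y`
within the cone `Γ_β(y)`. -/
def HasNontangentialLimit (u : EuclideanSpace ℝ (Fin (n + 1)) → ℝ)
    (y : EuclideanSpace ℝ (Fin (n + 1))) (l : ℝ) : Prop :=
  ∀ β : ℝ, 0 < β → Tendsto u (𝓝[cone β y] y) (𝓝 l)

end Hyperplane

end AlphaStable

end

open AlphaStable

/-! ### Regular paths and independence from the dyadic past. -/

namespace AlphaStable

variable {Ω : Type*} [MeasurableSpace Ω]

/-! Put `γ = α - 1` and `n = d - 1`, so that `α - d = γ - n`. Everything rests on an explicit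
harmonic measure: started at `x`, the process hits the hyperplane with density `p_t(z - x̄)`, where
`t = |x_d|` and `p_t = poissonDensity n γ t` is a Poisson-type kernel of mass one
(`IsSymmetricStable.harmonicMeasure_eq`).

To find it, the strong Markov property is used only on characters (`IsRegularStable.strongMarkov`),
where it says that `exp (iζ·X_t)` is damped by `exp (-(t - T)|ζ|^α)` after an optional time `T`. A
Laplace transform in `t` turns the damping into the resolvent factor `1 / (q + |ζ|^α)`. Take `T` to
be the entrance time of the last coordinate into `(-ε, ε)` and integrate over the vertical frequency
against a function whose Fourier transform is supported in that interval: paths that have not yet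
entered contribute nothing. Letting `ε → 0` and then `q → 0` gives the characteristic function of
the hitting place as a ratio of one-dimensional integrals (`IsRegularStable.integral_potential_eq`).
Gaussian mixtures express both this ratio and the Fourier transform of `p_t` through `besselInt`,
and the symmetry `besselInt_swap` identifies them.

The Riesz potential of `p_t` on the hyperplane equals that of a unit mass at height `t`
(`integral_riesz_mul_poisson`). Hence `G(x, w)`, for `w` near `(ȳ, 0)`, is `|w_d|^γ` times a
constant multiple of `p_{|x_d|}(ȳ - x̄)`, up to an error of order `|w_d|`, which is negligible
because `γ < 1` (`tendsto_greenDefect_div`). The Martin kernel is therefore `p_{|x_d|}(ȳ - x̄) /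
p_1(ȳ)`.

What remains is a Fatou theorem. The kernel integrates to one against `ω_α`, so `|M[μ](x) - f(y)|`
is at most its integral against `|f - f(y)| ω_α + |ν|`. For almost every `y` this measure has
Lebesgue density zero at `y`, by Lebesgue points and by differentiation of singular measures. A
layer-cake estimate near `y`, a factor `t^γ` far from `y` and a Harnack-type comparison inside cones
finish the proof (`tendsto_cone_lintegral_poissonDensity_div`). -/

/-- A symmetric stable process all of whose paths are right-continuous and start at `0`. -/
structure IsRegularStable (P : Measure Ω) {d : ℕ} (α : ℝ)
    (X : ℝ≥0 → Ω → EuclideanSpace ℝ (Fin d)) : Prop where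
  stable : IsSymmetricStable P α X
  zero : ∀ ω, X 0 ω = 0
  right_cont : ∀ ω t, ContinuousWithinAt (fun s => X s ω) (Set.Ici t) t

/-- Setting the path to `0` on a measurable null set keeps measurability and all laws. Afterwards
right continuity holds for every `ω`, so limits along dyadic times need no exceptional sets. -/
theorem IsSymmetricStable.exists_regular {P : Measure Ω} {d : ℕ} {α : ℝ}
    {X : ℝ≥0 → Ω → EuclideanSpace ℝ (Fin d)} (hX : IsSymmetricStable P α X) :
    ∃ X' : ℝ≥0 → Ω → EuclideanSpace ℝ (Fin d), IsRegularStable P α X' ∧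
      ∀ᵐ ω ∂P, ∀ t, X' t ω = X t ω := by
  classical
  have h := hX.cadlag.and hX.start_zero
  obtain ⟨N, hN, hNm, hN0⟩ := exists_measurable_superset_of_null (ae_iff.1 h)
  have hgood : ∀ ω, ω ∉ N → (∀ t : ℝ≥0, ContinuousWithinAt (fun s => X s ω) (Set.Ici t) t ∧
      ∃ l, Tendsto (fun s => X s ω) (𝓝[<] t) (𝓝 l)) ∧ X 0 ω = 0 := by
    intro ω hω
    by_contra hc
    exact hω (hN hc)
  have hNae : ∀ᵐ ω ∂P, ω ∉ N := measure_eq_zero_iff_ae_notMem.1 hN0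
  let X' : ℝ≥0 → Ω → EuclideanSpace ℝ (Fin d) := fun t ω => if ω ∈ N then 0 else X t ω
  have hae : ∀ᵐ ω ∂P, ∀ t, X' t ω = X t ω := by
    filter_upwards [hNae] with ω hω t
    simp [X', hω]
  refine ⟨X', ⟨⟨?_, ?_, ?_, ?_, ?_⟩, ?_, ?_⟩, hae⟩
  · exact fun t => Measurable.ite hNm measurable_const (hX.measurable t)
  · filter_upwards [hae, hX.start_zero] with ω h1 h2
    rw [h1, h2]
  · intro n t ht
    refine (hX.indep_increments n t ht).congr fun i => ?_
    filter_upwards [hae] with ω hω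
    simp [hω]
  · intro s t hst ξ
    rw [← hX.charFun_increment s t hst ξ]
    congr 1
    refine Measure.map_congr ?_
    filter_upwards [hae] with ω hω
    simp [hω]
  · refine Eventually.of_forall fun ω t => ?_
    by_cases hω : ω ∈ N
    · simp only [X', hω, if_true]
      exact ⟨continuousWithinAt_const, 0, tendsto_const_nhds⟩
    · simp only [X', hω, if_false]
      exact (hgood ω hω).1 t
  · intro ω
    by_cases hω : ω ∈ N
    · simp [X', hω]
    · simp [X', hω, (hgood ω hω).2]
  · intro ω t
    by_cases hω : ω ∈ N
    · simp only [X', hω, if_true]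
      exact continuousWithinAt_const
    · simp only [X', hω, if_false]
      exact ((hgood ω hω).1 t).1

/-- The dyadic time `k / 2 ^ j`. -/
noncomputable def dyadic (j k : ℕ) : ℝ≥0 := (k : ℝ≥0) / 2 ^ j

theorem dyadic_mono (j : ℕ) : Monotone (dyadic j) := by
  intro a b hab
  unfold dyadic
  gcongr

/-- The information carried by the positions at dyadic times up to time `r`. -/
@[reducible] noncomputable def dyadicPast {Ω E : Type*} [MeasurableSpace E] (X : ℝ≥0 → Ω → E)
    (r : ℝ≥0) : MeasurableSpace Ω :=
  ⨆ (j : ℕ) (k : ℕ) (_ : dyadic j k ≤ r), MeasurableSpace.comap (X (dyadic j k)) inferInstance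

section Past

variable {Ω E : Type*} [MeasurableSpace E] {X : ℝ≥0 → Ω → E}

theorem measurable_dyadicPast {r : ℝ≥0} {j k : ℕ} (h : dyadic j k ≤ r) :
    Measurable[dyadicPast X r] (X (dyadic j k)) := by
  rw [measurable_iff_comap_le]
  unfold dyadicPast
  exact le_iSup_of_le j (le_iSup_of_le k (le_iSup_of_le h le_rfl))

theorem dyadicPast_mono {r s : ℝ≥0} (h : r ≤ s) : dyadicPast X r ≤ dyadicPast X s := by
  unfold dyadicPast
  exact iSup_mono fun j => iSup_mono fun k => iSup_mono' fun hk => ⟨hk.trans h, le_rfl⟩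

theorem dyadicPast_le [MeasurableSpace Ω] (hX : ∀ t, Measurable (X t)) (r : ℝ≥0) :
    dyadicPast X r ≤ ‹MeasurableSpace Ω› := by
  unfold dyadicPast
  exact iSup_le fun j => iSup_le fun k => iSup_le fun _ => (hX _).comap_le

end Past

variable {P : Measure Ω} [IsProbabilityMeasure P] {d : ℕ} {α : ℝ}
  {X : ℝ≥0 → Ω → EuclideanSpace ℝ (Fin d)}

/-- At a fixed dyadic level the past up to `r` is generated by finitely many increments, which are
independent of `X t - X r`. The levels refine each other, so independence passes to their supremum.
-/
theorem IsRegularStable.indep_dyadicPast (hX : IsRegularStable P α X) {r t : ℝ≥0} (hrt : r ≤ t) :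
    Indep (dyadicPast X r)
      (MeasurableSpace.comap (fun ω => X t ω - X r ω) inferInstance) P := by
  have hm := hX.stable.measurable
  unfold dyadicPast
  refine indep_iSup_of_monotone (fun j => ?_)
    (fun j => iSup_le fun k => iSup_le fun _ => (hm _).comap_le)
    ((hm t).sub (hm r)).comap_le ?_
  · obtain ⟨K, hK⟩ : ∃ K : ℕ, r ≤ dyadic j K := by
      obtain ⟨K, hK⟩ := exists_nat_ge (r * 2 ^ j)
      refine ⟨K, ?_⟩
      unfold dyadic
      rwa [le_div_iff₀ (by positivity)]
    -- The level-`j` grid stopped at `r`, with one last jump to `t`. Since `r ≤ dyadic j K`, `τ K =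
    -- r`, so increment number `K` is `X t - X r` and the earlier ones generate the past.
    let τ : ℕ → ℝ≥0 := fun k => if k ≤ K then min (dyadic j k) r else t
    have hτ : Monotone τ := by
      intro a b hab
      simp only [τ]
      split_ifs with h1 h2 h2
      · exact min_le_min_right _ (dyadic_mono j hab)
      · exact (min_le_right _ _).trans hrt
      · omega
      · exact le_rfl
    have hind := hX.stable.indep_increments.nat hτ
    have hfin := hind.indepFun_finset (Finset.range K) {K} (by simp)
      (fun i => (hm _).sub (hm _))
    rw [IndepFun_iff_Indep] at hfin
    refine indep_of_indep_of_le_left (indep_of_indep_of_le_right hfin ?_) ?_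
    · rw [← measurable_iff_comap_le]
      have : (fun ω => X t ω - X r ω) = (fun v : ((({K} : Finset ℕ) : Type) →
          EuclideanSpace ℝ (Fin d)) => v ⟨K, by simp⟩) ∘
          (fun ω (i : (({K} : Finset ℕ) : Type)) => X (τ (i + 1)) ω - X (τ i) ω) := by
        funext ω
        simp [τ, hK]
      rw [this]
      exact (measurable_pi_apply _).comp (comap_measurable _)
    · refine iSup_le fun k => iSup_le fun hk => ?_
      rw [← measurable_iff_comap_le]
      have hkK : ∀ k' : ℕ, dyadic j k' ≤ r → k' ≤ K := by
        intro k' hk'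
        have h1 := hk'.trans hK
        unfold dyadic at h1
        have h2 : (0 : ℝ≥0) < 2 ^ j := by positivity
        rw [div_le_div_iff_of_pos_right h2] at h1
        exact_mod_cast h1
      have key : ∀ i, i ≤ k → τ i = dyadic j i := by
        intro i hi
        have h1 : dyadic j i ≤ r := (dyadic_mono j hi).trans hk
        simp [τ, hkK i h1, h1]
      have : X (dyadic j k) = (fun v : (((Finset.range K : Finset ℕ) : Type) →
          EuclideanSpace ℝ (Fin d)) => ∑ i : (Finset.range k),
            v ⟨i, Finset.mem_range.2 ((Finset.mem_range.1 i.2).trans_le (hkK k hk))⟩) ∘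
          (fun ω (i : ((Finset.range K : Finset ℕ) : Type)) => X (τ (i + 1)) ω - X (τ i) ω) := by
        funext ω
        simp only [Function.comp]
        rw [Finset.sum_coe_sort (Finset.range k) (fun i => X (τ (i + 1)) ω - X (τ i) ω),
          Finset.sum_range_sub (fun i => X (τ i) ω), key k le_rfl, key 0 (Nat.zero_le _)]
        simp [dyadic, hX.zero]
      rw [this]
      refine Measurable.comp ?_ (comap_measurable _)
      exact Finset.measurable_sum _ fun i _ => measurable_pi_apply _
  · refine monotone_nat_of_le_succ fun j => iSup_le fun k => iSup_le fun hk => ?_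
    have : dyadic j k = dyadic (j + 1) (2 * k) := by
      unfold dyadic
      push_cast
      rw [pow_succ]
      field_simp
    rw [this] at hk ⊢
    exact le_iSup_of_le (2 * k) (le_iSup_of_le hk le_rfl)

/-- The character `exp (i ⟨x, ζ⟩)`. -/
noncomputable def expInner {V : Type*} [NormedAddCommGroup V] [InnerProductSpace ℝ V]
    (ζ x : V) : ℂ :=
  Complex.exp ((inner ℝ x ζ : ℝ) * Complex.I)

section expInner

variable {V : Type*} [NormedAddCommGroup V] [InnerProductSpace ℝ V]

@[simp] theorem norm_expInner (ζ x : V) : ‖expInner ζ x‖ = 1 := by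
  simp [expInner, Complex.norm_exp_ofReal_mul_I]

theorem expInner_add (ζ x y : V) : expInner ζ (x + y) = expInner ζ x * expInner ζ y := by
  simp only [expInner, inner_add_left, Complex.ofReal_add, add_mul, Complex.exp_add]

@[simp] theorem expInner_zero_right (ζ : V) : expInner ζ 0 = 1 := by simp [expInner]

theorem continuous_expInner_uncurry : Continuous (fun p : V × V => expInner p.1 p.2) := by
  unfold expInner
  fun_prop

theorem continuous_expInner (ζ : V) : Continuous (expInner ζ) :=
  continuous_expInner_uncurry.comp (Continuous.prodMk_right ζ)

theorem charFun_eq_integral_expInner [MeasurableSpace V] (μ : Measure V) (ζ : V) :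
    charFun μ ζ = ∫ x, expInner ζ x ∂μ := rfl

end expInner

/-- The Markov property at a fixed time `r`, tested on characters: the increment after `r` is
independent of the past and contributes its characteristic function. A dyadic `r` makes `X r` itself
measurable with respect to the past. -/
theorem IsRegularStable.integral_indicator_expInner (hX : IsRegularStable P α X) {j k : ℕ}
    {t : ℝ≥0} (hrt : dyadic j k ≤ t) {A : Set Ω} (hA : MeasurableSet[dyadicPast X (dyadic j k)] A)
    (ζ : EuclideanSpace ℝ (Fin d)) :
    ∫ ω in A, expInner ζ (X t ω) ∂P = ∫ ω in A, expInner ζ (X (dyadic j k) ω) *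
      Complex.exp (((-((t - dyadic j k : ℝ) * ‖ζ‖ ^ α) : ℝ)) : ℂ) ∂P := by
  have hm := hX.stable.measurable
  have hA' : MeasurableSet A := dyadicPast_le hm _ _ hA
  set r := dyadic j k
  have hf : Measurable[dyadicPast X r] (A.indicator fun ω => expInner ζ (X r ω)) :=
    ((continuous_expInner ζ).measurable.comp (measurable_dyadicPast le_rfl)).indicator hA
  have hind : IndepFun (A.indicator fun ω => expInner ζ (X r ω))
      (fun ω => expInner ζ (X t ω - X r ω)) P := by
    rw [IndepFun_iff_Indep]
    refine indep_of_indep_of_le_left (indep_of_indep_of_le_right (hX.indep_dyadicPast hrt) ?_)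
      hf.comap_le
    rw [← measurable_iff_comap_le]
    exact (continuous_expInner ζ).measurable.comp (comap_measurable _)
  have hmul := hind.integral_fun_mul_eq_mul_integral
    (hf.mono (dyadicPast_le hm _) le_rfl).aestronglyMeasurable
    ((continuous_expInner ζ).measurable.comp ((hm t).sub (hm r))).aestronglyMeasurable
  have hchar : ∫ ω, expInner ζ (X t ω - X r ω) ∂P
      = Complex.exp (((-((t - r : ℝ) * ‖ζ‖ ^ α) : ℝ)) : ℂ) := by
    rw [← hX.stable.charFun_increment r t hrt ζ, charFun_eq_integral_expInner,
      integral_map (φ := fun ω => X t ω - X r ω) ((hm t).sub (hm r)).aemeasurable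
        (continuous_expInner ζ).measurable.aestronglyMeasurable]
  rw [hchar, integral_indicator hA'] at hmul
  rw [integral_mul_const, ← hmul, ← integral_indicator hA']
  refine integral_congr_ae (Eventually.of_forall fun ω => ?_)
  by_cases hω : ω ∈ A
  · simp only [Set.indicator_of_mem hω]
    rw [← expInner_add, add_sub_cancel]
  · simp [Set.indicator_of_notMem hω]

end AlphaStable

/-! ### Strong Markov property on characters. -/

namespace AlphaStable

/-- The smallest dyadic number of level `k` that is strictly larger than `s`. -/
noncomputable def dyadicAbove (k : ℕ) (s : ℝ≥0) : ℝ≥0 := dyadic k (⌊s * 2 ^ k⌋₊ + 1)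

theorem lt_dyadicAbove (k : ℕ) (s : ℝ≥0) : s < dyadicAbove k s := by
  unfold dyadicAbove dyadic
  rw [lt_div_iff₀ (by positivity)]
  exact_mod_cast Nat.lt_floor_add_one (s * 2 ^ k)

theorem dyadicAbove_le (k : ℕ) (s : ℝ≥0) : dyadicAbove k s ≤ s + 2⁻¹ ^ k := by
  unfold dyadicAbove dyadic
  rw [div_le_iff₀ (by positivity), add_mul, ← mul_pow, inv_mul_cancel₀ two_ne_zero, one_pow]
  push_cast
  gcongr
  exact Nat.floor_le zero_le

theorem tendsto_inv_two_pow : Tendsto (fun k : ℕ => (2⁻¹ : ℝ≥0) ^ k) atTop (𝓝 0) :=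
  NNReal.tendsto_pow_atTop_nhds_zero_of_lt_one (inv_lt_one_of_one_lt₀ one_lt_two)

theorem tendsto_dyadicAbove (s : ℝ≥0) : Tendsto (fun k => dyadicAbove k s) atTop (𝓝 s) := by
  refine tendsto_of_tendsto_of_tendsto_of_le_of_le tendsto_const_nhds ?_
    (fun k => (lt_dyadicAbove k s).le) (fun k => dyadicAbove_le k s)
  simpa using tendsto_inv_two_pow.const_add s

theorem tendsto_dyadic_floor (t : ℝ≥0) :
    Tendsto (fun k => dyadic k ⌊t * 2 ^ k⌋₊) atTop (𝓝 t) := by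
  have h : ∀ k, dyadicAbove k t = dyadic k ⌊t * 2 ^ k⌋₊ + 2⁻¹ ^ k := by
    intro k
    unfold dyadicAbove dyadic
    push_cast
    rw [add_div, one_div, inv_pow]
  have h2 : ∀ k, dyadic k ⌊t * 2 ^ k⌋₊ = dyadicAbove k t - 2⁻¹ ^ k := fun k => by
    rw [h, add_tsub_cancel_right]
  simp_rw [h2]
  simpa using (tendsto_dyadicAbove t).sub tendsto_inv_two_pow

theorem dyadic_floor_le (k : ℕ) (t : ℝ≥0) : dyadic k ⌊t * 2 ^ k⌋₊ ≤ t := by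
  unfold dyadic
  rw [div_le_iff₀ (by positivity)]
  exact Nat.floor_le zero_le

/-- `T` is an optional time for the dyadic filtration of `X`. -/
def IsOptional {Ω E : Type*} [MeasurableSpace E] (X : ℝ≥0 → Ω → E) (T : Ω → ℝ≥0∞) : Prop :=
  ∀ r : ℝ≥0, MeasurableSet[dyadicPast X r] {ω | T ω < r}

variable {Ω : Type*} [MeasurableSpace Ω] {P : Measure Ω} {d : ℕ} {α : ℝ}
  {X : ℝ≥0 → Ω → EuclideanSpace ℝ (Fin d)} {T : Ω → ℝ≥0∞}

theorem IsOptional.measurable {E : Type*} [MeasurableSpace E] {X : ℝ≥0 → Ω → E}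
    (hT : IsOptional X T) (hX : ∀ t, Measurable (X t)) : Measurable T := by
  refine measurable_of_Iio fun a => ?_
  induction a using ENNReal.recTopCoe with
  | top =>
    have : T ⁻¹' Set.Iio ∞ = ⋃ N : ℕ, {ω | T ω < (N : ℝ≥0)} := by
      ext ω
      simp only [Set.mem_preimage, Set.mem_Iio, Set.mem_iUnion, Set.mem_ofPred_eq]
      constructor
      · intro h
        obtain ⟨N, hN⟩ := ENNReal.exists_nat_gt h.ne
        exact ⟨N, by simpa using hN⟩
      · rintro ⟨N, hN⟩
        exact hN.trans ENNReal.coe_lt_top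
    rw [this]
    exact MeasurableSet.iUnion fun N => dyadicPast_le hX _ _ (hT N)
  | coe a => exact dyadicPast_le hX _ _ (hT a)

theorem IsRegularStable.tendsto_dyadicAbove (hX : IsRegularStable P α X) (ω : Ω) (s : ℝ≥0) :
    Tendsto (fun k => X (dyadicAbove k s) ω) atTop (𝓝 (X s ω)) := by
  refine (hX.right_cont ω s).tendsto.comp ?_
  refine tendsto_nhdsWithin_iff.2 ⟨AlphaStable.tendsto_dyadicAbove s, ?_⟩
  exact Eventually.of_forall fun k => (lt_dyadicAbove k s).le

theorem IsRegularStable.measurable_dyadicAbove (hX : IsRegularStable P α X) {S : Ω → ℝ≥0}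
    (hS : Measurable S) (k : ℕ) : Measurable fun ω => X (dyadicAbove k (S ω)) ω := by
  have h1 : Measurable (Function.uncurry fun (i : ℕ) (ω : Ω) => X (dyadic k (i + 1)) ω) :=
    measurable_from_prod_countable_right fun i => by
      simpa only [Function.uncurry] using hX.stable.measurable (dyadic k (i + 1))
  have h2 : Measurable fun ω => ⌊S ω * 2 ^ k⌋₊ := Nat.measurable_floor.comp (hS.mul_const _)
  have h3 := h1.comp (h2.prodMk measurable_id)
  simpa only [Function.comp_def, Function.uncurry, dyadicAbove, id] using h3

theorem IsRegularStable.measurable_comp (hX : IsRegularStable P α X) {S : Ω → ℝ≥0}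
    (hS : Measurable S) : Measurable fun ω => X (S ω) ω :=
  measurable_of_tendsto_metrizable (fun k => hX.measurable_dyadicAbove hS k)
    (tendsto_pi_nhds.2 fun ω => hX.tendsto_dyadicAbove ω (S ω))

/-- The damping factor `exp (-a c)` as a complex number. -/
noncomputable def decay (c a : ℝ) : ℂ := Complex.exp ((-(a * c) : ℝ) : ℂ)

theorem norm_decay (c a : ℝ) : ‖decay c a‖ = Real.exp (-(a * c)) := by
  rw [decay, Complex.norm_exp_ofReal]

theorem norm_decay_le_one {c a : ℝ} (hc : 0 ≤ c) (ha : 0 ≤ a) : ‖decay c a‖ ≤ 1 := by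
  rw [norm_decay, Real.exp_le_one_iff]
  have := mul_nonneg ha hc
  linarith

theorem continuous_decay : Continuous fun p : ℝ × ℝ => decay p.1 p.2 := by
  unfold decay
  fun_prop

section StrongMarkov

variable [IsProbabilityMeasure P]

/-- On the event that `T` lies in a half-open grid cell, the approximation from above is the right
end of the cell, and the event belongs to the past of that end. The fixed-time Markov property
applies on each cell, and induction on `N` adds the cells. A strict approximation is what fits the
events `T < r` of an optional time. -/
theorem IsRegularStable.strongMarkov_discrete (hX : IsRegularStable P α X)
    (hT : IsOptional X T) (k : ℕ) (t : ℝ≥0) (ζ : EuclideanSpace ℝ (Fin d)) (N : ℕ)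
    (hN : dyadic k N ≤ t) :
    ∫ ω in {ω | T ω < dyadic k N}, expInner ζ (X t ω) ∂P =
      ∫ ω in {ω | T ω < dyadic k N}, expInner ζ (X (dyadicAbove k (T ω).toNNReal) ω) *
        decay (‖ζ‖ ^ α) (t - dyadicAbove k (T ω).toNNReal) ∂P := by
  have hm := hX.stable.measurable
  have hTm := hT.measurable hm
  have hint1 : Integrable (fun ω => expInner ζ (X t ω)) P := by
    refine Integrable.of_bound
      ((continuous_expInner ζ).measurable.comp (hm t)).aestronglyMeasurable 1
      (Eventually.of_forall fun ω => by simp)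
  have hmeas2 : Measurable fun ω => expInner ζ (X (dyadicAbove k (T ω).toNNReal) ω) *
        decay (‖ζ‖ ^ α) (t - dyadicAbove k (T ω).toNNReal) := by
    refine ((continuous_expInner ζ).measurable.comp
      (hX.measurable_dyadicAbove hTm.ennreal_toNNReal k)).mul ?_
    have h2 : Measurable fun ω => dyadicAbove k (T ω).toNNReal := by
      have h1 : Measurable (fun i : ℕ => dyadic k (i + 1)) := measurable_from_top
      exact h1.comp (Nat.measurable_floor.comp (hTm.ennreal_toNNReal.mul_const _))
    exact continuous_decay.measurable.comp
      (measurable_const.prodMk (measurable_const.sub h2.coe_nnreal_real))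
  have hc : 0 ≤ ‖ζ‖ ^ α := by positivity
  have hfloor : ∀ (N : ℕ) (ω : Ω), T ω < dyadic k N →
      ⌊(T ω).toNNReal * 2 ^ k⌋₊ + 1 ≤ N := by
    intro N ω hω
    have hne : T ω ≠ ∞ := (hω.trans ENNReal.coe_lt_top).ne
    have h1 : (T ω).toNNReal < dyadic k N := by
      rw [← ENNReal.coe_lt_coe, ENNReal.coe_toNNReal hne]
      exact hω
    unfold dyadic at h1
    rw [lt_div_iff₀ (by positivity)] at h1
    exact Nat.succ_le_of_lt ((Nat.floor_lt zero_le).2 h1)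
  have hint2 : ∀ N : ℕ, dyadic k N ≤ t → IntegrableOn (fun ω =>
      expInner ζ (X (dyadicAbove k (T ω).toNNReal) ω) *
        decay (‖ζ‖ ^ α) (t - dyadicAbove k (T ω).toNNReal)) {ω | T ω < dyadic k N} P := by
    intro N hN
    refine Measure.integrableOn_of_bounded (M := 1) (measure_ne_top _ _)
      hmeas2.aestronglyMeasurable ?_
    refine (ae_restrict_iff' (measurableSet_lt hTm measurable_const)).2
      (Eventually.of_forall fun ω hω => ?_)
    rw [norm_mul, norm_expInner, one_mul]
    refine norm_decay_le_one hc (sub_nonneg.2 ?_)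
    exact NNReal.coe_le_coe.2 ((dyadic_mono k (hfloor N ω hω)).trans hN)
  induction N with
  | zero => simp [dyadic]
  | succ N ih =>
    have hN' : dyadic k N ≤ t := (dyadic_mono k (Nat.le_succ N)).trans hN
    set A := {ω | (dyadic k N : ℝ≥0∞) ≤ T ω ∧ T ω < dyadic k (N + 1)} with hA
    have hAm : MeasurableSet[dyadicPast X (dyadic k (N + 1))] A := by
      have : A = {ω | T ω < dyadic k (N + 1)} \ {ω | T ω < dyadic k N} := by
        ext ω
        simp [hA, and_comm]
      rw [this]
      exact (hT _).diff (dyadicPast_mono (dyadic_mono k (Nat.le_succ N)) _ (hT _))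
    have hAm' : MeasurableSet A := dyadicPast_le hm _ _ hAm
    have hunion : {ω | T ω < dyadic k (N + 1)} = {ω | T ω < dyadic k N} ∪ A := by
      ext ω
      simp only [hA, Set.mem_ofPred_eq, Set.mem_union]
      constructor
      · intro h
        by_cases h' : T ω < dyadic k N
        · exact Or.inl h'
        · exact Or.inr ⟨not_lt.1 h', h⟩
      · rintro (h | h)
        · exact h.trans_le (by exact_mod_cast dyadic_mono k (Nat.le_succ N))
        · exact h.2
    have hdisj : Disjoint {ω | T ω < dyadic k N} A :=
      Set.disjoint_left.2 fun ω h1 h2 => absurd h1 (not_lt.2 h2.1)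
    have hi2 := hint2 (N + 1) hN
    rw [hunion] at hi2 ⊢
    rw [setIntegral_union hdisj hAm' hint1.integrableOn hint1.integrableOn,
      setIntegral_union hdisj hAm' hi2.left_of_union hi2.right_of_union, ih hN',
      hX.integral_indicator_expInner hN hAm ζ]
    congr 1
    refine setIntegral_congr_fun hAm' fun ω hω => ?_
    have hne : T ω ≠ ∞ := (hω.2.trans ENNReal.coe_lt_top).ne
    have h3 : ⌊(T ω).toNNReal * 2 ^ k⌋₊ + 1 = N + 1 := by
      refine le_antisymm (hfloor _ ω hω.2) ?_
      have h1 : dyadic k N ≤ (T ω).toNNReal := by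
        rw [← ENNReal.coe_le_coe, ENNReal.coe_toNNReal hne]
        exact hω.1
      unfold dyadic at h1
      rw [div_le_iff₀ (by positivity)] at h1
      exact Nat.succ_le_succ (Nat.le_floor h1)
    simp only [dyadicAbove, h3, decay]

/-- The grid approximations tend to `T` from the right, so right continuity and dominated
convergence carry the discrete identity to `T`. -/
theorem IsRegularStable.strongMarkov (hX : IsRegularStable P α X)
    (hT : IsOptional X T) (t : ℝ≥0) (ζ : EuclideanSpace ℝ (Fin d)) :
    ∫ ω in {ω | T ω ≤ t}, expInner ζ (X t ω) ∂P =
      ∫ ω in {ω | T ω ≤ t}, expInner ζ (X (T ω).toNNReal ω) *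
        decay (‖ζ‖ ^ α) (t - (T ω).toNNReal) ∂P := by
  have hm := hX.stable.measurable
  have hTm := hT.measurable hm
  have hc : 0 ≤ ‖ζ‖ ^ α := by positivity
  have hmeas1 : Measurable fun ω => expInner ζ (X t ω) :=
    (continuous_expInner ζ).measurable.comp (hm t)
  have hmeas3 : Measurable fun ω => expInner ζ (X (T ω).toNNReal ω) *
        decay (‖ζ‖ ^ α) (t - (T ω).toNNReal) :=
    ((continuous_expInner ζ).measurable.comp (hX.measurable_comp hTm.ennreal_toNNReal)).mul
      (continuous_decay.measurable.comp
        (measurable_const.prodMk (measurable_const.sub hTm.ennreal_toNNReal.coe_nnreal_real)))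
  have hmeas2 : ∀ k, Measurable fun ω => expInner ζ (X (dyadicAbove k (T ω).toNNReal) ω) *
        decay (‖ζ‖ ^ α) (t - dyadicAbove k (T ω).toNNReal) := by
    intro k
    refine ((continuous_expInner ζ).measurable.comp
      (hX.measurable_dyadicAbove hTm.ennreal_toNNReal k)).mul ?_
    have h2 : Measurable fun ω => dyadicAbove k (T ω).toNNReal := by
      have h1 : Measurable (fun i : ℕ => dyadic k (i + 1)) := measurable_from_top
      exact h1.comp (Nat.measurable_floor.comp (hTm.ennreal_toNNReal.mul_const _))
    exact continuous_decay.measurable.comp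
      (measurable_const.prodMk (measurable_const.sub h2.coe_nnreal_real))
  have hset : ∀ a : ℝ≥0∞, MeasurableSet {ω | T ω < a} := fun a =>
    measurableSet_lt hTm measurable_const
  set D : ℕ → ℝ≥0 := fun k => dyadic k ⌊t * 2 ^ k⌋₊ with hD
  have hDt : ∀ k, D k ≤ t := fun k => dyadic_floor_le k t
  have hevent : ∀ ω, T ω < t → ∀ᶠ k in atTop, T ω < D k := by
    intro ω hω
    have h1 : Tendsto (fun k => (D k : ℝ≥0∞)) atTop (𝓝 t) :=
      ENNReal.tendsto_coe.2 (tendsto_dyadic_floor t)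
    exact h1.eventually_const_lt hω
  have hnot : ∀ ω, ¬ T ω < t → ∀ k, ¬ T ω < D k := fun ω hω k h =>
    hω (h.trans_le (by exact_mod_cast hDt k))
  -- passage to the limit on the event `T < t`
  have hlt : ∫ ω in {ω | T ω < t}, expInner ζ (X t ω) ∂P =
      ∫ ω in {ω | T ω < t}, expInner ζ (X (T ω).toNNReal ω) *
        decay (‖ζ‖ ^ α) (t - (T ω).toNNReal) ∂P := by
    have hL : Tendsto (fun k => ∫ ω in {ω | T ω < D k}, expInner ζ (X t ω) ∂P) atTop
        (𝓝 (∫ ω in {ω | T ω < t}, expInner ζ (X t ω) ∂P)) := by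
      simp_rw [← integral_indicator (hset _)]
      refine tendsto_integral_of_dominated_convergence (fun _ => 1)
        (fun k => (hmeas1.indicator (hset _)).aestronglyMeasurable) (integrable_const _) ?_ ?_
      · refine fun k => Eventually.of_forall fun ω => ?_
        refine (norm_indicator_le_norm_self _ _).trans (by simp)
      · refine Eventually.of_forall fun ω => ?_
        by_cases hω : T ω < t
        · refine tendsto_const_nhds.congr' ?_
          filter_upwards [hevent ω hω] with k hk
          rw [Set.indicator_of_mem (show ω ∈ {ω | T ω < D k} from hk),
            Set.indicator_of_mem (show ω ∈ {ω | T ω < t} from hω)]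
        · refine tendsto_const_nhds.congr fun k => ?_
          rw [Set.indicator_of_notMem (show ω ∉ {ω | T ω < D k} from hnot ω hω k),
            Set.indicator_of_notMem (show ω ∉ {ω | T ω < t} from hω)]
    have hR : Tendsto (fun k => ∫ ω in {ω | T ω < D k},
          expInner ζ (X (dyadicAbove k (T ω).toNNReal) ω) *
            decay (‖ζ‖ ^ α) (t - dyadicAbove k (T ω).toNNReal) ∂P) atTop
        (𝓝 (∫ ω in {ω | T ω < t}, expInner ζ (X (T ω).toNNReal ω) *
        decay (‖ζ‖ ^ α) (t - (T ω).toNNReal) ∂P)) := by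
      simp_rw [← integral_indicator (hset _)]
      refine tendsto_integral_of_dominated_convergence (fun _ => 1)
        (fun k => ((hmeas2 k).indicator (hset _)).aestronglyMeasurable) (integrable_const _) ?_ ?_
      · refine fun k => Eventually.of_forall fun ω => ?_
        by_cases hω : T ω < D k
        · rw [Set.indicator_of_mem (show ω ∈ {ω | T ω < D k} from hω), norm_mul, norm_expInner,
            one_mul]
          refine norm_decay_le_one hc (sub_nonneg.2 ?_)
          have hne : T ω ≠ ∞ := (hω.trans ENNReal.coe_lt_top).ne
          have h1 : (T ω).toNNReal < D k := by
            rw [← ENNReal.coe_lt_coe, ENNReal.coe_toNNReal hne]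
            exact hω
          simp only [hD, dyadic] at h1
          rw [lt_div_iff₀ (by positivity)] at h1
          have h2 := Nat.succ_le_of_lt ((Nat.floor_lt zero_le).2 h1)
          exact NNReal.coe_le_coe.2 ((dyadic_mono k h2).trans (hDt k))
        · rw [Set.indicator_of_notMem (show ω ∉ {ω | T ω < D k} from hω)]
          simp
      · refine Eventually.of_forall fun ω => ?_
        by_cases hω : T ω < t
        · rw [Set.indicator_of_mem (show ω ∈ {ω | T ω < t} from hω)]
          have h1 : Tendsto (fun k => expInner ζ (X (dyadicAbove k (T ω).toNNReal) ω) *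
            decay (‖ζ‖ ^ α) (t - dyadicAbove k (T ω).toNNReal)) atTop
            (𝓝 (expInner ζ (X (T ω).toNNReal ω) *
              decay (‖ζ‖ ^ α) (t - (T ω).toNNReal))) := by
            refine (((continuous_expInner ζ).tendsto _).comp
              (hX.tendsto_dyadicAbove ω _)).mul ?_
            refine (continuous_decay.tendsto (‖ζ‖ ^ α, (t : ℝ) - (T ω).toNNReal)).comp
              (tendsto_const_nhds.prodMk_nhds (tendsto_const_nhds.sub ?_))
            exact (NNReal.tendsto_coe.2 (AlphaStable.tendsto_dyadicAbove _))
          refine h1.congr' ?_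
          filter_upwards [hevent ω hω] with k hk
          rw [Set.indicator_of_mem (show ω ∈ {ω | T ω < D k} from hk)]
        · refine tendsto_const_nhds.congr fun k => ?_
          rw [Set.indicator_of_notMem (show ω ∉ {ω | T ω < D k} from hnot ω hω k),
            Set.indicator_of_notMem (show ω ∉ {ω | T ω < t} from hω)]
    refine tendsto_nhds_unique hL (hR.congr fun k => ?_)
    exact (hX.strongMarkov_discrete hT k t ζ _ (hDt k)).symm
  -- The limit covers only `T < t`. On `T = t` the damping factor is `exp 0 = 1` and the two
  -- integrands coincide.
  have hunion : {ω | T ω ≤ t} = {ω | T ω < t} ∪ {ω | T ω = t} := by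
    ext ω
    simp [le_iff_lt_or_eq]
  have hdisj : Disjoint {ω | T ω < t} {ω | T ω = t} :=
    Set.disjoint_left.2 fun ω h1 h2 => absurd h2 (ne_of_lt h1)
  have heqm : MeasurableSet {ω | T ω = t} := measurableSet_eq_fun hTm measurable_const
  have hb : ∀ ω ∈ {ω | T ω ≤ t}, ‖expInner ζ (X (T ω).toNNReal ω) *
        decay (‖ζ‖ ^ α) (t - (T ω).toNNReal)‖ ≤ 1 := by
    intro ω hω
    rw [norm_mul, norm_expInner, one_mul]
    refine norm_decay_le_one hc (sub_nonneg.2 ?_)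
    have : (T ω).toNNReal ≤ t := ENNReal.toNNReal_mono ENNReal.coe_ne_top hω
    exact NNReal.coe_le_coe.2 this
  have hi1 : IntegrableOn (fun ω => expInner ζ (X t ω)) {ω | T ω ≤ t} P :=
    (Integrable.of_bound hmeas1.aestronglyMeasurable 1
      (Eventually.of_forall fun ω => by simp)).integrableOn
  have hi2 : IntegrableOn (fun ω => expInner ζ (X (T ω).toNNReal ω) *
        decay (‖ζ‖ ^ α) (t - (T ω).toNNReal)) {ω | T ω ≤ t} P :=
    Measure.integrableOn_of_bounded (M := 1) (measure_ne_top _ _) hmeas3.aestronglyMeasurable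
      ((ae_restrict_iff' (measurableSet_le hTm measurable_const)).2 (Eventually.of_forall hb))
  rw [hunion] at hi1 hi2 ⊢
  rw [setIntegral_union hdisj heqm hi1.left_of_union hi1.right_of_union,
    setIntegral_union hdisj heqm hi2.left_of_union hi2.right_of_union, hlt]
  congr 1
  refine setIntegral_congr_fun heqm fun ω hω => ?_
  have : T ω = t := hω
  simp [this, decay]

end StrongMarkov

end AlphaStable

/-! ### Laplace and Fourier transforms at optional times. -/

namespace AlphaStable

variable {Ω : Type*} [MeasurableSpace Ω] {P : Measure Ω} {d : ℕ} {α : ℝ}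
  {X : ℝ≥0 → Ω → EuclideanSpace ℝ (Fin d)} {T : Ω → ℝ≥0∞}

omit [MeasurableSpace Ω] in
theorem isOptional_zero {E : Type*} [MeasurableSpace E] (X : ℝ≥0 → Ω → E) :
    IsOptional X (fun _ => 0) := fun r => by
  by_cases h : (0 : ℝ≥0∞) < r
  · simp [h]
  · simp [h]

open Classical in
/-- The integrand of the occupation transform after the strong Markov property at time `T`. -/
noncomputable def occKernel (X : ℝ≥0 → Ω → EuclideanSpace ℝ (Fin d)) (α : ℝ) (T : Ω → ℝ≥0∞)
    (ζ : EuclideanSpace ℝ (Fin d)) (t : ℝ) (ω : Ω) : ℂ :=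
  if T ω ≤ ENNReal.ofReal t then
    expInner ζ (X (T ω).toNNReal ω) * decay (‖ζ‖ ^ α) (t - (T ω).toNNReal) else 0

/-- The function `t ↦ E[exp (i ζ·X_t); T ≤ t]`. -/
noncomputable def occ (P : Measure Ω) (X : ℝ≥0 → Ω → EuclideanSpace ℝ (Fin d)) (α : ℝ)
    (T : Ω → ℝ≥0∞) (ζ : EuclideanSpace ℝ (Fin d)) (t : ℝ) : ℂ :=
  ∫ ω, occKernel X α T ζ t ω ∂P

/-- The transform `E[exp (-q T + i ζ·X_T); T < ∞]`. -/
noncomputable def lap (P : Measure Ω) (X : ℝ≥0 → Ω → EuclideanSpace ℝ (Fin d))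
    (T : Ω → ℝ≥0∞) (q : ℝ) (ζ : EuclideanSpace ℝ (Fin d)) : ℂ :=
  ∫ ω in {ω | T ω < ∞}, decay q (T ω).toNNReal * expInner ζ (X (T ω).toNNReal ω) ∂P

omit [MeasurableSpace Ω] in
theorem norm_occKernel_le {t : ℝ} (ht : 0 ≤ t) (ζ : EuclideanSpace ℝ (Fin d)) (ω : Ω) :
    ‖occKernel X α T ζ t ω‖ ≤ 1 := by
  unfold occKernel
  split_ifs with h
  · rw [norm_mul, norm_expInner, one_mul]
    refine norm_decay_le_one (by positivity) (sub_nonneg.2 ?_)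
    have h1 : (T ω).toNNReal ≤ t.toNNReal := ENNReal.toNNReal_mono ENNReal.coe_ne_top h
    calc (((T ω).toNNReal : ℝ≥0) : ℝ) ≤ (t.toNNReal : ℝ) := NNReal.coe_le_coe.2 h1
      _ = t := Real.coe_toNNReal t ht
  · simp

theorem IsRegularStable.measurable_occKernel (hX : IsRegularStable P α X) (hT : Measurable T) :
    Measurable fun p : (EuclideanSpace ℝ (Fin d) × ℝ) × Ω =>
      occKernel X α T p.1.1 p.1.2 p.2 := by
  unfold occKernel
  refine Measurable.ite (measurableSet_le (hT.comp measurable_snd)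
    (ENNReal.measurable_ofReal.comp (measurable_snd.comp measurable_fst))) ?_ measurable_const
  refine Measurable.mul ?_ ?_
  · exact continuous_expInner_uncurry.measurable.comp ((measurable_fst.comp measurable_fst).prodMk
      ((hX.measurable_comp hT.ennreal_toNNReal).comp measurable_snd))
  · refine continuous_decay.measurable.comp (Measurable.prodMk ?_ ?_)
    · exact (measurable_fst.comp measurable_fst).norm.pow_const _
    · exact (measurable_snd.comp measurable_fst).sub
        (hT.ennreal_toNNReal.coe_nnreal_real.comp measurable_snd)

variable [IsProbabilityMeasure P]

theorem IsRegularStable.measurable_occ (hX : IsRegularStable P α X) (hT : Measurable T) :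
    StronglyMeasurable fun p : EuclideanSpace ℝ (Fin d) × ℝ => occ P X α T p.1 p.2 :=
  (hX.measurable_occKernel hT).stronglyMeasurable.integral_prod_right

theorem norm_occ_le {t : ℝ} (ht : 0 ≤ t) (ζ : EuclideanSpace ℝ (Fin d)) :
    ‖occ P X α T ζ t‖ ≤ 1 := by
  refine (norm_integral_le_of_norm_le_const (C := 1)
    (Eventually.of_forall fun ω => norm_occKernel_le ht ζ ω)).trans (by simp)

theorem IsRegularStable.occ_eq (hX : IsRegularStable P α X) (hT : IsOptional X T) {t : ℝ}
    (ht : 0 ≤ t) (ζ : EuclideanSpace ℝ (Fin d)) :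
    occ P X α T ζ t =
      ∫ ω in {ω | T ω ≤ t.toNNReal}, expInner ζ (X t.toNNReal ω) ∂P := by
  have hTm := hT.measurable hX.stable.measurable
  rw [hX.strongMarkov hT, ← integral_indicator (measurableSet_le hTm measurable_const)]
  refine integral_congr_ae (Eventually.of_forall fun ω => ?_)
  simp only [occKernel, Set.indicator_apply, Set.mem_ofPred_eq, Real.coe_toNNReal t ht]
  rfl

theorem decay_eq_cexp (c a : ℝ) : decay c a = Complex.exp (-(c : ℂ) * a) := by
  unfold decay
  push_cast
  ring_nf

theorem integral_decay_indicator {q c : ℝ} (hq : 0 < q) (hc : 0 ≤ c) {s : ℝ} (hs : 0 ≤ s) :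
    ∫ t in Set.Ioi (0 : ℝ), (Set.Ici s).indicator (fun t => decay q t * decay c (t - s)) t =
      decay q s / (q + c) := by
  have h0 : ∫ t in Set.Ioi (0 : ℝ), (Set.Ici s).indicator
      (fun t => decay q t * decay c (t - s)) t =
      ∫ t in Set.Ioi s, decay q t * decay c (t - s) := by
    rw [setIntegral_indicator measurableSet_Ici]
    refine setIntegral_congr_set ?_
    have h1 : (Set.Ioi 0 ∩ Set.Ioi s : Set ℝ) = Set.Ioi s := by
      rw [Set.Ioi_inter_Ioi, max_eq_right hs]
    have h2 : (Set.Ioi 0 ∩ Set.Ici s : Set ℝ) =ᵐ[volume] (Set.Ioi 0 ∩ Set.Ioi s : Set ℝ) :=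
      (ae_eq_refl _).inter Ioi_ae_eq_Ici.symm
    rwa [h1] at h2
  rw [h0]
  have hre : (-((q : ℂ) + c)).re < 0 := by
    simp only [Complex.neg_re, Complex.add_re, Complex.ofReal_re]
    linarith
  have hne : (q : ℂ) + c ≠ 0 := by
    intro h
    rw [h] at hre
    simp at hre
  have h3 : ∀ t : ℝ, decay q t * decay c (t - s) =
      Complex.exp ((c : ℂ) * s) * Complex.exp (-((q : ℂ) + c) * t) := by
    intro t
    rw [decay_eq_cexp, decay_eq_cexp, ← Complex.exp_add, ← Complex.exp_add]
    congr 1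
    push_cast
    ring
  simp_rw [h3]
  rw [integral_const_mul, integral_exp_mul_complex_Ioi hre, neg_div_neg_eq, decay_eq_cexp,
    ← mul_div_assoc, ← Complex.exp_add]
  congr 2
  ring

theorem integrable_decay_prod {β : Type*} [MeasurableSpace β] {ρ : Measure β} [SFinite ρ]
    {q : ℝ} (hq : 0 < q) {g : β → ℝ} (hg : Integrable g ρ) {F : β × ℝ → ℂ}
    (hF : AEStronglyMeasurable F (ρ.prod (volume.restrict (Set.Ioi (0 : ℝ)))))
    (hle : ∀ x t, 0 < t → ‖F (x, t)‖ ≤ g x * ‖decay q t‖) :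
    Integrable F (ρ.prod (volume.restrict (Set.Ioi (0 : ℝ)))) := by
  have h1 : Integrable (fun t : ℝ => ‖decay q t‖) (volume.restrict (Set.Ioi 0)) := by
    have h := integrableOn_exp_mul_Ioi (a := -q) (by linarith) 0
    refine h.congr (Eventually.of_forall fun t => ?_)
    simp only [norm_decay]
    congr 1
    ring
  refine (hg.mul_prod h1).mono' hF ?_
  have : ∀ᵐ z ∂(ρ.prod (volume.restrict (Set.Ioi (0 : ℝ)))), z.2 ∈ Set.Ioi (0 : ℝ) :=
    (Measure.quasiMeasurePreserving_snd (μ := ρ)).ae (ae_restrict_mem measurableSet_Ioi)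
  filter_upwards [this] with z hz
  exact hle z.1 z.2 hz

/-- By Fubini, for each path the time integral over `[T, ∞)` is an exponential integral, which
produces the factor `1 / (q + |ζ|^α)` and leaves the discounted character at `T`. -/
theorem IsRegularStable.integral_decay_occ (hX : IsRegularStable P α X) (hT : IsOptional X T)
    {q : ℝ} (hq : 0 < q) (ζ : EuclideanSpace ℝ (Fin d)) :
    ∫ t in Set.Ioi (0 : ℝ), decay q t * occ P X α T ζ t =
      lap P X T q ζ / (q + (‖ζ‖ ^ α : ℝ)) := by
  have hTm := hT.measurable hX.stable.measurable
  have hc : 0 ≤ ‖ζ‖ ^ α := by positivity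
  have hmeas : Measurable fun p : Ω × ℝ => decay q p.2 * occKernel X α T ζ p.2 p.1 := by
    refine Measurable.mul ?_ ?_
    · exact continuous_decay.measurable.comp (measurable_const.prodMk measurable_snd)
    · exact (hX.measurable_occKernel hTm).comp
        ((measurable_const.prodMk measurable_snd).prodMk measurable_fst)
  have hint := integrable_decay_prod (ρ := P) hq (integrable_const (1 : ℝ))
    hmeas.aestronglyMeasurable (fun ω t ht => by
      rw [norm_mul, mul_comm]
      gcongr
      exact norm_occKernel_le ht.le ζ ω)
  have hswap := integral_integral_swap (f := fun ω t => decay q t * occKernel X α T ζ t ω) hint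
  simp only [occ, ← integral_const_mul]
  rw [← hswap, lap, ← integral_indicator (measurableSet_lt hTm measurable_const),
    ← integral_div]
  refine integral_congr_ae (Eventually.of_forall fun ω => ?_)
  simp only
  by_cases hω : T ω < ∞
  · rw [Set.indicator_of_mem (show ω ∈ {ω | T ω < ∞} from hω)]
    have h1 := integral_decay_indicator hq hc (s := (T ω).toNNReal) (NNReal.coe_nonneg _)
    have h2 : ∀ t ∈ Set.Ioi (0 : ℝ), decay q t * occKernel X α T ζ t ω =
        expInner ζ (X (T ω).toNNReal ω) * (Set.Ici ((T ω).toNNReal : ℝ)).indicator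
          (fun t => decay q t * decay (‖ζ‖ ^ α) (t - (T ω).toNNReal)) t := by
      intro t ht
      have h3 : T ω ≤ ENNReal.ofReal t ↔ ((T ω).toNNReal : ℝ) ≤ t := by
        rw [ENNReal.le_ofReal_iff_toReal_le hω.ne (le_of_lt ht)]
        rfl
      unfold occKernel
      by_cases h : T ω ≤ ENNReal.ofReal t
      · rw [if_pos h, Set.indicator_of_mem (show t ∈ Set.Ici _ from h3.1 h)]
        ring
      · rw [if_neg h, Set.indicator_of_notMem (show t ∉ Set.Ici _ from fun h' => h (h3.2 h'))]
        simp
    rw [setIntegral_congr_fun measurableSet_Ioi h2, integral_const_mul, h1]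
    ring
  · rw [Set.indicator_of_notMem (show ω ∉ {ω | T ω < ∞} from hω)]
    have h2 : ∀ t, occKernel X α T ζ t ω = 0 := by
      intro t
      unfold occKernel
      rw [if_neg]
      intro h
      exact hω (h.trans_lt ENNReal.ofReal_lt_top)
    simp [h2]

/-- This takes the place of quasi-left-continuity; left limits of paths are not used. The Markov
identity expresses each transform through `X` at fixed times on the events `S m ≤ t`, and these
decrease to `T ≤ t`. -/
theorem IsRegularStable.tendsto_lap (hX : IsRegularStable P α X) {S : ℕ → Ω → ℝ≥0∞}
    (hS : ∀ m, IsOptional X (S m)) (hmono : ∀ ω, Monotone fun m => S m ω)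
    (hT : IsOptional X T) (hsup : ∀ ω, T ω = ⨆ m, S m ω)
    {q : ℝ} (hq : 0 < q) (ζ : EuclideanSpace ℝ (Fin d)) :
    Tendsto (fun m => lap P X (S m) q ζ) atTop (𝓝 (lap P X T q ζ)) := by
  have hm := hX.stable.measurable
  have hlim : Tendsto (fun m => ∫ t in Set.Ioi (0 : ℝ), decay q t * occ P X α (S m) ζ t) atTop
      (𝓝 (∫ t in Set.Ioi (0 : ℝ), decay q t * occ P X α T ζ t)) := by
    refine tendsto_integral_of_dominated_convergence (fun t => Real.exp (-q * t)) (fun m => ?_)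
      (integrableOn_exp_mul_Ioi (by linarith) 0) (fun m => ?_) ?_
    · refine StronglyMeasurable.aestronglyMeasurable ?_
      refine StronglyMeasurable.mul ?_ ?_
      · exact (continuous_decay.measurable.comp
          (measurable_const.prodMk measurable_id)).stronglyMeasurable
      · exact (hX.measurable_occ ((hS m).measurable hm)).comp_measurable
          (measurable_const.prodMk measurable_id)
    · refine (ae_restrict_iff' measurableSet_Ioi).2 (Eventually.of_forall fun t ht => ?_)
      rw [norm_mul, norm_decay, show -q * t = -(t * q) by ring]
      exact mul_le_of_le_one_right (Real.exp_pos _).le (norm_occ_le (le_of_lt ht) ζ)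
    · refine (ae_restrict_iff' measurableSet_Ioi).2 (Eventually.of_forall fun t ht => ?_)
      refine Tendsto.const_mul _ ?_
      have ht' : (0 : ℝ) ≤ t := le_of_lt ht
      rw [hX.occ_eq hT ht']
      simp_rw [fun m => hX.occ_eq (hS m) ht' ζ]
      have hset : {ω | T ω ≤ t.toNNReal} = ⋂ m, {ω | S m ω ≤ t.toNNReal} := by
        ext ω
        simp [hsup]
      rw [hset]
      refine tendsto_setIntegral_of_antitone
        (fun m => measurableSet_le ((hS m).measurable hm) measurable_const) ?_ ⟨0, ?_⟩
      · intro m m' hmm ω hω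
        exact (hmono ω hmm).trans hω
      · refine (Integrable.of_bound ((continuous_expInner ζ).measurable.comp
          (hm _)).aestronglyMeasurable 1 (Eventually.of_forall fun ω => by simp)).integrableOn
  simp_rw [fun m => hX.integral_decay_occ (hS m) hq ζ, hX.integral_decay_occ hT hq ζ] at hlim
  have hne : (q : ℂ) + (‖ζ‖ ^ α : ℝ) ≠ 0 := by
    have : (0 : ℝ) < q + ‖ζ‖ ^ α := by positivity
    exact_mod_cast this.ne'
  have := hlim.mul_const ((q : ℂ) + (‖ζ‖ ^ α : ℝ))
  simpa [div_mul_cancel₀ _ hne] using this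

theorem expInner_add_smul (a b x : EuclideanSpace ℝ (Fin d)) (η : ℝ) :
    expInner (a + η • b) x = expInner a x * Complex.exp ((η * inner ℝ x b : ℝ) * Complex.I) := by
  simp only [expInner, inner_add_right, inner_smul_right, Complex.ofReal_add, add_mul,
    Complex.exp_add]

/-- Averaging over the frequency line `a + η b` with weight `ψ η exp (i η y)` tests the coordinate
`y + ⟨X, b⟩` with a Fourier transform of `ψ`, while `a` is carried along as a frozen frequency. The
proof is two Fubini exchanges. -/
theorem IsRegularStable.integral_lap_eq (hX : IsRegularStable P α X) (hT : IsOptional X T)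
    (a b : EuclideanSpace ℝ (Fin d)) {ψ : ℝ → ℂ} (hψ : Integrable ψ) (y : ℝ)
    {q : ℝ} (hq : 0 < q) :
    ∫ η, ψ η * Complex.exp ((η * y : ℝ) * Complex.I) *
        (lap P X T q (a + η • b) / (q + (‖a + η • b‖ ^ α : ℝ))) =
      ∫ t in Set.Ioi (0 : ℝ), decay q t * ∫ ω in {ω | T ω ≤ t.toNNReal},
        expInner a (X t.toNNReal ω) *
        (∫ η, ψ η * Complex.exp ((η * (y + inner ℝ (X t.toNNReal ω) b) : ℝ) * Complex.I)) ∂P := by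
  have hm := hX.stable.measurable
  have hTm := hT.measurable hm
  have hcl : Continuous fun η : ℝ => a + η • b := by fun_prop
  have hce : Continuous fun η : ℝ => Complex.exp ((η * y : ℝ) * Complex.I) := by fun_prop
  have hmeas : AEStronglyMeasurable (fun p : ℝ × ℝ => ψ p.1 *
      Complex.exp ((p.1 * y : ℝ) * Complex.I) * (decay q p.2 * occ P X α T (a + p.1 • b) p.2))
      (volume.prod (volume.restrict (Set.Ioi (0 : ℝ)))) := by
    refine AEStronglyMeasurable.mul (AEStronglyMeasurable.mul ?_ ?_) ?_
    · exact hψ.aestronglyMeasurable.comp_fst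
    · exact (hce.comp continuous_fst).aestronglyMeasurable
    · refine (StronglyMeasurable.mul ?_ ?_).aestronglyMeasurable
      · exact (continuous_decay.measurable.comp
          (measurable_const.prodMk measurable_snd)).stronglyMeasurable
      · exact (hX.measurable_occ hTm).comp_measurable
          ((hcl.measurable.comp measurable_fst).prodMk measurable_snd)
  have hint := integrable_decay_prod hq hψ.norm hmeas (fun η t ht => by
    rw [norm_mul, norm_mul, norm_mul, Complex.norm_exp_ofReal_mul_I, mul_one]
    gcongr
    exact mul_le_of_le_one_right (norm_nonneg _) (norm_occ_le ht.le _))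
  have hswap := integral_integral_swap (f := fun η t => ψ η *
      Complex.exp ((η * y : ℝ) * Complex.I) * (decay q t * occ P X α T (a + η • b) t)) hint
  simp_rw [integral_const_mul, fun η : ℝ => hX.integral_decay_occ hT hq (a + η • b)] at hswap
  rw [hswap]
  refine setIntegral_congr_fun measurableSet_Ioi fun t ht => ?_
  have ht' : (0 : ℝ) ≤ t := le_of_lt ht
  simp_rw [fun η : ℝ => hX.occ_eq hT ht' (a + η • b)]
  simp_rw [mul_left_comm _ (decay q t)]
  rw [integral_const_mul]
  congr 1
  simp_rw [← integral_const_mul]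
  rw [integral_integral_swap]
  · refine integral_congr_ae (Eventually.of_forall fun ω => ?_)
    refine integral_congr_ae (Eventually.of_forall fun η => ?_)
    simp only
    rw [expInner_add_smul, mul_add, Complex.ofReal_add, add_mul, Complex.exp_add]
    ring
  · have h1 : Integrable (fun p : ℝ × Ω => ‖ψ p.1‖)
        (volume.prod (P.restrict {ω | T ω ≤ t.toNNReal})) := hψ.norm.comp_fst _
    refine h1.mono' ?_ (Eventually.of_forall fun p => ?_)
    · refine AEStronglyMeasurable.mul (AEStronglyMeasurable.mul ?_ ?_) ?_
      · exact hψ.aestronglyMeasurable.comp_fst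
      · exact (hce.measurable.comp measurable_fst).aestronglyMeasurable
      · have h2 : Measurable fun p : ℝ × Ω => expInner (a + p.1 • b) (X t.toNNReal p.2) :=
          continuous_expInner_uncurry.measurable.comp
            ((hcl.measurable.comp measurable_fst).prodMk ((hm _).comp measurable_snd))
        exact h2.aestronglyMeasurable
    · simp only [Function.uncurry]
      rw [norm_mul, norm_mul, norm_expInner, Complex.norm_exp_ofReal_mul_I, mul_one, mul_one]

theorem IsRegularStable.lap_zero (hX : IsRegularStable P α X) (q : ℝ)
    (ζ : EuclideanSpace ℝ (Fin d)) : lap P X (fun _ => 0) q ζ = 1 := by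
  simp [lap, hX.zero, decay]

/-- If the test function vanishes along the path before `T`, the restriction `T ≤ t` is void. The
value is then that of `T = 0`, whose transform is `1`. -/
theorem IsRegularStable.integral_lap_eq_of_vanishing (hX : IsRegularStable P α X)
    (hT : IsOptional X T) (a b : EuclideanSpace ℝ (Fin d)) {ψ : ℝ → ℂ} (hψ : Integrable ψ) (y : ℝ)
    {q : ℝ} (hq : 0 < q)
    (hvan : ∀ ω (t : ℝ≥0), (t : ℝ≥0∞) < T ω →
      ∫ η, ψ η * Complex.exp ((η * (y + inner ℝ (X t ω) b) : ℝ) * Complex.I) = 0) :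
    ∫ η, ψ η * Complex.exp ((η * y : ℝ) * Complex.I) *
        (lap P X T q (a + η • b) / (q + (‖a + η • b‖ ^ α : ℝ))) =
      ∫ η, ψ η * Complex.exp ((η * y : ℝ) * Complex.I) *
        (1 / (q + (‖a + η • b‖ ^ α : ℝ))) := by
  have h0 := hX.integral_lap_eq (isOptional_zero X) a b hψ y hq
  simp_rw [hX.lap_zero] at h0
  rw [h0, hX.integral_lap_eq hT a b hψ y hq]
  refine setIntegral_congr_fun measurableSet_Ioi fun t _ => ?_
  congr 1
  rw [setIntegral_eq_integral_of_forall_compl_eq_zero,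
    setIntegral_eq_integral_of_forall_compl_eq_zero]
  · intro ω hω
    simp at hω
  · intro ω hω
    rw [hvan ω _ (not_le.1 hω), mul_zero]

end AlphaStable

/-! ### A band-limited test function and hitting times of neighbourhoods of a level. -/

namespace AlphaStable

-- The choice is the Fourier transform of a smooth bump of mass one supported in the unit interval.
-- The mass gives `ψ 0 = 1`, inversion gives the vanishing, and the Schwartz class gives
-- integrability and boundedness. Dilation by `(2π)⁻¹` passes from the character `exp (2πi η y)` to
-- `exp (i η y)`.
open scoped FourierTransform in
theorem exists_fourier_compact_support : ∃ ψ : ℝ → ℂ, Integrable ψ ∧ Continuous ψ ∧ ψ 0 = 1 ∧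
    (∃ C : ℝ, ∀ η, ‖ψ η‖ ≤ C) ∧
    ∀ y : ℝ, 1 ≤ |y| → ∫ η, ψ η * Complex.exp ((η * y : ℝ) * Complex.I) = 0 := by
  let f : ContDiffBump (0 : ℝ) := ⟨1 / 2, 1, by norm_num, by norm_num⟩
  let F : ℝ → ℂ := fun y => (f.normed volume y : ℂ)
  have hFsupp : ∀ y, 1 ≤ |y| → F y = 0 := by
    intro y hy
    have h1 : y ∉ Function.support (f.normed volume) := by
      rw [f.support_normed_eq]
      simp [f, Real.norm_eq_abs, hy]
    simp only [F, Function.notMem_support.1 h1, Complex.ofReal_zero]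
  have hFc : HasCompactSupport F := f.hasCompactSupport_normed.comp_left Complex.ofReal_zero
  have hFs : ContDiff ℝ (⊤ : ℕ∞) F := Complex.ofRealCLM.contDiff.comp f.contDiff_normed
  let g : SchwartzMap ℝ ℂ := hFc.toSchwartzMap hFs
  let G : SchwartzMap ℝ ℂ := 𝓕 g
  have hinv : ∀ y, ∫ η, Complex.exp ((2 * Real.pi * (η * y) : ℝ) * Complex.I) * G η = F y := by
    intro y
    have h1 : 𝓕⁻ (𝓕 g) y = g y := by rw [FourierTransform.fourierInv_fourier_eq]
    have h2 : (𝓕⁻ (𝓕 g)) y = 𝓕⁻ (G : ℝ → ℂ) y := by rw [SchwartzMap.fourierInv_coe]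
    rw [h2, Real.fourierInv_eq'] at h1
    have h3 : g y = F y := rfl
    rw [← h3, ← h1]
    refine integral_congr_ae (Eventually.of_forall fun η => ?_)
    simp [mul_comm]
  have hG0 : G 0 = 1 := by
    have h1 : G 0 = 𝓕 (g : ℝ → ℂ) 0 := by
      simp only [G, SchwartzMap.fourier_coe]
    rw [h1, Real.fourier_eq']
    simp only [inner_zero_right, mul_zero, Complex.ofReal_zero, zero_mul, Complex.exp_zero,
      one_smul]
    have h2 : ∀ v, g v = ((f.normed volume v : ℝ) : ℂ) := fun v => rfl
    simp_rw [h2]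
    rw [integral_complex_ofReal, f.integral_normed, Complex.ofReal_one]
  have h2pi : (2 * Real.pi)⁻¹ ≠ 0 := by positivity
  refine ⟨fun η => G ((2 * Real.pi)⁻¹ * η), G.integrable.comp_mul_left' h2pi,
    G.continuous.comp (by fun_prop), by simp [hG0], ?_, ?_⟩
  · obtain ⟨C, hC⟩ := G.decay 0 0
    exact ⟨C, fun η => by simpa using hC.2 _⟩
  · intro y hy
    have h1 := Measure.integral_comp_mul_left
      (fun η => Complex.exp ((2 * Real.pi * (η * y) : ℝ) * Complex.I) * G η) (2 * Real.pi)⁻¹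
    rw [hinv, hFsupp y hy, smul_zero] at h1
    rw [← h1]
    refine integral_congr_ae (Eventually.of_forall fun η => ?_)
    simp only
    rw [mul_comm]
    congr 3
    have : (Real.pi : ℝ) ≠ 0 := Real.pi_ne_zero
    field_simp


variable {Ω : Type*} [MeasurableSpace Ω] {P : Measure Ω} {d : ℕ} {α : ℝ}
  {X : ℝ≥0 → Ω → EuclideanSpace ℝ (Fin d)} {T : Ω → ℝ≥0∞}

/-- The first dyadic time at which the coordinate `y + ⟨X, b⟩` is smaller than `ε`. -/
noncomputable def hitLevel (X : ℝ≥0 → Ω → EuclideanSpace ℝ (Fin d))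
    (b : EuclideanSpace ℝ (Fin d)) (y ε : ℝ) (ω : Ω) : ℝ≥0∞ :=
  ⨅ (j : ℕ) (k : ℕ) (_ : |y + inner ℝ (X (dyadic j k) ω) b| < ε), (dyadic j k : ℝ≥0∞)

omit [MeasurableSpace Ω] in
theorem hitLevel_lt_iff {b : EuclideanSpace ℝ (Fin d)} {y ε : ℝ} {ω : Ω} {r : ℝ≥0∞} :
    hitLevel X b y ε ω < r ↔
      ∃ j k, |y + inner ℝ (X (dyadic j k) ω) b| < ε ∧ (dyadic j k : ℝ≥0∞) < r := by
  simp [hitLevel, iInf_lt_iff]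

omit [MeasurableSpace Ω] in
theorem hitLevel_antitone (b : EuclideanSpace ℝ (Fin d)) (y : ℝ) (ω : Ω) :
    Antitone fun ε => hitLevel X b y ε ω := by
  intro ε ε' h
  refine le_iInf fun j => le_iInf fun k => le_iInf fun hk => ?_
  exact iInf_le_of_le j (iInf_le_of_le k (iInf_le_of_le (hk.trans_le h) le_rfl))

omit [MeasurableSpace Ω] in
theorem isOptional_hitLevel (b : EuclideanSpace ℝ (Fin d)) (y ε : ℝ) :
    IsOptional X (hitLevel X b y ε) := by
  intro r
  have h : {ω | hitLevel X b y ε ω < r} = ⋃ (j : ℕ) (k : ℕ) (_ : dyadic j k < r),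
      {ω | |y + inner ℝ (X (dyadic j k) ω) b| < ε} := by
    ext ω
    simp only [Set.mem_ofPred_eq, hitLevel_lt_iff, Set.mem_iUnion, ENNReal.coe_lt_coe, exists_prop]
    exact exists_congr fun j => exists_congr fun k => and_comm
  rw [h]
  refine MeasurableSet.iUnion fun j => MeasurableSet.iUnion fun k => MeasurableSet.iUnion fun hk =>
    ?_
  have h1 : Measurable fun x : EuclideanSpace ℝ (Fin d) => |y + inner ℝ x b| :=
    (by fun_prop : Continuous fun x : EuclideanSpace ℝ (Fin d) => |y + inner ℝ x b|).measurable
  have h2 := h1.comp (measurable_dyadicPast (X := X) hk.le)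
  exact h2 measurableSet_Iio

-- All `S m` may lie below `r` while their supremum equals `r`. Hence a dyadic time is inserted
-- strictly between the supremum and `r`.
omit [MeasurableSpace Ω] in
theorem isOptional_iSup {S : ℕ → Ω → ℝ≥0∞} (hS : ∀ m, IsOptional X (S m)) :
    IsOptional X (fun ω => ⨆ m, S m ω) := by
  intro r
  have h : {ω | ⨆ m, S m ω < r} = ⋃ (j : ℕ) (k : ℕ) (_ : dyadic j k < r),
      ⋂ m, {ω | S m ω < dyadic j k} := by
    ext ω
    simp only [Set.mem_ofPred_eq, Set.mem_iUnion, Set.mem_iInter, exists_prop]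
    constructor
    · intro h
      have hne : ⨆ m, S m ω ≠ ∞ := (h.trans ENNReal.coe_lt_top).ne
      set s := (⨆ m, S m ω).toNNReal with hs
      have hs' : (s : ℝ≥0∞) = ⨆ m, S m ω := ENNReal.coe_toNNReal hne
      rw [← hs', ENNReal.coe_lt_coe] at h
      obtain ⟨j, hj⟩ := ((tendsto_dyadicAbove s).eventually_lt_const h).exists
      refine ⟨j, _, hj, fun m => (le_iSup (fun m => S m ω) m).trans_lt ?_⟩
      rw [← hs', ENNReal.coe_lt_coe]
      exact lt_dyadicAbove j s
    · rintro ⟨j, k, hjk, hm⟩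
      exact (iSup_le fun m => (hm m).le).trans_lt (ENNReal.coe_lt_coe.2 hjk)
  rw [h]
  refine MeasurableSet.iUnion fun j => MeasurableSet.iUnion fun k => MeasurableSet.iUnion fun hk =>
    MeasurableSet.iInter fun m => ?_
  exact dyadicPast_mono hk.le _ (hS m _)

theorem IsRegularStable.right_cont_coord (hX : IsRegularStable P α X)
    (b : EuclideanSpace ℝ (Fin d)) (y : ℝ) (ω : Ω) (t : ℝ≥0) :
    ContinuousWithinAt (fun s => |y + inner ℝ (X s ω) b|) (Set.Ici t) t := by
  have h : Continuous fun x : EuclideanSpace ℝ (Fin d) => |y + inner ℝ x b| := by fun_prop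
  exact h.continuousAt.comp_continuousWithinAt (hX.right_cont ω t)

/-- Right continuity carries the strict inequality to dyadic times just after `t`, so an infimum
over dyadic times alone misses no entrance. -/
theorem IsRegularStable.hitLevel_le (hX : IsRegularStable P α X) {b : EuclideanSpace ℝ (Fin d)}
    {y ε : ℝ} {ω : Ω} {t : ℝ≥0} (h : |y + inner ℝ (X t ω) b| < ε) :
    hitLevel X b y ε ω ≤ t := by
  have h1 := (hX.right_cont_coord b y ω t).tendsto.eventually_lt_const h
  have h2 : Tendsto (fun k => dyadicAbove k t) atTop (𝓝[≥] t) :=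
    tendsto_nhdsWithin_iff.2 ⟨AlphaStable.tendsto_dyadicAbove t,
      Eventually.of_forall fun k => (lt_dyadicAbove k t).le⟩
  refine le_of_forall_gt fun r hr => ?_
  have h3 : ∀ᶠ k in atTop, (dyadicAbove k t : ℝ≥0∞) < r :=
    (ENNReal.tendsto_coe.2 (AlphaStable.tendsto_dyadicAbove t)).eventually_lt_const hr
  obtain ⟨k, hk1, hk2⟩ := ((h2.eventually h1).and h3).exists
  exact hitLevel_lt_iff.2 ⟨k, _, hk1, hk2⟩

/-- A value above `ε` at the infimum would persist on a short interval to its right, which contains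
a dyadic time where the coordinate is below `ε`. -/
theorem IsRegularStable.abs_hitLevel_le (hX : IsRegularStable P α X)
    {b : EuclideanSpace ℝ (Fin d)} {y ε : ℝ} {ω : Ω} (h : hitLevel X b y ε ω < ∞) :
    |y + inner ℝ (X (hitLevel X b y ε ω).toNNReal ω) b| ≤ ε := by
  by_contra hc
  rw [not_le] at hc
  set t := (hitLevel X b y ε ω).toNNReal with ht
  have htt : (t : ℝ≥0∞) = hitLevel X b y ε ω := ENNReal.coe_toNNReal h.ne
  have h1 := (hX.right_cont_coord b y ω t).tendsto.eventually_const_lt hc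
  rw [eventually_nhdsWithin_iff] at h1
  obtain ⟨r, hr, hrs⟩ := exists_Ico_subset_of_mem_nhds h1 ⟨t + 1, by simp⟩
  have h2 : hitLevel X b y ε ω < r := by
    rw [← htt]
    exact_mod_cast hr
  obtain ⟨j, k, hjk, hlt⟩ := hitLevel_lt_iff.1 h2
  have h3 : t ≤ dyadic j k := by
    rw [← ENNReal.coe_le_coe, htt]
    exact iInf_le_of_le j (iInf_le_of_le k (iInf_le_of_le hjk le_rfl))
  have h4 := hrs ⟨h3, by exact_mod_cast hlt⟩ h3
  exact absurd hjk (not_lt.2 (le_of_lt h4))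

end AlphaStable

/-! ### The resolvent identity at the hitting time of the level zero. -/

namespace AlphaStable

variable {Ω : Type*} [MeasurableSpace Ω] {P : Measure Ω} {d : ℕ} {α : ℝ}
  {X : ℝ≥0 → Ω → EuclideanSpace ℝ (Fin d)} {T : Ω → ℝ≥0∞}

/-- The condition `1 < α` enters here: the resolvent symbol of the one-dimensional coordinate is
integrable, which is the analytic reason why that coordinate hits points. -/
theorem integrable_inv_add_rpow {κ : ℝ} (hκ : 0 < κ) (hα : 1 < α) :
    Integrable fun η : ℝ => (κ + |η| ^ α)⁻¹ := by
  have h1 : Integrable fun η : ℝ => (1 + ‖η‖) ^ (-α) :=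
    integrable_one_add_norm (by simpa using hα)
  have hcont : Continuous fun η : ℝ => (κ + |η| ^ α)⁻¹ := by
    refine Continuous.inv₀ ?_ fun η => by positivity
    exact continuous_const.add (continuous_abs.rpow_const fun _ => Or.inr (by linarith))
  refine (h1.const_mul (2 ^ α * (1 + κ⁻¹))).mono' hcont.aestronglyMeasurable
    (Eventually.of_forall fun η => ?_)
  rw [Real.norm_of_nonneg (by positivity), Real.norm_eq_abs, Real.rpow_neg (by positivity),
    ← div_eq_mul_inv, le_div_iff₀ (by positivity), inv_mul_le_iff₀ (by positivity)]
  have h2 : (1 + |η|) ^ α ≤ 2 ^ α * (1 + |η| ^ α) := by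
    rcases le_total |η| 1 with h | h
    · calc (1 + |η|) ^ α ≤ 2 ^ α :=
            Real.rpow_le_rpow (by positivity) (by linarith) (by linarith)
        _ ≤ 2 ^ α * (1 + |η| ^ α) := by
            refine le_mul_of_one_le_right (by positivity) ?_
            have : 0 ≤ |η| ^ α := by positivity
            linarith
    · calc (1 + |η|) ^ α ≤ (2 * |η|) ^ α :=
            Real.rpow_le_rpow (by positivity) (by linarith) (by linarith)
        _ = 2 ^ α * |η| ^ α := Real.mul_rpow (by norm_num) (abs_nonneg _)
        _ ≤ 2 ^ α * (1 + |η| ^ α) := by gcongr; linarith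
  refine h2.trans ?_
  have h3 : (κ + |η| ^ α) * (2 ^ α * (1 + κ⁻¹)) =
      2 ^ α * (1 + κ + |η| ^ α + |η| ^ α * κ⁻¹) := by
    field_simp
    ring
  rw [h3]
  have : 0 ≤ |η| ^ α * κ⁻¹ := by positivity
  exact mul_le_mul_of_nonneg_left (by linarith) (by positivity)

theorem abs_rpow_le_norm_rpow (hα : 0 ≤ α) {a b : EuclideanSpace ℝ (Fin d)} (hb : ‖b‖ = 1)
    (hab : inner ℝ a b = 0) (η : ℝ) : |η| ^ α ≤ ‖a + η • b‖ ^ α := by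
  refine Real.rpow_le_rpow (abs_nonneg _) ?_ hα
  have h1 : ‖a + η • b‖ ^ 2 = ‖a‖ ^ 2 + η ^ 2 := by
    rw [norm_add_sq_real, inner_smul_right, hab, norm_smul, hb]
    simp
  refine abs_le_of_sq_le_sq' (a := |η|) (b := ‖a + η • b‖) ?_ (norm_nonneg _) |>.2
  rw [h1, sq_abs]
  have := sq_nonneg ‖a‖
  linarith

theorem norm_rpow_le_norm_rpow (hα : 0 ≤ α) {a b : EuclideanSpace ℝ (Fin d)}
    (hab : inner ℝ a b = 0) (η : ℝ) : ‖a‖ ^ α ≤ ‖a + η • b‖ ^ α := by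
  refine Real.rpow_le_rpow (norm_nonneg _) ?_ hα
  have h1 : ‖a + η • b‖ ^ 2 = ‖a‖ ^ 2 + ‖η • b‖ ^ 2 := by
    rw [norm_add_sq_real, inner_smul_right, hab]
    simp
  refine abs_le_of_sq_le_sq' (a := ‖a‖) (b := ‖a + η • b‖) ?_ (norm_nonneg _) |>.2
  rw [h1]
  have := sq_nonneg ‖η • b‖
  linarith

theorem norm_cexp_mul_I_sub_one_le (x : ℝ) : ‖Complex.exp (x * Complex.I) - 1‖ ≤ |x| := by
  rw [mul_comm]
  exact Real.norm_exp_I_mul_ofReal_sub_one_le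

variable [IsProbabilityMeasure P]

omit [IsProbabilityMeasure P] in
theorem IsRegularStable.measurable_lap_integrand (hX : IsRegularStable P α X) (hT : Measurable T)
    (q : ℝ) (ζ : EuclideanSpace ℝ (Fin d)) :
    Measurable fun ω => decay q (T ω).toNNReal * expInner ζ (X (T ω).toNNReal ω) :=
  (continuous_decay.measurable.comp
    (measurable_const.prodMk hT.ennreal_toNNReal.coe_nnreal_real)).mul
    ((continuous_expInner ζ).measurable.comp (hX.measurable_comp hT.ennreal_toNNReal))

theorem IsRegularStable.integrable_lap_integrand (hX : IsRegularStable P α X) (hT : Measurable T)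
    {q : ℝ} (hq : 0 ≤ q) (ζ : EuclideanSpace ℝ (Fin d)) :
    Integrable (fun ω => decay q (T ω).toNNReal * expInner ζ (X (T ω).toNNReal ω)) P :=
  Integrable.of_bound (hX.measurable_lap_integrand hT q ζ).aestronglyMeasurable 1
    (Eventually.of_forall fun ω => by
      rw [norm_mul, norm_expInner, mul_one]
      exact norm_decay_le_one hq (NNReal.coe_nonneg _))

omit [IsProbabilityMeasure P] in
theorem norm_lap_le [IsProbabilityMeasure P] {q : ℝ} (hq : 0 ≤ q)
    (ζ : EuclideanSpace ℝ (Fin d)) : ‖lap P X T q ζ‖ ≤ 1 := by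
  unfold lap
  refine (norm_setIntegral_le_of_norm_le_const (C := 1) (measure_lt_top _ _) fun ω _ => ?_).trans ?_
  · rw [norm_mul, norm_expInner, mul_one]
    exact norm_decay_le_one hq (NNReal.coe_nonneg _)
  · rw [one_mul]
    exact measureReal_le_one

/-- At time `T` the coordinate along `b` is within `δ` of `-y`, so the factor `exp (i η y)` cancels
the extra frequency `η b` up to `|η| δ`. -/
theorem IsRegularStable.norm_lap_sub_le (hX : IsRegularStable P α X) (hT : Measurable T)
    {q : ℝ} (hq : 0 ≤ q) (a b : EuclideanSpace ℝ (Fin d)) (y η : ℝ) {δ : ℝ}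
    (h0 : 0 ≤ δ)
    (hδ : ∀ ω, T ω < ∞ → |y + inner ℝ (X (T ω).toNNReal ω) b| ≤ δ) :
    ‖Complex.exp ((η * y : ℝ) * Complex.I) * lap P X T q (a + η • b) - lap P X T q a‖
      ≤ |η| * δ := by
  unfold lap
  rw [← integral_const_mul, ← integral_sub
    ((hX.integrable_lap_integrand hT hq _).const_mul _).integrableOn
    (hX.integrable_lap_integrand hT hq _).integrableOn]
  refine (norm_setIntegral_le_of_norm_le_const (C := |η| * δ) (measure_lt_top _ _)
    fun ω hω => ?_).trans ?_
  · have h1 : Complex.exp ((η * y : ℝ) * Complex.I) * (decay q (T ω).toNNReal *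
        expInner (a + η • b) (X (T ω).toNNReal ω)) -
        decay q (T ω).toNNReal * expInner a (X (T ω).toNNReal ω) =
        decay q (T ω).toNNReal * expInner a (X (T ω).toNNReal ω) *
        (Complex.exp ((η * (y + inner ℝ (X (T ω).toNNReal ω) b) : ℝ) * Complex.I) - 1) := by
      rw [expInner_add_smul, mul_add, Complex.ofReal_add, add_mul, Complex.exp_add]
      ring
    rw [h1, norm_mul, norm_mul, norm_expInner, mul_one]
    calc _ ≤ 1 * |η * (y + inner ℝ (X (T ω).toNNReal ω) b)| := by
          gcongr
          · exact norm_decay_le_one hq (NNReal.coe_nonneg _)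
          · exact norm_cexp_mul_I_sub_one_le _
      _ ≤ |η| * δ := by
          rw [one_mul, abs_mul]
          gcongr
          exact hδ ω hω
  · exact mul_le_of_le_one_right (by positivity) measureReal_le_one

/-- The hitting time of the level `0` by the coordinate `y + ⟨X, b⟩`, as a limit of the hitting
times of neighbourhoods. -/
noncomputable def hitZero (X : ℝ≥0 → Ω → EuclideanSpace ℝ (Fin d))
    (b : EuclideanSpace ℝ (Fin d)) (y : ℝ) (ω : Ω) : ℝ≥0∞ :=
  ⨆ m : ℕ, hitLevel X b y (1 / (m + 1)) ω

omit [MeasurableSpace Ω] in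
theorem isOptional_hitZero (b : EuclideanSpace ℝ (Fin d)) (y : ℝ) :
    IsOptional X (hitZero X b y) := isOptional_iSup fun _ => isOptional_hitLevel b y _

theorem IsRegularStable.tendsto_lap_hitZero (hX : IsRegularStable P α X)
    (b : EuclideanSpace ℝ (Fin d)) (y : ℝ) {q : ℝ} (hq : 0 < q) (ζ : EuclideanSpace ℝ (Fin d)) :
    Tendsto (fun m : ℕ => lap P X (hitLevel X b y (1 / (m + 1))) q ζ) atTop
      (𝓝 (lap P X (hitZero X b y) q ζ)) :=
  hX.tendsto_lap (fun _ => isOptional_hitLevel b y _)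
    (fun ω _ _ h => hitLevel_antitone b y ω (Nat.one_div_le_one_div h))
    (isOptional_hitZero b y) (fun _ => rfl) hq ζ

theorem IsRegularStable.tendsto_lap_hitLevel (hX : IsRegularStable P α X)
    (a b : EuclideanSpace ℝ (Fin d)) (y η : ℝ) {q : ℝ} (hq : 0 < q) :
    Tendsto (fun m : ℕ => Complex.exp ((η * y : ℝ) * Complex.I) *
      lap P X (hitLevel X b y (1 / (m + 1))) q (a + η • b)) atTop
      (𝓝 (lap P X (hitZero X b y) q a)) := by
  have h1 := hX.tendsto_lap_hitZero b y hq a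
  have h2 : Tendsto (fun m : ℕ => |η| * (1 / ((m : ℝ) + 1))) atTop (𝓝 0) := by
    simpa using tendsto_one_div_add_atTop_nhds_zero_nat.const_mul |η|
  have h3 := squeeze_zero_norm (fun m : ℕ => hX.norm_lap_sub_le
    ((isOptional_hitLevel b y (1 / ((m : ℝ) + 1))).measurable hX.stable.measurable) hq.le a b y η
    (by positivity) fun ω hω => hX.abs_hitLevel_le hω) h2
  simpa using h3.add h1

/-- The transforms at the approximating times have two limits: one from
`IsRegularStable.tendsto_lap_hitZero` with its frequency kept, and one from
`IsRegularStable.tendsto_lap_hitLevel` in which `η` has disappeared. At horizontal frequency `0`,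
equality of real parts says that `exp (-T) (1 - cos (η Y))` has integral zero over `T < ∞`, where
`T` is the limit time and `Y` the coordinate there. -/
theorem IsRegularStable.hitZero_coord (hX : IsRegularStable P α X)
    (b : EuclideanSpace ℝ (Fin d)) (y : ℝ) :
    ∀ᵐ ω ∂P, hitZero X b y ω < ∞ →
      y + inner ℝ (X (hitZero X b y ω).toNNReal ω) b = 0 := by
  have hTm := (isOptional_hitZero b y (X := X)).measurable hX.stable.measurable
  have hset : MeasurableSet {ω | hitZero X b y ω < ∞} := measurableSet_lt hTm measurable_const
  have key : ∀ η : ℝ, ∀ᵐ ω ∂P, hitZero X b y ω < ∞ →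
      Real.cos (η * (y + inner ℝ (X (hitZero X b y ω).toNNReal ω) b)) = 1 := by
    intro η
    have h1 := hX.tendsto_lap_hitLevel 0 b y η one_pos
    have h2 := (hX.tendsto_lap_hitZero b y one_pos (0 + η • b)).const_mul
      (Complex.exp ((η * y : ℝ) * Complex.I))
    have h3 := tendsto_nhds_unique h1 h2
    have hi1 := hX.integrable_lap_integrand hTm zero_le_one (0 : EuclideanSpace ℝ (Fin d))
    have hi2 := (hX.integrable_lap_integrand hTm zero_le_one (0 + η • b)).const_mul
      (Complex.exp ((η * y : ℝ) * Complex.I))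
    unfold lap at h3
    rw [← integral_const_mul, ← sub_eq_zero,
      ← integral_sub hi1.integrableOn hi2.integrableOn] at h3
    have h4 : ∫ ω in {ω | hitZero X b y ω < ∞}, Real.exp (-((hitZero X b y ω).toNNReal * 1)) *
        (1 - Real.cos (η * (y + inner ℝ (X (hitZero X b y ω).toNNReal ω) b))) ∂P = 0 := by
      have h5 := congrArg Complex.re h3
      have h6 := integral_re (𝕜 := ℂ) (hi1.sub hi2).integrableOn
          (μ := P.restrict {ω | hitZero X b y ω < ∞})
      simp only [RCLike.re_to_complex, Pi.sub_apply] at h6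
      rw [← h6] at h5
      rw [Complex.zero_re] at h5
      rw [← h5]
      refine integral_congr_ae (Eventually.of_forall fun ω => ?_)
      have h7 : ∀ x z : ℂ, ∀ w : ℂ, z * (w * x) = w * (z * x) := fun x z w => by ring
      simp only
      rw [expInner_add_smul, h7, ← mul_sub, decay, ← Complex.ofReal_exp, Complex.re_ofReal_mul]
      congr 1
      simp only [expInner, inner_zero_right, Complex.ofReal_zero, zero_mul, Complex.exp_zero,
        one_mul, Complex.sub_re, Complex.one_re]
      rw [← Complex.exp_add, ← add_mul, ← Complex.ofReal_add, ← mul_add,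
        Complex.exp_ofReal_mul_I_re]
    rw [integral_eq_zero_iff_of_nonneg_ae] at h4
    · rw [Filter.EventuallyEq, ae_restrict_iff' hset] at h4
      filter_upwards [h4] with ω hω hlt
      have := hω hlt
      simp only [Pi.zero_apply, mul_eq_zero, Real.exp_ne_zero, false_or] at this
      linarith
    · refine Eventually.of_forall fun ω => ?_
      have := Real.cos_le_one (η * (y + inner ℝ (X (hitZero X b y ω).toNNReal ω) b))
      exact mul_nonneg (Real.exp_pos _).le (by linarith)
    · have hm : Measurable fun ω => Real.exp (-((hitZero X b y ω).toNNReal * 1 : ℝ)) *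
        (1 - Real.cos (η * (y + inner ℝ (X (hitZero X b y ω).toNNReal ω) b))) := by
        have hc : Continuous fun x : EuclideanSpace ℝ (Fin d) =>
          1 - Real.cos (η * (y + inner ℝ x b)) := by fun_prop
        have h8 := hc.measurable.comp (hX.measurable_comp hTm.ennreal_toNNReal)
        have h9 : Measurable fun ω => Real.exp (-((hitZero X b y ω).toNNReal * 1 : ℝ)) :=
          Real.measurable_exp.comp (hTm.ennreal_toNNReal.coe_nnreal_real.mul_const _).neg
        exact h9.mul h8
      refine (Integrable.of_bound hm.aestronglyMeasurable 2
        (Eventually.of_forall fun ω => ?_)).integrableOn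
      have h1 := Real.cos_le_one (η * (y + inner ℝ (X (hitZero X b y ω).toNNReal ω) b))
      have h2 := Real.neg_one_le_cos (η * (y + inner ℝ (X (hitZero X b y ω).toNNReal ω) b))
      rw [Real.norm_eq_abs, abs_of_nonneg (mul_nonneg (Real.exp_pos _).le (by linarith))]
      have h3 : Real.exp (-((hitZero X b y ω).toNNReal * 1)) ≤ 1 := by
        rw [Real.exp_le_one_iff]
        simp
      calc _ ≤ 1 * (2 : ℝ) := mul_le_mul h3 (by linarith) (by linarith) zero_le_one
        _ = 2 := one_mul 2
  -- Countably many frequencies suffice: once `k > |Y|`, the argument lies in `(-1, 1)`, where the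
  -- cosine equals `1` only at `0`.
  have key' : ∀ᵐ ω ∂P, ∀ k : ℕ, hitZero X b y ω < ∞ →
      Real.cos ((1 / ((k : ℝ) + 1)) * (y + inner ℝ (X (hitZero X b y ω).toNNReal ω) b)) = 1 :=
    ae_all_iff.2 fun k => key _
  filter_upwards [key'] with ω hω hlt
  set Y := y + inner ℝ (X (hitZero X b y ω).toNNReal ω) b
  obtain ⟨k, hk⟩ := exists_nat_gt |Y|
  have h1 := hω k hlt
  have hk1 : (0 : ℝ) < k + 1 := by positivity
  have h2 : |1 / ((k : ℝ) + 1) * Y| < 1 := by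
    rw [abs_mul, abs_of_pos (by positivity), one_div, inv_mul_lt_iff₀ hk1]
    linarith
  have hpi := Real.pi_gt_three
  rw [abs_lt] at h2
  have h3 := (Real.cos_eq_one_iff_of_lt_of_lt (by linarith) (by linarith)).1 h1
  simpa [hk1.ne'] using h3


theorem tendsto_div_nat_succ (η : ℝ) : Tendsto (fun m : ℕ => η / ((m : ℝ) + 1)) atTop (𝓝 0) := by
  simpa [div_eq_mul_inv] using tendsto_one_div_add_atTop_nhds_zero_nat.const_mul η

/-- Before `S m` the coordinate stays at distance at least `1 / (m + 1)` from zero, exactly where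
the Fourier transform of the dilated cutoff `ψ (η / (m + 1))` vanishes. This gives an identity for
every `m`. In the limit the cutoff becomes `ψ 0 = 1` and the transform at `S m`, multiplied by `exp
(i η y)`, no longer depends on `η`, so it leaves the integral. -/
theorem IsRegularStable.integral_resolvent_eq (hX : IsRegularStable P α X) (hα : 1 < α)
    {a b : EuclideanSpace ℝ (Fin d)} (hb : ‖b‖ = 1) (hab : inner ℝ a b = 0) (y : ℝ)
    {q : ℝ} (hq : 0 < q) :
    ∫ η : ℝ, Complex.exp ((η * y : ℝ) * Complex.I) / (q + (‖a + η • b‖ ^ α : ℝ)) =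
      lap P X (hitZero X b y) q a * ∫ η : ℝ, 1 / ((q : ℂ) + (‖a + η • b‖ ^ α : ℝ)) := by
  obtain ⟨ψ, hψi, hψc, hψ0, ⟨C, hC⟩, hψv⟩ := exists_fourier_compact_support
  have hC0 : 0 ≤ C := (norm_nonneg _).trans (hC 0)
  set S : ℕ → Ω → ℝ≥0∞ := fun m => hitLevel X b y (1 / ((m : ℝ) + 1)) with hS
  have hDnorm : ∀ η : ℝ, ‖(1 : ℂ) / ((q : ℂ) + (‖a + η • b‖ ^ α : ℝ))‖ ≤ (q + |η| ^ α)⁻¹ := by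
    intro η
    have h1 : (q : ℂ) + (‖a + η • b‖ ^ α : ℝ) = ((q + ‖a + η • b‖ ^ α : ℝ) : ℂ) := by push_cast; rfl
    rw [h1, norm_div, norm_one, Complex.norm_real, Real.norm_of_nonneg (by positivity), one_div]
    have := abs_rpow_le_norm_rpow (by linarith : 0 ≤ α) hb hab η
    gcongr
  have hDcont : Continuous fun η : ℝ => (1 : ℂ) / ((q : ℂ) + (‖a + η • b‖ ^ α : ℝ)) := by
    refine continuous_const.div ?_ fun η => ?_
    · refine continuous_const.add (Complex.continuous_ofReal.comp ?_)
      exact (by fun_prop : Continuous fun η : ℝ => ‖a + η • b‖).rpow_const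
        fun _ => Or.inr (by linarith)
    · have : (0 : ℝ) < q + ‖a + η • b‖ ^ α := by positivity
      exact_mod_cast this.ne'
  have hbound := (integrable_inv_add_rpow hq hα).const_mul C
  have hψm : ∀ η, Tendsto (fun m : ℕ => ψ (η / ((m : ℝ) + 1))) atTop (𝓝 1) := fun η => by
    rw [← hψ0]
    exact (hψc.tendsto 0).comp (tendsto_div_nat_succ η)
  have hψmi : ∀ m : ℕ, Integrable fun η => ψ (η / ((m : ℝ) + 1)) := fun m =>
    hψi.comp_div (by positivity)
  have hψmc : ∀ m : ℕ, Continuous fun η => ψ (η / ((m : ℝ) + 1)) := fun m =>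
    hψc.comp (by fun_prop)
  have hexp : Continuous fun η : ℝ => Complex.exp ((η * y : ℝ) * Complex.I) := by fun_prop
  have hid : ∀ m : ℕ, ∫ η, ψ (η / ((m : ℝ) + 1)) * Complex.exp ((η * y : ℝ) * Complex.I) *
        (lap P X (S m) q (a + η • b) / (q + (‖a + η • b‖ ^ α : ℝ))) =
      ∫ η, ψ (η / ((m : ℝ) + 1)) * Complex.exp ((η * y : ℝ) * Complex.I) *
        (1 / (q + (‖a + η • b‖ ^ α : ℝ))) := by
    intro m
    refine hX.integral_lap_eq_of_vanishing (isOptional_hitLevel b y _) a b (hψmi m) y hq ?_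
    intro ω t ht
    have h1 : 1 / ((m : ℝ) + 1) ≤ |y + inner ℝ (X t ω) b| := by
      by_contra hc
      exact absurd (hX.hitLevel_le (not_le.1 hc)) (not_le.2 ht)
    have hm : (0 : ℝ) < (m : ℝ) + 1 := by positivity
    have h2 := hψv (((m : ℝ) + 1) * (y + inner ℝ (X t ω) b)) (by
      rw [abs_mul, abs_of_pos hm, mul_comm, ← div_le_iff₀ hm]
      exact h1)
    have h3 := Measure.integral_comp_div (fun η => ψ η * Complex.exp
      ((η * (((m : ℝ) + 1) * (y + inner ℝ (X t ω) b)) : ℝ) * Complex.I)) ((m : ℝ) + 1)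
    rw [h2, smul_zero] at h3
    rw [← h3]
    refine integral_congr_ae (Eventually.of_forall fun η => ?_)
    simp only
    congr 4
    field_simp
  have hR : Tendsto (fun m : ℕ => ∫ η, ψ (η / ((m : ℝ) + 1)) *
        Complex.exp ((η * y : ℝ) * Complex.I) * (1 / (q + (‖a + η • b‖ ^ α : ℝ)))) atTop
      (𝓝 (∫ η : ℝ, Complex.exp ((η * y : ℝ) * Complex.I) / (q + (‖a + η • b‖ ^ α : ℝ)))) := by
    refine tendsto_integral_of_dominated_convergence _
      (fun m => (((hψmc m).mul hexp).mul hDcont).aestronglyMeasurable) hbound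
      (fun m => Eventually.of_forall fun η => ?_) (Eventually.of_forall fun η => ?_)
    · rw [norm_mul, norm_mul, Complex.norm_exp_ofReal_mul_I, mul_one]
      exact mul_le_mul (hC _) (hDnorm η) (norm_nonneg _) hC0
    · have := ((hψm η).mul_const (Complex.exp ((η * y : ℝ) * Complex.I))).mul_const
        (1 / ((q : ℂ) + (‖a + η • b‖ ^ α : ℝ)))
      rw [one_mul, mul_one_div] at this
      exact this
  have hL : Tendsto (fun m : ℕ => ∫ η, ψ (η / ((m : ℝ) + 1)) *
        Complex.exp ((η * y : ℝ) * Complex.I) *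
        (lap P X (S m) q (a + η • b) / (q + (‖a + η • b‖ ^ α : ℝ)))) atTop
      (𝓝 (∫ η : ℝ, lap P X (hitZero X b y) q a * (1 / ((q : ℂ) + (‖a + η • b‖ ^ α : ℝ))))) := by
    refine tendsto_integral_of_dominated_convergence _
      (fun m => ?_) hbound
      (fun m => Eventually.of_forall fun η => ?_) (Eventually.of_forall fun η => ?_)
    · have h1 : StronglyMeasurable fun η : ℝ => lap P X (S m) q (a + η • b) := by
        have hTm := (isOptional_hitLevel b y (1 / ((m : ℝ) + 1)) (X := X)).measurable
          hX.stable.measurable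
        have h2 : Measurable fun p : ℝ × Ω => decay q (S m p.2).toNNReal *
            expInner (a + p.1 • b) (X (S m p.2).toNNReal p.2) := by
          refine Measurable.mul ?_ ?_
          · exact continuous_decay.measurable.comp (measurable_const.prodMk
              (hTm.ennreal_toNNReal.coe_nnreal_real.comp measurable_snd))
          · refine continuous_expInner_uncurry.measurable.comp (Measurable.prodMk ?_ ?_)
            · exact (by fun_prop : Continuous fun η : ℝ => a + η • b).measurable.comp
                measurable_fst
            · exact (hX.measurable_comp hTm.ennreal_toNNReal).comp measurable_snd
        exact h2.stronglyMeasurable.integral_prod_right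
      refine AEStronglyMeasurable.mul ((hψmc m).mul hexp).aestronglyMeasurable ?_
      have h3 := h1.aestronglyMeasurable (μ := volume).mul hDcont.aestronglyMeasurable
      refine h3.congr (Eventually.of_forall fun η => ?_)
      simp [div_eq_mul_inv]
    · rw [norm_mul, norm_mul, Complex.norm_exp_ofReal_mul_I, mul_one]
      refine mul_le_mul (hC _) ?_ (norm_nonneg _) hC0
      rw [div_eq_mul_one_div, norm_mul]
      exact (mul_le_of_le_one_left (norm_nonneg _) (norm_lap_le hq.le _)).trans (hDnorm η)
    · have h1 := ((hψm η).mul (hX.tendsto_lap_hitLevel a b y η hq)).mul_const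
        (1 / ((q : ℂ) + (‖a + η • b‖ ^ α : ℝ)))
      rw [one_mul] at h1
      refine h1.congr fun m => ?_
      simp only [hS]
      ring
  rw [integral_const_mul] at hL
  exact tendsto_nhds_unique hR (hL.congr hid)

theorem IsRegularStable.tendsto_lap_zero (hX : IsRegularStable P α X) (hT : Measurable T)
    (ζ : EuclideanSpace ℝ (Fin d)) :
    Tendsto (fun k : ℕ => lap P X T (1 / ((k : ℝ) + 1)) ζ) atTop
      (𝓝 (∫ ω in {ω | T ω < ∞}, expInner ζ (X (T ω).toNNReal ω) ∂P)) := by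
  unfold lap
  refine tendsto_integral_of_dominated_convergence (fun _ => 1)
    (fun k => (hX.measurable_lap_integrand hT _ ζ).aestronglyMeasurable) (integrable_const _)
    (fun k => Eventually.of_forall fun ω => ?_) (Eventually.of_forall fun ω => ?_)
  · rw [norm_mul, norm_expInner, mul_one]
    exact norm_decay_le_one (by positivity) (NNReal.coe_nonneg _)
  · have h1 : Tendsto (fun k : ℕ => decay (1 / ((k : ℝ) + 1)) (T ω).toNNReal) atTop (𝓝 1) := by
      have h2 : decay 0 (T ω).toNNReal = 1 := by simp [decay]
      rw [← h2]
      exact (continuous_decay.tendsto (0, ((T ω).toNNReal : ℝ))).comp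
        (tendsto_one_div_add_atTop_nhds_zero_nat.prodMk_nhds tendsto_const_nhds)
    simpa using h1.mul_const (expInner ζ (X (T ω).toNNReal ω))

/-- Orthogonality and `a ≠ 0` bound the denominators below by `‖a‖ ^ α` uniformly in the discount.
For `a = 0` the limiting integral of `|η| ^ (-α)` diverges at the origin, so that frequency is
excluded until the measures are compared. -/
theorem tendsto_integral_resolvent (hα : 1 < α) {a b : EuclideanSpace ℝ (Fin d)} (hb : ‖b‖ = 1)
    (hab : inner ℝ a b = 0) (ha : a ≠ 0) (y : ℝ) :
    Tendsto (fun k : ℕ => ∫ η : ℝ, Complex.exp ((η * y : ℝ) * Complex.I) /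
        (((1 / ((k : ℝ) + 1) : ℝ) : ℂ) + (‖a + η • b‖ ^ α : ℝ))) atTop
      (𝓝 (∫ η : ℝ, Complex.exp ((η * y : ℝ) * Complex.I) / (‖a + η • b‖ ^ α : ℝ))) := by
  have hκ : 0 < ‖a‖ ^ α := by positivity
  have hpos : ∀ η : ℝ, 0 < ‖a + η • b‖ ^ α := fun η =>
    hκ.trans_le (norm_rpow_le_norm_rpow (by linarith) hab η)
  refine tendsto_integral_of_dominated_convergence _ (fun k => ?_)
    ((integrable_inv_add_rpow hκ hα).const_mul 2)
    (fun k => Eventually.of_forall fun η => ?_) (Eventually.of_forall fun η => ?_)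
  · refine (Continuous.div (by fun_prop) ?_ fun η => ?_).aestronglyMeasurable
    · refine continuous_const.add (Complex.continuous_ofReal.comp ?_)
      exact (by fun_prop : Continuous fun η : ℝ => ‖a + η • b‖).rpow_const
        fun _ => Or.inr (by linarith)
    · have : (0 : ℝ) < 1 / ((k : ℝ) + 1) + ‖a + η • b‖ ^ α := by have := hpos η; positivity
      exact_mod_cast this.ne'
  · rw [norm_div, Complex.norm_exp_ofReal_mul_I, ← Complex.ofReal_add, Complex.norm_real]
    have h0 : (0 : ℝ) < 1 / ((k : ℝ) + 1) := by positivity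
    have h1 := hpos η
    have h2 := abs_rpow_le_norm_rpow (by linarith : 0 ≤ α) hb hab η
    have h3 := norm_rpow_le_norm_rpow (by linarith : 0 ≤ α) hab η
    rw [Real.norm_of_nonneg (by positivity), ← div_eq_mul_inv,
      div_le_div_iff₀ (by positivity) (by positivity)]
    linarith
  · refine Tendsto.div tendsto_const_nhds ?_ ?_
    · have h1 : Tendsto (fun k : ℕ => ((1 / ((k : ℝ) + 1) : ℝ) : ℂ)) atTop (𝓝 ((0 : ℝ) : ℂ)) :=
        (Complex.continuous_ofReal.tendsto 0).comp tendsto_one_div_add_atTop_nhds_zero_nat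
      simpa using h1.add_const (((‖a + η • b‖ ^ α : ℝ)) : ℂ)
    · exact_mod_cast (hpos η).ne'

theorem IsRegularStable.integral_potential_eq (hX : IsRegularStable P α X) (hα : 1 < α)
    {a b : EuclideanSpace ℝ (Fin d)} (hb : ‖b‖ = 1) (hab : inner ℝ a b = 0) (ha : a ≠ 0)
    (y : ℝ) :
    ∫ η : ℝ, Complex.exp ((η * y : ℝ) * Complex.I) / (‖a + η • b‖ ^ α : ℝ) =
      (∫ ω in {ω | hitZero X b y ω < ∞}, expInner a (X (hitZero X b y ω).toNNReal ω) ∂P) *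
        ∫ η : ℝ, 1 / ((‖a + η • b‖ ^ α : ℝ) : ℂ) := by
  have h1 := tendsto_integral_resolvent hα hb hab ha y
  have h2 := tendsto_integral_resolvent hα hb hab ha 0
  have h3 := hX.tendsto_lap_zero
    ((isOptional_hitZero b y (X := X)).measurable hX.stable.measurable) a
  simp only [mul_zero, Complex.ofReal_zero, zero_mul, Complex.exp_zero] at h2
  refine tendsto_nhds_unique h1 ((h3.mul h2).congr fun k => ?_)
  exact (hX.integral_resolvent_eq hα hb hab y (by positivity)).symm

end AlphaStable

/-! ### Gaussian mixtures and Bessel-type integrals. -/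

namespace AlphaStable

theorem integrableOn_rpow_mul_exp {s a : ℝ} (hs : 0 < s) (ha : 0 < a) :
    IntegrableOn (fun r : ℝ => r ^ (s - 1) * Real.exp (-(a * r))) (Set.Ioi 0) := by
  have h := integrableOn_rpow_mul_exp_neg_mul_rpow (s := s - 1) (p := 1) (b := a) (by linarith)
    one_pos ha
  refine h.congr_fun (fun r _ => ?_) measurableSet_Ioi
  simp

section Bessel

/-- The integral `∫_0^∞ s^(g-1) exp (-s a - b / (4 s)) ds`. -/
noncomputable def besselInt (g a b : ℝ) : ℝ :=
  ∫ s in Set.Ioi (0 : ℝ), s ^ (g - 1) * Real.exp (-(a * s) - b / (4 * s))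

theorem besselInt_zero_right {g a : ℝ} (hg : 0 < g) (ha : 0 < a) :
    besselInt g a 0 = Real.Gamma g * a ^ (-g) := by
  unfold besselInt
  simp only [zero_div, sub_zero]
  rw [Real.integral_rpow_mul_exp_neg_mul_Ioi hg ha, one_div, Real.inv_rpow ha.le,
    ← Real.rpow_neg ha.le, mul_comm]

/-- Substitute `s = (b / a) r`. The one-dimensional integral over the vertical frequency produces
the parameters `(‖ξ‖ ^ 2, y ^ 2)`, the Fourier transform of the Poisson kernel produces `(y ^ 2, ‖ξ‖
^ 2)`, and this symmetry matches them. -/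
theorem besselInt_swap {g a b : ℝ} (ha : 0 < a) (hb : 0 < b) :
    a ^ g * besselInt g a b = b ^ g * besselInt g b a := by
  have hc : 0 < b / a := by positivity
  have h := integral_comp_mul_left_Ioi
    (fun s : ℝ => s ^ (g - 1) * Real.exp (-(a * s) - b / (4 * s))) 0 hc
  rw [mul_zero] at h
  have h1 : ∫ x in Set.Ioi (0 : ℝ), (fun s : ℝ => s ^ (g - 1) *
      Real.exp (-(a * s) - b / (4 * s))) (b / a * x) = (b / a) ^ (g - 1) * besselInt g b a := by
    unfold besselInt
    rw [← integral_const_mul]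
    refine setIntegral_congr_fun measurableSet_Ioi fun x hx => ?_
    have hx' : (0 : ℝ) < x := hx
    simp only
    rw [Real.mul_rpow hc.le hx'.le, mul_assoc]
    congr 3
    field_simp
  rw [h1, smul_eq_mul] at h
  have h2 : besselInt g a b = b / a * ((b / a) ^ (g - 1) * besselInt g b a) := by
    rw [h, mul_inv_cancel_left₀ hc.ne']
    rfl
  rw [h2, Real.rpow_sub_one hc.ne', Real.div_rpow hb.le ha.le]
  have : a ^ g ≠ 0 := by positivity
  field_simp

end Bessel

section Mixture

variable {V : Type*} [NormedAddCommGroup V] [InnerProductSpace ℝ V] [FiniteDimensional ℝ V]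
  [MeasurableSpace V] [BorelSpace V]

theorem integrable_gaussian {s : ℝ} (hs : 0 < s) :
    Integrable fun z : V => Real.exp (-(s * ‖z‖ ^ 2)) := by
  have h := (GaussianFourier.integrable_cexp_neg_mul_sq_norm_add (V := V) (b := (s : ℂ))
    (by simpa using hs) 0 0).norm
  refine h.congr (Eventually.of_forall fun z => ?_)
  simp only [Complex.norm_exp]
  congr 1
  simp [← Complex.ofReal_pow]

theorem integral_gaussian_expInner {s : ℝ} (hs : 0 < s) (ξ : V) :
    ∫ z : V, expInner ξ z * (Real.exp (-(s * ‖z‖ ^ 2)) : ℝ) =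
      (((Real.pi / s) ^ (Module.finrank ℝ V / 2 : ℝ) * Real.exp (-(‖ξ‖ ^ 2 / (4 * s))) : ℝ) : ℂ)
          := by
  have h := GaussianFourier.integral_cexp_neg_mul_sq_norm_add (V := V) (b := (s : ℂ))
    (by simpa using hs) Complex.I ξ
  rw [Complex.ofReal_mul, Complex.ofReal_exp, Complex.ofReal_cpow (by positivity)]
  push_cast
  convert h using 2
  · ext z
    rw [expInner, ← Complex.exp_add, real_inner_comm]
    congr 1
    ring
  · congr 1
    rw [Complex.I_sq]
    ring

theorem integral_gaussian {s : ℝ} (hs : 0 < s) :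
    ∫ z : V, Real.exp (-(s * ‖z‖ ^ 2)) = (Real.pi / s) ^ (Module.finrank ℝ V / 2 : ℝ) := by
  rw [← GaussianFourier.integral_rexp_neg_mul_sq_norm hs]
  simp_rw [neg_mul]

/-- Integrating the Gaussian in space costs `s ^ (-dim / 2)`; the condition `dim / 2 < b` keeps the
remaining power of `s` integrable at zero, and `κ > 0` gives decay at infinity. -/
theorem integrable_mixture {b κ : ℝ} (hb : (Module.finrank ℝ V : ℝ) / 2 < b) (hκ : 0 < κ) (ξ : V) :
    Integrable (fun p : V × ℝ => expInner ξ p.1 *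
      ((p.2 ^ (b - 1) * Real.exp (-((‖p.1‖ ^ 2 + κ) * p.2)) : ℝ) : ℂ))
      ((volume : Measure V).prod (volume.restrict (Set.Ioi (0 : ℝ)))) := by
  have hmeas : Measurable (fun p : V × ℝ => expInner ξ p.1 *
      ((p.2 ^ (b - 1) * Real.exp (-((‖p.1‖ ^ 2 + κ) * p.2)) : ℝ) : ℂ)) := by
    refine ((continuous_expInner ξ).measurable.comp measurable_fst).mul ?_
    fun_prop
  have hsplit : ∀ (z : V) (s : ℝ), s ^ (b - 1) * Real.exp (-((‖z‖ ^ 2 + κ) * s)) =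
      s ^ (b - 1) * Real.exp (-(κ * s)) * Real.exp (-(s * ‖z‖ ^ 2)) := by
    intro z s
    rw [mul_assoc, ← Real.exp_add]
    ring_nf
  rw [integrable_prod_iff' hmeas.aestronglyMeasurable]
  constructor
  · refine (ae_restrict_iff' measurableSet_Ioi).2 (Eventually.of_forall fun s hs => ?_)
    have hs' : (0 : ℝ) < s := hs
    refine ((integrable_gaussian (V := V) hs').const_mul (s ^ (b - 1) * Real.exp (-(κ * s)))).mono'
      (hmeas.comp (measurable_id.prodMk measurable_const)).aestronglyMeasurable
      (Eventually.of_forall fun z => ?_)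
    rw [norm_mul, norm_expInner, one_mul, Complex.norm_real, Real.norm_of_nonneg (by positivity),
      hsplit]
  · have h1 := (integrableOn_rpow_mul_exp (s := b - Module.finrank ℝ V / 2) (by linarith)
      hκ).const_mul (Real.pi ^ (Module.finrank ℝ V / 2 : ℝ))
    refine IntegrableOn.congr_fun h1 (fun s hs => ?_) measurableSet_Ioi
    have hs' : (0 : ℝ) < s := hs
    have h2 : ∀ z : V, ‖expInner ξ z * ((s ^ (b - 1) * Real.exp (-((‖z‖ ^ 2 + κ) * s)) : ℝ) : ℂ)‖ =
        s ^ (b - 1) * Real.exp (-(κ * s)) * Real.exp (-(s * ‖z‖ ^ 2)) := by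
      intro z
      rw [norm_mul, norm_expInner, one_mul, Complex.norm_real, Real.norm_of_nonneg (by positivity),
        hsplit]
    simp only [h2]
    rw [integral_const_mul, integral_gaussian hs', Real.div_rpow Real.pi_pos.le hs'.le,
      show b - (Module.finrank ℝ V : ℝ) / 2 - 1 = b - 1 - (Module.finrank ℝ V : ℝ) / 2 by ring,
      Real.rpow_sub hs' (b - 1) (Module.finrank ℝ V / 2)]
    ring

theorem mixture_eq {b a : ℝ} (hb : 0 < b) (ha : 0 < a) :
    ∫ s in Set.Ioi (0 : ℝ), s ^ (b - 1) * Real.exp (-(a * s)) = Real.Gamma b * a ^ (-b) := by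
  rw [Real.integral_rpow_mul_exp_neg_mul_Ioi hb ha, one_div, Real.inv_rpow ha.le,
    ← Real.rpow_neg ha.le, mul_comm]

theorem integrable_expInner_rpow {b κ : ℝ} (hb : (Module.finrank ℝ V : ℝ) / 2 < b) (hκ : 0 < κ)
    (ξ : V) : Integrable fun z : V => expInner ξ z * (((‖z‖ ^ 2 + κ) ^ (-b) : ℝ) : ℂ) := by
  have hb0 : 0 < b := lt_of_le_of_lt (by positivity) hb
  have hΓ : (Real.Gamma b : ℂ) ≠ 0 := by exact_mod_cast (Real.Gamma_pos_of_pos hb0).ne'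
  have h := ((integrable_mixture hb hκ ξ).integral_prod_left).const_mul ((Real.Gamma b : ℂ)⁻¹)
  refine h.congr (Eventually.of_forall fun z => ?_)
  simp only
  rw [integral_const_mul, integral_complex_ofReal, mixture_eq hb0 (by positivity)]
  push_cast
  field_simp

theorem integral_expInner_rpow {b κ : ℝ} (hb : (Module.finrank ℝ V : ℝ) / 2 < b) (hκ : 0 < κ)
    (ξ : V) : ∫ z : V, expInner ξ z * (((‖z‖ ^ 2 + κ) ^ (-b) : ℝ) : ℂ) =
      ((Real.pi ^ (Module.finrank ℝ V / 2 : ℝ) / Real.Gamma b *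
        besselInt (b - Module.finrank ℝ V / 2) κ (‖ξ‖ ^ 2) : ℝ) : ℂ) := by
  have hb0 : 0 < b := lt_of_le_of_lt (by positivity) hb
  have hΓ : (Real.Gamma b : ℂ) ≠ 0 := by exact_mod_cast (Real.Gamma_pos_of_pos hb0).ne'
  have h1 : ∀ z : V, expInner ξ z * (((‖z‖ ^ 2 + κ) ^ (-b) : ℝ) : ℂ) =
      (Real.Gamma b : ℂ)⁻¹ * ∫ s in Set.Ioi (0 : ℝ), expInner ξ z *
        ((s ^ (b - 1) * Real.exp (-((‖z‖ ^ 2 + κ) * s)) : ℝ) : ℂ) := by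
    intro z
    rw [integral_const_mul, integral_complex_ofReal, mixture_eq hb0 (by positivity)]
    push_cast
    field_simp
  simp_rw [h1]
  rw [integral_const_mul, integral_integral_swap (integrable_mixture hb hκ ξ)]
  have h2 : ∀ s ∈ Set.Ioi (0 : ℝ), ∫ z : V, expInner ξ z *
        ((s ^ (b - 1) * Real.exp (-((‖z‖ ^ 2 + κ) * s)) : ℝ) : ℂ) =
      ((Real.pi ^ (Module.finrank ℝ V / 2 : ℝ) * (s ^ (b - Module.finrank ℝ V / 2 - 1) *
        Real.exp (-(κ * s) - ‖ξ‖ ^ 2 / (4 * s))) : ℝ) : ℂ) := by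
    intro s hs
    have hs' : (0 : ℝ) < s := hs
    have h3 : ∀ z : V, expInner ξ z *
        ((s ^ (b - 1) * Real.exp (-((‖z‖ ^ 2 + κ) * s)) : ℝ) : ℂ) =
        ((s ^ (b - 1) * Real.exp (-(κ * s)) : ℝ) : ℂ) *
          (expInner ξ z * (Real.exp (-(s * ‖z‖ ^ 2)) : ℝ)) := by
      intro z
      have : Real.exp (-((‖z‖ ^ 2 + κ) * s)) =
          Real.exp (-(κ * s)) * Real.exp (-(s * ‖z‖ ^ 2)) := by
        rw [← Real.exp_add]
        ring_nf
      rw [this]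
      push_cast
      ring
    simp_rw [h3]
    rw [integral_const_mul, integral_gaussian_expInner hs', ← Complex.ofReal_mul]
    congr 1
    rw [Real.div_rpow Real.pi_pos.le hs'.le,
      show b - (Module.finrank ℝ V : ℝ) / 2 - 1 = b - 1 - (Module.finrank ℝ V : ℝ) / 2 by ring,
      Real.rpow_sub hs' (b - 1) (Module.finrank ℝ V / 2), sub_eq_add_neg (-(κ * s)), Real.exp_add]
    ring
  rw [setIntegral_congr_fun measurableSet_Ioi h2, integral_complex_ofReal, integral_const_mul,
    ← besselInt]
  push_cast
  ring

end Mixture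

end AlphaStable

/-! ### Coordinates, the Poisson kernel and the law of the hitting place. -/

namespace AlphaStable

variable {n : ℕ}

section Coordinates

theorem horizontalPart_apply (x : EuclideanSpace ℝ (Fin (n + 1))) (i : Fin n) :
    horizontalPart x i = x i.castSucc := rfl

theorem boundaryPoint_castSucc (y : EuclideanSpace ℝ (Fin n)) (i : Fin n) :
    boundaryPoint y i.castSucc = y i := by
  simp [boundaryPoint]

theorem boundaryPoint_last (y : EuclideanSpace ℝ (Fin n)) :
    boundaryPoint y (Fin.last n) = 0 := by
  simp [boundaryPoint]

theorem horizontalPart_boundaryPoint (y : EuclideanSpace ℝ (Fin n)) :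
    horizontalPart (boundaryPoint y) = y := by
  ext i
  rw [horizontalPart_apply, boundaryPoint_castSucc]

theorem inner_boundaryPoint (x : EuclideanSpace ℝ (Fin (n + 1))) (ξ : EuclideanSpace ℝ (Fin n)) :
    inner ℝ x (boundaryPoint ξ) = inner ℝ (horizontalPart x) ξ := by
  simp [PiLp.inner_apply, Fin.sum_univ_castSucc, boundaryPoint_castSucc, boundaryPoint_last,
    horizontalPart_apply]

theorem inner_referencePoint (x : EuclideanSpace ℝ (Fin (n + 1))) :
    inner ℝ x (referencePoint n) = x (Fin.last n) := by
  simp [referencePoint, EuclideanSpace.inner_single_right]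

theorem norm_referencePoint : ‖referencePoint n‖ = 1 := by
  simp [referencePoint]

theorem norm_sq_eq_horizontal (x : EuclideanSpace ℝ (Fin (n + 1))) :
    ‖x‖ ^ 2 = ‖horizontalPart x‖ ^ 2 + x (Fin.last n) ^ 2 := by
  simp [EuclideanSpace.norm_sq_eq, Fin.sum_univ_castSucc, horizontalPart_apply]

theorem eq_boundaryPoint_of_last_eq_zero {x : EuclideanSpace ℝ (Fin (n + 1))}
    (h : x (Fin.last n) = 0) : x = boundaryPoint (horizontalPart x) := by
  ext i
  refine Fin.lastCases ?_ (fun i => ?_) i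
  · rw [h, boundaryPoint_last]
  · rw [boundaryPoint_castSucc, horizontalPart_apply]

theorem continuous_horizontalPart :
    Continuous (horizontalPart : EuclideanSpace ℝ (Fin (n + 1)) → _) := by
  refine (PiLp.continuous_toLp 2 _).comp (continuous_pi fun i => ?_)
  exact (EuclideanSpace.proj (𝕜 := ℝ) i.castSucc).continuous

theorem continuous_boundaryPoint :
    Continuous (boundaryPoint : EuclideanSpace ℝ (Fin n) → _) := by
  refine (PiLp.continuous_toLp 2 _).comp (continuous_pi fun i => ?_)
  refine Fin.lastCases ?_ (fun i => ?_) i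
  · simpa using continuous_const
  · simpa using (EuclideanSpace.proj (𝕜 := ℝ) i).continuous

theorem continuous_last : Continuous fun x : EuclideanSpace ℝ (Fin (n + 1)) => x (Fin.last n) :=
  (EuclideanSpace.proj (𝕜 := ℝ) (Fin.last n)).continuous

end Coordinates

/-- The Poisson kernel `c t^γ (|z|² + t²)^(-(n + γ)/2)` on `ℝ^n`. -/
noncomputable def poissonDensity (n : ℕ) (γ t : ℝ) (z : EuclideanSpace ℝ (Fin n)) : ℝ :=
  Real.Gamma ((n + γ) / 2) / (Real.pi ^ ((n : ℝ) / 2) * Real.Gamma (γ / 2)) * t ^ γ *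
    (‖z‖ ^ 2 + t ^ 2) ^ (-((n + γ) / 2))

section Poisson

variable {γ t : ℝ}

theorem poissonDensity_pos (hγ : 0 < γ) (ht : 0 < t) (z : EuclideanSpace ℝ (Fin n)) :
    0 < poissonDensity n γ t z := by
  unfold poissonDensity
  have h1 : 0 < Real.Gamma ((n + γ) / 2) := Real.Gamma_pos_of_pos (by positivity)
  have h2 : 0 < Real.Gamma (γ / 2) := Real.Gamma_pos_of_pos (by positivity)
  positivity

theorem continuous_poissonDensity (ht : 0 < t) : Continuous (poissonDensity n γ t) := by
  unfold poissonDensity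
  refine continuous_const.mul (Continuous.rpow_const (by fun_prop) fun z => Or.inl ?_)
  positivity

theorem finrank_half_lt (hγ : 0 < γ) :
    (Module.finrank ℝ (EuclideanSpace ℝ (Fin n)) : ℝ) / 2 < (n + γ) / 2 := by
  simp only [finrank_euclideanSpace, Fintype.card_fin]
  linarith

theorem integrable_poissonDensity (hγ : 0 < γ) (ht : 0 < t) :
    Integrable (poissonDensity n γ t) := by
  have h := (integrable_expInner_rpow (V := EuclideanSpace ℝ (Fin n)) (finrank_half_lt hγ)
    (by positivity : 0 < t ^ 2) 0).norm
  unfold poissonDensity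
  refine Integrable.const_mul (h.congr (Eventually.of_forall fun z => ?_)) _
  simp only [norm_mul, norm_expInner, one_mul, Complex.norm_real]
  exact Real.norm_of_nonneg (by positivity)

theorem sq_rpow_half {t : ℝ} (ht : 0 ≤ t) (γ : ℝ) : (t ^ 2) ^ (γ / 2) = t ^ γ := by
  rw [← Real.rpow_natCast, ← Real.rpow_mul ht]
  congr 1
  push_cast
  ring

theorem integral_expInner_poissonDensity (hγ : 0 < γ) (ht : 0 < t) (ξ : EuclideanSpace ℝ (Fin n)) :
    ∫ z, expInner ξ z * (poissonDensity n γ t z : ℂ) =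
      ((t ^ γ / Real.Gamma (γ / 2) * besselInt (γ / 2) (t ^ 2) (‖ξ‖ ^ 2) : ℝ) : ℂ) := by
  have h := integral_expInner_rpow (V := EuclideanSpace ℝ (Fin n)) (finrank_half_lt hγ)
    (by positivity : 0 < t ^ 2) ξ
  simp only [finrank_euclideanSpace, Fintype.card_fin] at h
  rw [show ((n : ℝ) + γ) / 2 - n / 2 = γ / 2 by ring] at h
  have h1 : ∀ z, expInner ξ z * (poissonDensity n γ t z : ℂ) =
      ((Real.Gamma ((n + γ) / 2) / (Real.pi ^ ((n : ℝ) / 2) * Real.Gamma (γ / 2)) * t ^ γ : ℝ) :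
          ℂ) *
      (expInner ξ z * (((‖z‖ ^ 2 + t ^ 2) ^ (-((n + γ) / 2)) : ℝ) : ℂ)) := by
    intro z
    unfold poissonDensity
    push_cast
    ring
  simp_rw [h1]
  rw [integral_const_mul, h, ← Complex.ofReal_mul]
  congr 1
  have h2 : Real.Gamma ((n + γ) / 2) ≠ 0 := (Real.Gamma_pos_of_pos (by positivity)).ne'
  have h3 : Real.Gamma (γ / 2) ≠ 0 := (Real.Gamma_pos_of_pos (by positivity)).ne'
  have h4 : Real.pi ^ ((n : ℝ) / 2) ≠ 0 := by positivity
  field_simp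

theorem integral_poissonDensity (hγ : 0 < γ) (ht : 0 < t) :
    ∫ z, poissonDensity n γ t z = 1 := by
  have h := integral_expInner_poissonDensity (n := n) hγ ht 0
  have h1 : ∀ z : EuclideanSpace ℝ (Fin n), expInner 0 z = 1 := fun z => by simp [expInner]
  simp only [h1, one_mul, norm_zero] at h
  rw [integral_complex_ofReal] at h
  have h2 := Complex.ofReal_injective h
  rw [h2, zero_pow two_ne_zero, besselInt_zero_right (by positivity) (by positivity),
    Real.rpow_neg (by positivity), sq_rpow_half ht.le]
  have h3 : Real.Gamma (γ / 2) ≠ 0 := (Real.Gamma_pos_of_pos (by positivity)).ne'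
  have h4 : t ^ γ ≠ 0 := by positivity
  field_simp

end Poisson

theorem norm_boundaryPoint_add_smul_rpow (α : ℝ) (ξ : EuclideanSpace ℝ (Fin n)) (η : ℝ) :
    ‖boundaryPoint ξ + η • referencePoint n‖ ^ α = (‖η‖ ^ 2 + ‖ξ‖ ^ 2) ^ (α / 2) := by
  rw [← sq_rpow_half (norm_nonneg _), norm_add_sq_real, inner_smul_right, inner_referencePoint,
    boundaryPoint_last, norm_smul, norm_referencePoint, norm_sq_eq_horizontal (boundaryPoint ξ),
    boundaryPoint_last, horizontalPart_boundaryPoint]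
  congr 1
  ring

theorem integral_potential_hyperplane {α : ℝ} (hα : 1 < α) {ξ : EuclideanSpace ℝ (Fin n)}
    (hξ : ξ ≠ 0) (y : ℝ) :
    ∫ η : ℝ, Complex.exp ((η * y : ℝ) * Complex.I) /
      (‖boundaryPoint ξ + η • referencePoint n‖ ^ α : ℝ) =
      ((Real.pi ^ ((1 : ℝ) / 2) / Real.Gamma (α / 2) *
        besselInt ((α - 1) / 2) (‖ξ‖ ^ 2) (y ^ 2) : ℝ) : ℂ) := by
  have h := integral_expInner_rpow (V := ℝ) (b := α / 2) (κ := ‖ξ‖ ^ 2)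
    (by simp only [Module.finrank_self, Nat.cast_one]; linarith) (by positivity) y
  simp only [Module.finrank_self, Nat.cast_one, Real.norm_eq_abs, sq_abs] at h
  rw [show α / 2 - 1 / 2 = (α - 1) / 2 by ring] at h
  rw [← h]
  refine integral_congr_ae (Eventually.of_forall fun η => ?_)
  simp only
  rw [norm_boundaryPoint_add_smul_rpow, Real.norm_eq_abs, sq_abs, Real.rpow_neg (by positivity),
    Complex.ofReal_inv, div_eq_mul_inv]
  congr 2
  simp [mul_comm]

/-- The potential identity presents the left side as the quotient of the vertical frequency
integrals at heights `y` and `0`. The one at height `0` is a nonzero Gamma integral, called `c`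
below, and `besselInt_swap` turns the quotient into the transform of the Poisson kernel. -/
theorem IsRegularStable.charFun_hitZero {Ω : Type*} [MeasurableSpace Ω] {P : Measure Ω}
    [IsProbabilityMeasure P] {α : ℝ} {X : ℝ≥0 → Ω → EuclideanSpace ℝ (Fin (n + 1))}
    (hX : IsRegularStable P α X) (hα : 1 < α) {ξ : EuclideanSpace ℝ (Fin n)} (hξ : ξ ≠ 0)
    {y : ℝ} (hy : y ≠ 0) :
    ∫ ω in {ω | hitZero X (referencePoint n) y ω < ∞},
      expInner ξ (horizontalPart (X (hitZero X (referencePoint n) y ω).toNNReal ω)) ∂P =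
      ∫ z, expInner ξ z * (poissonDensity n (α - 1) |y| z : ℂ) := by
  have hγ : 0 < α - 1 := by linarith
  have ha : boundaryPoint ξ ≠ 0 := by
    intro h
    apply hξ
    rw [← horizontalPart_boundaryPoint ξ, h]
    rfl
  have h := hX.integral_potential_eq hα (norm_referencePoint (n := n)) (a := boundaryPoint ξ)
    (by rw [inner_referencePoint, boundaryPoint_last]) ha y
  have h0 := integral_potential_hyperplane hα hξ 0
  simp only [mul_zero, Complex.ofReal_zero, zero_mul, Complex.exp_zero] at h0
  rw [integral_potential_hyperplane hα hξ, h0] at h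
  have h1 : ∀ x, expInner (boundaryPoint ξ) x = expInner ξ (horizontalPart x) := fun x => by
    simp only [expInner, inner_boundaryPoint]
  simp only [h1] at h
  rw [integral_expInner_poissonDensity hγ (abs_pos.2 hy)]
  set I := ∫ ω in {ω | hitZero X (referencePoint n) y ω < ∞},
      expInner ξ (horizontalPart (X (hitZero X (referencePoint n) y ω).toNNReal ω)) ∂P
  have hρ : 0 < ‖ξ‖ := norm_pos_iff.2 hξ
  rw [zero_pow two_ne_zero, besselInt_zero_right (by positivity) (by positivity),
    Real.rpow_neg (by positivity), sq_rpow_half hρ.le] at h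
  have hsw := besselInt_swap (g := (α - 1) / 2) (a := ‖ξ‖ ^ 2) (b := y ^ 2) (by positivity)
    (by positivity)
  rw [sq_rpow_half hρ.le, ← sq_abs y, sq_rpow_half (abs_nonneg y)] at hsw
  rw [← sq_abs y] at h
  have hΓ1 : Real.Gamma (α / 2) ≠ 0 := (Real.Gamma_pos_of_pos (by linarith)).ne'
  have hΓ2 : Real.Gamma ((α - 1) / 2) ≠ 0 := (Real.Gamma_pos_of_pos (by linarith)).ne'
  have hπ : Real.pi ^ ((1 : ℝ) / 2) ≠ 0 := by positivity
  have hρ' : ‖ξ‖ ^ (α - 1) ≠ 0 := by positivity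
  set c : ℝ := Real.pi ^ ((1 : ℝ) / 2) / Real.Gamma (α / 2) *
    (Real.Gamma ((α - 1) / 2) * (‖ξ‖ ^ (α - 1))⁻¹) with hc
  have hc0 : (c : ℂ) ≠ 0 := by
    have : c ≠ 0 := by
      rw [hc]
      positivity
    exact_mod_cast this
  refine mul_right_cancel₀ hc0 ?_
  rw [← h, ← Complex.ofReal_mul]
  congr 1
  rw [hc]
  have h2 : |y| ^ (α - 1) / Real.Gamma ((α - 1) / 2) * besselInt ((α - 1) / 2) (|y| ^ 2) (‖ξ‖ ^ 2)
      = (‖ξ‖ ^ (α - 1) * besselInt ((α - 1) / 2) (‖ξ‖ ^ 2) (|y| ^ 2)) /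
        Real.Gamma ((α - 1) / 2) := by
    rw [hsw]
    ring
  rw [h2]
  field_simp

end AlphaStable

/-! ### The harmonic measure of the complement of the hyperplane. -/

namespace AlphaStable

variable {n : ℕ}

/-- The measure on `ℝ^n` with density the Poisson kernel centred at the foot of `x`. -/
noncomputable def poissonMeasure (n : ℕ) (γ : ℝ) (x : EuclideanSpace ℝ (Fin (n + 1))) :
    Measure (EuclideanSpace ℝ (Fin n)) :=
  volume.withDensity fun z =>
    ENNReal.ofReal (poissonDensity n γ |x (Fin.last n)| (z - horizontalPart x))

section PoissonMeasure

variable {γ : ℝ} {x : EuclideanSpace ℝ (Fin (n + 1))}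

theorem continuous_poissonDensity_sub (hx : x (Fin.last n) ≠ 0) :
    Continuous fun z => poissonDensity n γ |x (Fin.last n)| (z - horizontalPart x) :=
  (continuous_poissonDensity (abs_pos.2 hx)).comp (by fun_prop)

theorem integrable_poissonDensity_sub (hγ : 0 < γ) (hx : x (Fin.last n) ≠ 0) :
    Integrable fun z => poissonDensity n γ |x (Fin.last n)| (z - horizontalPart x) :=
  (integrable_poissonDensity hγ (abs_pos.2 hx)).comp_sub_right _

theorem isFiniteMeasure_poissonMeasure (hγ : 0 < γ) (hx : x (Fin.last n) ≠ 0) :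
    IsFiniteMeasure (poissonMeasure n γ x) :=
  isFiniteMeasure_withDensity_ofReal (integrable_poissonDensity_sub hγ hx).2

theorem integral_poissonMeasure {F : Type*} [NormedAddCommGroup F] [NormedSpace ℝ F]
    (hγ : 0 < γ) (hx : x (Fin.last n) ≠ 0) (g : EuclideanSpace ℝ (Fin n) → F) :
    ∫ z, g z ∂(poissonMeasure n γ x) =
      ∫ z, poissonDensity n γ |x (Fin.last n)| (z - horizontalPart x) • g z := by
  unfold poissonMeasure
  rw [integral_withDensity_eq_integral_toReal_smul
    (continuous_poissonDensity_sub hx).measurable.ennreal_ofReal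
    (Eventually.of_forall fun z => ENNReal.ofReal_lt_top)]
  refine integral_congr_ae (Eventually.of_forall fun z => ?_)
  simp only
  rw [ENNReal.toReal_ofReal (poissonDensity_pos hγ (abs_pos.2 hx) _).le]

theorem charFun_poissonMeasure (hγ : 0 < γ) (hx : x (Fin.last n) ≠ 0)
    (ξ : EuclideanSpace ℝ (Fin n)) :
    charFun (poissonMeasure n γ x) ξ = expInner ξ (horizontalPart x) *
      ∫ z, expInner ξ z * (poissonDensity n γ |x (Fin.last n)| z : ℂ) := by
  rw [charFun_eq_integral_expInner, integral_poissonMeasure hγ hx, ← integral_const_mul,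
    ← integral_sub_right_eq_self (fun z => expInner ξ (horizontalPart x) *
      (expInner ξ z * (poissonDensity n γ |x (Fin.last n)| z : ℂ))) (horizontalPart x)]
  refine integral_congr_ae (Eventually.of_forall fun z => ?_)
  simp only
  rw [← mul_assoc, ← expInner_add, add_sub_cancel, Complex.real_smul, mul_comm]

end PoissonMeasure

variable {Ω : Type*} [MeasurableSpace Ω] {P : Measure Ω} [IsProbabilityMeasure P] {α : ℝ}
  {X X' : ℝ≥0 → Ω → EuclideanSpace ℝ (Fin (n + 1))} {x : EuclideanSpace ℝ (Fin (n + 1))}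

/-- At `hitZero` the coordinate vanishes almost surely, and that time is positive because the start
is off the hyperplane; hence the exit time is no later. Conversely, a path on the hyperplane has
already entered every neighbourhood of it. -/
theorem IsRegularStable.exitTime_eq (hX : IsRegularStable P α X) (hx : x (Fin.last n) ≠ 0) :
    ∀ᵐ ω ∂P, exitTime X (hyperplaneCompl n) x ω =
      hitZero X (referencePoint n) (x (Fin.last n)) ω := by
  filter_upwards [hX.hitZero_coord (referencePoint n) (x (Fin.last n))] with ω hω
  have hiff : ∀ t, x + X t ω ∉ hyperplaneCompl n ↔
      x (Fin.last n) + inner ℝ (X t ω) (referencePoint n) = 0 := by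
    intro t
    simp [hyperplaneCompl, inner_referencePoint]
  refine le_antisymm ?_ ?_
  · by_cases h : hitZero X (referencePoint n) (x (Fin.last n)) ω < ∞
    · have h1 := hω h
      set t := (hitZero X (referencePoint n) (x (Fin.last n)) ω).toNNReal with ht
      have htt : (t : ℝ≥0∞) = hitZero X (referencePoint n) (x (Fin.last n)) ω :=
        ENNReal.coe_toNNReal h.ne
      have ht0 : 0 < t := by
        rw [pos_iff_ne_zero]
        intro h0
        rw [h0, hX.zero] at h1
        simp [hx] at h1
      rw [← htt]
      exact iInf₂_le t ⟨ht0, (hiff t).2 h1⟩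
    · rw [not_lt, top_le_iff] at h
      rw [h]
      exact le_top
  · exact le_iInf₂ fun t ht => iSup_le fun m => hX.hitLevel_le (by
      rw [(hiff t).1 ht.2, abs_zero]; positivity)

omit [IsProbabilityMeasure P] in
theorem harmonicMeasure_congr (h : ∀ᵐ ω ∂P, ∀ t, X' t ω = X t ω)
    (D : Set (EuclideanSpace ℝ (Fin (n + 1)))) :
    harmonicMeasure P X D x = harmonicMeasure P X' D x := by
  have h1 : ∀ᵐ ω ∂P, exitTime X' D x ω = exitTime X D x ω := by
    filter_upwards [h] with ω hω
    simp only [exitTime, hω]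
  unfold harmonicMeasure
  have h2 : {ω | exitTime X D x ω < ∞} =ᵐ[P] {ω | exitTime X' D x ω < ∞} := by
    filter_upwards [h1] with ω hω
    exact congrArg (· < ∞) hω.symm
  rw [Measure.restrict_congr_set h2]
  refine Measure.map_congr (ae_restrict_of_ae ?_)
  filter_upwards [h, h1] with ω hω hω1
  simp only [exitPosition, hω1, hω]

theorem IsRegularStable.harmonicMeasure_eq (hX : IsRegularStable P α X) (hn : 1 ≤ n) (hα : 1 < α)
    (hx : x (Fin.last n) ≠ 0) :
    harmonicMeasure P X (hyperplaneCompl n) x =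
      (poissonMeasure n (α - 1) x).map boundaryPoint := by
  have hγ : 0 < α - 1 := by linarith
  set S := hitZero X (referencePoint n) (x (Fin.last n)) with hS
  have hSm : Measurable S := (isOptional_hitZero _ _).measurable hX.stable.measurable
  have hset : MeasurableSet {ω | S ω < ∞} := measurableSet_lt hSm measurable_const
  let Z : Ω → EuclideanSpace ℝ (Fin n) := fun ω => horizontalPart (x + X (S ω).toNNReal ω)
  have hZ : Measurable Z := continuous_horizontalPart.measurable.comp
    (measurable_const.add (hX.measurable_comp hSm.ennreal_toNNReal))
  have hexit := hX.exitTime_eq hx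
  have h1 : harmonicMeasure P X (hyperplaneCompl n) x =
      (P.restrict {ω | S ω < ∞}).map (boundaryPoint ∘ Z) := by
    unfold harmonicMeasure
    have h2 : {ω | exitTime X (hyperplaneCompl n) x ω < ∞} =ᵐ[P] {ω | S ω < ∞} := by
      filter_upwards [hexit] with ω hω
      exact congrArg (· < ∞) hω
    rw [Measure.restrict_congr_set h2]
    refine Measure.map_congr ?_
    rw [Filter.EventuallyEq, ae_restrict_iff' hset]
    filter_upwards [hexit, hX.hitZero_coord (referencePoint n) (x (Fin.last n))] with ω hω hω2 hlt
    simp only [exitPosition, hω, Function.comp, Z]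
    refine eq_boundaryPoint_of_last_eq_zero ?_
    have h3 := hω2 hlt
    rw [inner_referencePoint] at h3
    exact h3
  rw [h1, ← Measure.map_map continuous_boundaryPoint.measurable hZ]
  congr 1
  have : IsFiniteMeasure (poissonMeasure n (α - 1) x) := isFiniteMeasure_poissonMeasure hγ hx
  have hnt : Nontrivial (EuclideanSpace ℝ (Fin n)) := by
    have : Nonempty (Fin n) := ⟨⟨0, hn⟩⟩
    infer_instance
  refine Measure.ext_of_charFun ?_
  -- The frequency `0`, that is, the total mass and with it almost sure hitting, is recovered by
  -- continuity; the other frequencies are dense since `n ≥ 1`.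
  refine Continuous.ext_on (dense_compl_singleton (0 : EuclideanSpace ℝ (Fin n)))
    continuous_charFun continuous_charFun fun ξ hξ => ?_
  have hξ' : ξ ≠ 0 := hξ
  rw [charFun_poissonMeasure hγ hx, ← hX.charFun_hitZero hα hξ' hx, charFun_eq_integral_expInner,
    integral_map hZ.aemeasurable (continuous_expInner ξ).aestronglyMeasurable,
    ← integral_const_mul]
  refine integral_congr_ae (Eventually.of_forall fun ω => ?_)
  simp only [Z]
  rw [← expInner_add]
  congr 1

theorem IsSymmetricStable.harmonicMeasure_eq (hX : IsSymmetricStable P α X) (hn : 1 ≤ n)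
    (hα : 1 < α) (hx : x (Fin.last n) ≠ 0) :
    harmonicMeasure P X (hyperplaneCompl n) x =
      (poissonMeasure n (α - 1) x).map boundaryPoint := by
  obtain ⟨X', hX', hae⟩ := hX.exists_regular
  rw [harmonicMeasure_congr hae, hX'.harmonicMeasure_eq hn hα hx]

theorem IsSymmetricStable.hyperplaneHarmonicMeasure_eq (hX : IsSymmetricStable P α X) (hn : 1 ≤ n)
    (hα : 1 < α) :
    hyperplaneHarmonicMeasure P X = poissonMeasure n (α - 1) (referencePoint n) := by
  unfold hyperplaneHarmonicMeasure
  rw [hX.harmonicMeasure_eq hn hα (by simp [referencePoint]),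
    Measure.map_map continuous_horizontalPart.measurable continuous_boundaryPoint.measurable]
  have : (horizontalPart ∘ boundaryPoint : EuclideanSpace ℝ (Fin n) → _) = id := by
    funext y
    exact horizontalPart_boundaryPoint y
  rw [this, Measure.map_id]

end AlphaStable

/-! ### Balayage of the Riesz kernel. -/

namespace AlphaStable

theorem lintegral_mixture {b a : ℝ} (hb : 0 < b) (ha : 0 < a) :
    ∫⁻ s in Set.Ioi (0 : ℝ), ENNReal.ofReal (s ^ (b - 1) * Real.exp (-(a * s))) =
      ENNReal.ofReal (Real.Gamma b * a ^ (-b)) := by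
  rw [← mixture_eq hb ha, ofReal_integral_eq_lintegral_ofReal (integrableOn_rpow_mul_exp hb ha)]
  filter_upwards [ae_restrict_mem measurableSet_Ioi] with s hs
  have : (0 : ℝ) < s := hs
  positivity

theorem lintegral_const_mul_mixture {c b a : ℝ} (hc : 0 ≤ c) (hb : 0 < b) (ha : 0 < a) :
    ∫⁻ s in Set.Ioi (0 : ℝ), ENNReal.ofReal (c * (s ^ (b - 1) * Real.exp (-(a * s)))) =
      ENNReal.ofReal (c * (Real.Gamma b * a ^ (-b))) := by
  simp_rw [ENNReal.ofReal_mul hc]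
  rw [lintegral_const_mul' _ _ ENNReal.ofReal_ne_top, lintegral_mixture hb ha]

section Balayage

variable {n : ℕ}

theorem lintegral_gaussian_mul_gaussian {r s : ℝ} (hr : 0 < r) (hs : 0 < s)
    (y : EuclideanSpace ℝ (Fin n)) :
    ∫⁻ z : EuclideanSpace ℝ (Fin n), ENNReal.ofReal (Real.exp (-(r * ‖y - z‖ ^ 2 + s * ‖z‖ ^ 2))) =
      ENNReal.ofReal ((Real.pi / (r + s)) ^ ((n : ℝ) / 2) *
        Real.exp (-(r * s / (r + s) * ‖y‖ ^ 2))) := by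
  have hrs : 0 < r + s := by positivity
  have h1 : ∀ z : EuclideanSpace ℝ (Fin n), Real.exp (-(r * ‖y - z‖ ^ 2 + s * ‖z‖ ^ 2)) =
      Real.exp (-((r + s) * ‖z - (r / (r + s)) • y‖ ^ 2)) *
        Real.exp (-(r * s / (r + s) * ‖y‖ ^ 2)) := by
    intro z
    rw [← Real.exp_add]
    congr 1
    rw [norm_sub_sq_real, norm_sub_sq_real, inner_smul_right, norm_smul, mul_pow,
      Real.norm_eq_abs, sq_abs, real_inner_comm]
    field_simp
    ring
  have hint := (integrable_gaussian (V := EuclideanSpace ℝ (Fin n)) hrs).comp_sub_right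
      ((r / (r + s)) • y)
  simp_rw [h1]
  rw [← ofReal_integral_eq_lintegral_ofReal (hint.mul_const _)
    (Eventually.of_forall fun z => by positivity), integral_mul_const,
    integral_sub_right_eq_self (fun z : EuclideanSpace ℝ (Fin n) => Real.exp
        (-((r + s) * ‖z‖ ^ 2))),
    integral_gaussian hrs]
  simp

/-- The Gaussian mixture that represents the product of the Riesz kernel and the Poisson kernel. -/
noncomputable def mixtureKernel (A m t : ℝ) (y : EuclideanSpace ℝ (Fin n))
    (z : EuclideanSpace ℝ (Fin n)) (s θ : ℝ) : ℝ :=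
  s ^ (m - 1) * θ ^ (A - 1) * Real.exp (-(s * (θ * ‖y - z‖ ^ 2 + (‖z‖ ^ 2 + t ^ 2))))

theorem measurable_mixtureKernel (A m t : ℝ) (y : EuclideanSpace ℝ (Fin n)) :
    Measurable fun p : (EuclideanSpace ℝ (Fin n) × ℝ) × ℝ =>
      ENNReal.ofReal (mixtureKernel A m t y p.1.1 p.1.2 p.2) := by
  unfold mixtureKernel
  fun_prop

/-- Here `s θ` is the Gamma variable of the Riesz factor and `s` that of the Poisson factor. The
exponent `A + B` absorbs the power `s ^ A` from the change of variable. At `z = y` the real power on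
the right takes a default value, so this point is left out. -/
theorem lintegral_mixtureKernel {A B t : ℝ} (hA : 0 < A) (hB : 0 < B) (ht : 0 < t)
    {y z : EuclideanSpace ℝ (Fin n)} (hz : z ≠ y) :
    ∫⁻ s in Set.Ioi (0 : ℝ), ∫⁻ θ in Set.Ioi (0 : ℝ),
        ENNReal.ofReal (mixtureKernel A (A + B) t y z s θ) =
      ENNReal.ofReal (Real.Gamma A * Real.Gamma B) * (ENNReal.ofReal (‖y - z‖ ^ (-(2 * A))) *
        ENNReal.ofReal ((‖z‖ ^ 2 + t ^ 2) ^ (-B))) := by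
  have hρ : 0 < ‖y - z‖ := norm_pos_iff.2 (sub_ne_zero.2 hz.symm)
  have hΓA := Real.Gamma_pos_of_pos hA
  have hΓB := Real.Gamma_pos_of_pos hB
  have hc : 0 < ‖z‖ ^ 2 + t ^ 2 := by positivity
  have h1 : ∀ s ∈ Set.Ioi (0 : ℝ), ∫⁻ θ in Set.Ioi (0 : ℝ),
      ENNReal.ofReal (mixtureKernel A (A + B) t y z s θ) =
      ENNReal.ofReal (Real.Gamma A * (‖y - z‖ ^ (-(2 * A))) *
        (s ^ (B - 1) * Real.exp (-((‖z‖ ^ 2 + t ^ 2) * s)))) := by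
    intro s hs
    have hs0 : (0 : ℝ) < s := hs
    have h2 : ∀ θ : ℝ, mixtureKernel A (A + B) t y z s θ =
        s ^ (A + B - 1) * Real.exp (-((‖z‖ ^ 2 + t ^ 2) * s)) *
          (θ ^ (A - 1) * Real.exp (-((s * ‖y - z‖ ^ 2) * θ))) := by
      intro θ
      unfold mixtureKernel
      rw [mul_mul_mul_comm, ← Real.exp_add]
      congr 2
      ring
    simp_rw [h2]
    rw [lintegral_const_mul_mixture (by positivity) hA (by positivity)]
    congr 1
    rw [Real.mul_rpow hs0.le (by positivity), ← Real.rpow_natCast ‖y - z‖, ← Real.rpow_mul hρ.le,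
      show A + B - 1 = A + (B - 1) by ring, Real.rpow_add hs0, Real.rpow_neg hs0.le,
      show ((2 : ℕ) : ℝ) * -A = -(2 * A) by push_cast; ring]
    have : s ^ A ≠ 0 := by positivity
    field_simp
  rw [setLIntegral_congr_fun measurableSet_Ioi h1,
    lintegral_const_mul_mixture (by positivity) hB hc,
    ← ENNReal.ofReal_mul (by positivity), ← ENNReal.ofReal_mul (by positivity)]
  congr 1
  ring

/-- A Beta integral, evaluated by writing the power of `t ^ 2 + θ R` as a Gamma integral and
integrating over `θ` first. -/
theorem lintegral_beta {A m t R : ℝ} (hA : 0 < A) (hm : A < m) (ht : 0 < t) (hR : 0 < R) :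
    ENNReal.ofReal (Real.Gamma m) *
      ∫⁻ θ in Set.Ioi (0 : ℝ), ENNReal.ofReal (θ ^ (A - 1) * (t ^ 2 + θ * R) ^ (-m)) =
      ENNReal.ofReal (Real.Gamma A * Real.Gamma (m - A) * t ^ (-(2 * (m - A))) * R ^ (-A)) := by
  have hm0 : 0 < m := hA.trans hm
  have hΓA := Real.Gamma_pos_of_pos hA
  have hΓm := Real.Gamma_pos_of_pos hm0
  rw [← lintegral_const_mul' _ _ ENNReal.ofReal_ne_top]
  have h1 : ∀ θ ∈ Set.Ioi (0 : ℝ), ENNReal.ofReal (Real.Gamma m) *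
      ENNReal.ofReal (θ ^ (A - 1) * (t ^ 2 + θ * R) ^ (-m)) =
      ∫⁻ u in Set.Ioi (0 : ℝ), ENNReal.ofReal
        (θ ^ (A - 1) * (u ^ (m - 1) * Real.exp (-((t ^ 2 + θ * R) * u)))) := by
    intro θ hθ
    have hθ0 : (0 : ℝ) < θ := hθ
    rw [lintegral_const_mul_mixture (by positivity) hm0 (by positivity),
      ← ENNReal.ofReal_mul hΓm.le]
    congr 1
    ring
  rw [setLIntegral_congr_fun measurableSet_Ioi h1, lintegral_lintegral_swap (by fun_prop)]
  have h2 : ∀ u ∈ Set.Ioi (0 : ℝ), ∫⁻ θ in Set.Ioi (0 : ℝ), ENNReal.ofReal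
        (θ ^ (A - 1) * (u ^ (m - 1) * Real.exp (-((t ^ 2 + θ * R) * u)))) =
      ENNReal.ofReal ((Real.Gamma A * R ^ (-A)) *
        (u ^ (m - A - 1) * Real.exp (-(t ^ 2 * u)))) := by
    intro u hu
    have hu0 : (0 : ℝ) < u := hu
    have h3 : ∀ θ : ℝ, θ ^ (A - 1) * (u ^ (m - 1) * Real.exp (-((t ^ 2 + θ * R) * u))) =
        u ^ (m - 1) * Real.exp (-(t ^ 2 * u)) * (θ ^ (A - 1) * Real.exp (-((u * R) * θ))) := by
      intro θ
      rw [mul_mul_mul_comm, ← Real.exp_add, mul_left_comm, ← mul_assoc]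
      congr 2
      ring
    simp_rw [h3]
    rw [lintegral_const_mul_mixture (by positivity) hA (by positivity)]
    congr 1
    rw [Real.mul_rpow hu0.le hR.le, show m - 1 = (m - A - 1) + A by ring, Real.rpow_add hu0,
      Real.rpow_neg hu0.le]
    have : u ^ A ≠ 0 := by positivity
    field_simp
  rw [setLIntegral_congr_fun measurableSet_Ioi h2,
    lintegral_const_mul_mixture (by positivity) (by linarith) (by positivity)]
  congr 1
  rw [← Real.rpow_natCast t, ← Real.rpow_mul ht.le,
    show ((2 : ℕ) : ℝ) * -(m - A) = -(2 * (m - A)) by push_cast; ring]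
  ring

/-- The swept measure and the unit mass at height `t` have the same Riesz potential on the
hyperplane. With both factors opened as Gamma mixtures, the `z`-integral is Gaussian, the
`s`-integral a Gamma integral and the `θ`-integral a Beta integral. In `ℝ≥0∞` the exchanges need no
integrability, which is instead deduced from the finite value. -/
theorem lintegral_riesz_mul_poisson {γ t : ℝ} (hγ : 0 < γ) (hn : γ < n) (ht : 0 < t)
    (y : EuclideanSpace ℝ (Fin n)) :
    ∫⁻ z : EuclideanSpace ℝ (Fin n), ENNReal.ofReal (‖y - z‖ ^ (γ - n)) * ENNReal.ofReal
        (poissonDensity n γ t z) =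
      ENNReal.ofReal ((‖y‖ ^ 2 + t ^ 2) ^ ((γ - n) / 2)) := by
  set A : ℝ := (n - γ) / 2 with hAdef
  set B : ℝ := (n + γ) / 2 with hBdef
  set R : ℝ := ‖y‖ ^ 2 + t ^ 2 with hRdef
  have hR : 0 < R := by positivity
  have hn0 : (0 : ℝ) < n := hγ.trans hn
  have hA : 0 < A := by rw [hAdef]; linarith
  have hB : 0 < B := by rw [hBdef]; linarith
  -- Because of this relation the `s`-integral has exponent `-n/2`, the same as that of `1 + θ` left
  -- by the Gaussian; the product is a power of `(1 + θ) t ^ 2 + θ ‖y‖ ^ 2 = t ^ 2 + θ R`.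
  have hAB : A + B = n := by rw [hAdef, hBdef]; ring
  have hΓA := Real.Gamma_pos_of_pos hA
  have hΓB := Real.Gamma_pos_of_pos hB
  have hΓγ : 0 < Real.Gamma (γ / 2) := Real.Gamma_pos_of_pos (by positivity)
  have hnt : Nontrivial (EuclideanSpace ℝ (Fin n)) := by
    have : Nonempty (Fin n) := ⟨⟨0, by exact_mod_cast hn0⟩⟩
    infer_instance
  have hK := measurable_mixtureKernel A (A + B) t y
  have key : ENNReal.ofReal (Real.Gamma A * Real.Gamma B) *
      ∫⁻ z : EuclideanSpace ℝ (Fin n), (ENNReal.ofReal (‖y - z‖ ^ (γ - n)) * ENNReal.ofReal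
          ((‖z‖ ^ 2 + t ^ 2) ^ (-B))) =
      ENNReal.ofReal (Real.pi ^ ((n : ℝ) / 2) * (Real.Gamma A * Real.Gamma (γ / 2) *
        t ^ (-γ) * R ^ (-A))) := by
    rw [← lintegral_const_mul' _ _ ENNReal.ofReal_ne_top]
    have h1 : ∀ᵐ z : EuclideanSpace ℝ (Fin n), ENNReal.ofReal (Real.Gamma A * Real.Gamma B) *
        (ENNReal.ofReal (‖y - z‖ ^ (γ - n)) * ENNReal.ofReal ((‖z‖ ^ 2 + t ^ 2) ^ (-B))) =
        ∫⁻ s in Set.Ioi (0 : ℝ), ∫⁻ θ in Set.Ioi (0 : ℝ),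
          ENNReal.ofReal (mixtureKernel A (A + B) t y z s θ) := by
      filter_upwards [Measure.ae_ne volume y] with z hz
      rw [lintegral_mixtureKernel hA hB ht hz, show γ - n = -(2 * A) by rw [hAdef]; ring]
    rw [lintegral_congr_ae h1, lintegral_lintegral_swap
      (hK.lintegral_prod_right' (ν := volume.restrict (Set.Ioi (0 : ℝ)))).aemeasurable]
    have h2 : ∀ s ∈ Set.Ioi (0 : ℝ), ∫⁻ z : EuclideanSpace ℝ (Fin n), ∫⁻ θ in Set.Ioi (0 : ℝ),
          ENNReal.ofReal (mixtureKernel A (A + B) t y z s θ) =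
        ∫⁻ θ in Set.Ioi (0 : ℝ), ENNReal.ofReal
          (Real.pi ^ ((n : ℝ) / 2) * θ ^ (A - 1) * (1 + θ) ^ (-((n : ℝ) / 2)) *
            (s ^ ((n : ℝ) / 2 - 1) * Real.exp (-((t ^ 2 + θ / (1 + θ) * ‖y‖ ^ 2) * s)))) := by
      intro s hs
      have hs0 : (0 : ℝ) < s := hs
      rw [lintegral_lintegral_swap (by unfold mixtureKernel; fun_prop)]
      refine setLIntegral_congr_fun measurableSet_Ioi fun θ hθ => ?_
      have hθ0 : (0 : ℝ) < θ := hθ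
      have h3 : ∀ z : EuclideanSpace ℝ (Fin n), ENNReal.ofReal (mixtureKernel A (A + B) t y z s θ) =
          ENNReal.ofReal (s ^ ((n : ℝ) - 1) * θ ^ (A - 1) * Real.exp (-(s * t ^ 2))) *
          ENNReal.ofReal (Real.exp (-(s * θ * ‖y - z‖ ^ 2 + s * ‖z‖ ^ 2))) := by
        intro z
        rw [← ENNReal.ofReal_mul (by positivity), mul_assoc _ (Real.exp _), ← Real.exp_add,
          mixtureKernel, hAB]
        congr 3
        ring
      simp_rw [h3]
      rw [lintegral_const_mul' _ _ ENNReal.ofReal_ne_top,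
        lintegral_gaussian_mul_gaussian (by positivity) hs0, ← ENNReal.ofReal_mul (by positivity)]
      congr 1
      have h4 : Real.exp (-((t ^ 2 + θ / (1 + θ) * ‖y‖ ^ 2) * s)) =
          Real.exp (-(s * t ^ 2)) * Real.exp (-(s * θ * s / (s * θ + s) * ‖y‖ ^ 2)) := by
        rw [← Real.exp_add]
        congr 1
        field_simp
        ring
      rw [h4, show s * θ + s = s * (1 + θ) by ring, Real.div_rpow (by positivity) (by positivity),
        Real.mul_rpow (by positivity) (by positivity), Real.rpow_neg (by positivity),
        show (n : ℝ) - 1 = ((n : ℝ) / 2 - 1) + n / 2 by ring, Real.rpow_add hs0]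
      have : s ^ ((n : ℝ) / 2) ≠ 0 := by positivity
      have : (1 + θ) ^ ((n : ℝ) / 2) ≠ 0 := by positivity
      field_simp
    rw [setLIntegral_congr_fun measurableSet_Ioi h2, lintegral_lintegral_swap (by fun_prop)]
    have h5 : ∀ θ ∈ Set.Ioi (0 : ℝ), ∫⁻ s in Set.Ioi (0 : ℝ), ENNReal.ofReal
          (Real.pi ^ ((n : ℝ) / 2) * θ ^ (A - 1) * (1 + θ) ^ (-((n : ℝ) / 2)) *
            (s ^ ((n : ℝ) / 2 - 1) * Real.exp (-((t ^ 2 + θ / (1 + θ) * ‖y‖ ^ 2) * s)))) =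
        ENNReal.ofReal (Real.pi ^ ((n : ℝ) / 2)) * (ENNReal.ofReal (Real.Gamma ((n : ℝ) / 2)) *
          ENNReal.ofReal (θ ^ (A - 1) * (t ^ 2 + θ * R) ^ (-((n : ℝ) / 2)))) := by
      intro θ hθ
      have hθ0 : (0 : ℝ) < θ := hθ
      have hΓn : 0 < Real.Gamma ((n : ℝ) / 2) := Real.Gamma_pos_of_pos (by positivity)
      rw [lintegral_const_mul_mixture (by positivity) (by positivity) (by positivity),
        ← ENNReal.ofReal_mul (by positivity), ← ENNReal.ofReal_mul (by positivity)]
      congr 1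
      rw [show t ^ 2 + θ * R = (1 + θ) * (t ^ 2 + θ / (1 + θ) * ‖y‖ ^ 2) by
        rw [hRdef]; field_simp; ring, Real.mul_rpow (by positivity) (by positivity)]
      ring
    rw [setLIntegral_congr_fun measurableSet_Ioi h5,
      lintegral_const_mul' _ _ ENNReal.ofReal_ne_top, lintegral_const_mul' _ _
          ENNReal.ofReal_ne_top,
      lintegral_beta hA (by rw [hAdef]; linarith) ht hR, ← ENNReal.ofReal_mul (by positivity),
      show (n : ℝ) / 2 - A = γ / 2 by rw [hAdef]; ring, mul_div_cancel₀ γ two_ne_zero]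
  have h6 : ∀ z : EuclideanSpace ℝ (Fin n), ENNReal.ofReal (‖y - z‖ ^ (γ - n)) *
      ENNReal.ofReal (poissonDensity n γ t z) =
      ENNReal.ofReal (Real.Gamma B / (Real.pi ^ ((n : ℝ) / 2) * Real.Gamma (γ / 2)) * t ^ γ) *
        (ENNReal.ofReal (‖y - z‖ ^ (γ - n)) * ENNReal.ofReal ((‖z‖ ^ 2 + t ^ 2) ^ (-B))) := by
    intro z
    rw [poissonDensity, ENNReal.ofReal_mul (by positivity), mul_left_comm]
  simp_rw [h6]
  rw [lintegral_const_mul' _ _ ENNReal.ofReal_ne_top]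
  have hAB0 : ENNReal.ofReal (Real.Gamma A * Real.Gamma B) ≠ 0 := by
    rw [ne_eq, ENNReal.ofReal_eq_zero, not_le]
    positivity
  refine (ENNReal.mul_right_inj hAB0 ENNReal.ofReal_ne_top).1 ?_
  rw [mul_left_comm, key, ← ENNReal.ofReal_mul (by positivity), ← ENNReal.ofReal_mul
      (by positivity),
    show (γ - n) / 2 = -A by rw [hAdef]; ring, Real.rpow_neg ht.le]
  congr 1
  have : t ^ γ ≠ 0 := by positivity
  have : Real.pi ^ ((n : ℝ) / 2) ≠ 0 := by positivity
  field_simp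

theorem integrable_riesz_mul_poisson {γ t : ℝ} (hγ : 0 < γ) (hn : γ < n) (ht : 0 < t)
    (y : EuclideanSpace ℝ (Fin n)) :
    Integrable fun z : EuclideanSpace ℝ (Fin n) => ‖y - z‖ ^ (γ - n) * poissonDensity n γ t z := by
  have hmeas : Measurable fun z : EuclideanSpace ℝ (Fin n) => ‖y - z‖ ^ (γ - n) * poissonDensity n
      γ t z :=
    Measurable.mul (by fun_prop) (continuous_poissonDensity ht).measurable
  refine ⟨hmeas.aestronglyMeasurable, ?_⟩
  rw [hasFiniteIntegral_iff_ofReal (Eventually.of_forall fun z =>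
    mul_nonneg (by positivity) (poissonDensity_pos hγ ht z).le)]
  simp_rw [ENNReal.ofReal_mul (Real.rpow_nonneg (norm_nonneg _) _)]
  rw [lintegral_riesz_mul_poisson hγ hn ht]
  exact ENNReal.ofReal_lt_top

theorem integral_riesz_mul_poisson {γ t : ℝ} (hγ : 0 < γ) (hn : γ < n) (ht : 0 < t)
    (y : EuclideanSpace ℝ (Fin n)) :
    ∫ z : EuclideanSpace ℝ (Fin n), ‖y - z‖ ^ (γ - n) * poissonDensity n γ t z =
      (‖y‖ ^ 2 + t ^ 2) ^ ((γ - n) / 2) := by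
  rw [integral_eq_lintegral_of_nonneg_ae (Eventually.of_forall fun z =>
    mul_nonneg (by positivity) (poissonDensity_pos hγ ht z).le)
    (integrable_riesz_mul_poisson hγ hn ht y).1]
  simp_rw [ENNReal.ofReal_mul (Real.rpow_nonneg (norm_nonneg _) _)]
  rw [lintegral_riesz_mul_poisson hγ hn ht, ENNReal.toReal_ofReal (by positivity)]

end Balayage

end AlphaStable

/-! ### Boundary behaviour of the Green function and the Martin kernel. -/

namespace AlphaStable

section RieszDefect

variable {n : ℕ} {γ : ℝ}

/-- The difference of the Riesz kernels at height `0` and at height `1`. -/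
noncomputable def rieszDefect (n : ℕ) (γ : ℝ) (z : EuclideanSpace ℝ (Fin n)) : ℝ :=
  ‖z‖ ^ (γ - n) - (‖z‖ ^ 2 + 1) ^ ((γ - n) / 2)

theorem measurable_rieszDefect : Measurable (rieszDefect n γ) := by
  unfold rieszDefect
  fun_prop

theorem rieszDefect_smul {σ : ℝ} (hσ : 0 < σ) (v : EuclideanSpace ℝ (Fin n)) :
    ‖σ • v‖ ^ (γ - n) - (‖σ • v‖ ^ 2 + σ ^ 2) ^ ((γ - n) / 2) =
      σ ^ (γ - n) * rieszDefect n γ v := by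
  rw [rieszDefect, norm_smul, Real.norm_of_nonneg hσ.le, Real.mul_rpow hσ.le (norm_nonneg _),
    show (σ * ‖v‖) ^ 2 + σ ^ 2 = σ ^ 2 * (‖v‖ ^ 2 + 1) by ring,
    Real.mul_rpow (by positivity) (by positivity), sq_rpow_half hσ.le]
  ring

theorem rieszDefect_pos (hn : γ < n) {z : EuclideanSpace ℝ (Fin n)} (hz : z ≠ 0) :
    0 < rieszDefect n γ z := by
  have hz' : 0 < ‖z‖ := norm_pos_iff.2 hz
  rw [rieszDefect, sub_pos, ← sq_rpow_half hz'.le]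
  exact Real.rpow_lt_rpow_of_neg (by positivity) (by linarith) (by linarith)

theorem one_sub_rpow_le {a x : ℝ} (ha : 0 < a) (hx0 : 0 ≤ x) (hx1 : x < 1) :
    1 - (1 - x) ^ a ≤ (a + 1) * x := by
  rcases le_total 1 a with h | h
  · have := one_add_mul_self_le_rpow_one_add (s := -x) (by linarith) h
    rw [← sub_eq_add_neg] at this
    nlinarith
  · have := Real.rpow_le_rpow_of_exponent_ge (by linarith : 0 < 1 - x) (by linarith) h
    rw [Real.rpow_one] at this
    nlinarith

/-- Factoring out the Riesz kernel leaves `1 - (1 - x) ^ a` with `x = 1 / (‖z‖ ^ 2 + 1)`, which is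
at most linear in `x` and so gains two powers of decay. The first summand carries the singularity at
the origin and is integrable by balayage at `y = 0`; the second is a Poisson profile of order `2 -
γ` and governs infinity. -/
theorem rieszDefect_le (hγ : 0 < γ) (hn : γ < n) {z : EuclideanSpace ℝ (Fin n)} (hz : z ≠ 0) :
    rieszDefect n γ z ≤ (((n - γ) / 2 + 1) * 2 ^ (n : ℝ)) * (‖z‖ ^ (γ - n) *
      (‖z‖ ^ 2 + 1) ^ (-((n + γ) / 2)) + (‖z‖ ^ 2 + 1) ^ (-((n + (2 - γ)) / 2))) := by
  have hz' : 0 < ‖z‖ := norm_pos_iff.2 hz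
  set ρ := ‖z‖ ^ 2 with hρ
  have hρ0 : 0 < ρ := by positivity
  have hA : 0 < ((n : ℝ) - γ) / 2 := by linarith
  have hn0 : (0 : ℝ) < n := hγ.trans hn
  have h1 : ‖z‖ ^ (γ - n) = ρ ^ (-(((n : ℝ) - γ) / 2)) := by
    rw [← sq_rpow_half hz'.le]
    congr 1
    ring
  have h2 : rieszDefect n γ z ≤ (((n : ℝ) - γ) / 2 + 1) * (‖z‖ ^ (γ - n) * (ρ + 1)⁻¹) := by
    rw [rieszDefect, h1, show (γ - n) / 2 = -(((n : ℝ) - γ) / 2) by ring]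
    have h3 := one_sub_rpow_le hA (x := (ρ + 1)⁻¹) (by positivity)
      (inv_lt_one_of_one_lt₀ (by linarith))
    have h4 : 1 - (ρ + 1)⁻¹ = ρ / (ρ + 1) := by field_simp; ring
    rw [h4, Real.div_rpow hρ0.le (by positivity)] at h3
    have h5 : ρ ^ (-(((n : ℝ) - γ) / 2)) - (ρ + 1) ^ (-(((n : ℝ) - γ) / 2)) =
        ρ ^ (-(((n : ℝ) - γ) / 2)) *
          (1 - ρ ^ (((n : ℝ) - γ) / 2) / (ρ + 1) ^ (((n : ℝ) - γ) / 2)) := by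
      rw [Real.rpow_neg hρ0.le, Real.rpow_neg (by positivity)]
      field_simp
    rw [h5, mul_left_comm]
    exact mul_le_mul_of_nonneg_left h3 (by positivity)
  refine h2.trans ?_
  rw [mul_assoc]
  refine mul_le_mul_of_nonneg_left ?_ (by positivity)
  have h1' : (ρ + 1)⁻¹ ≤ 1 := inv_le_one_of_one_le₀ (by linarith)
  rcases le_total ρ 1 with h | h
  · have h6 : 1 ≤ 2 ^ (n : ℝ) * (ρ + 1) ^ (-((n + γ) / 2)) := by
      calc (1 : ℝ) ≤ 2 ^ ((n : ℝ) - (n + γ) / 2) :=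
            Real.one_le_rpow (by norm_num) (by linarith)
        _ = 2 ^ (n : ℝ) * 2 ^ (-((n + γ) / 2)) := by
            rw [← Real.rpow_add two_pos]; congr 1
        _ ≤ _ := mul_le_mul_of_nonneg_left
            (Real.rpow_le_rpow_of_nonpos (by positivity) (by linarith) (by linarith))
                (by positivity)
    have h7 : 0 ≤ 2 ^ (n : ℝ) * (ρ + 1) ^ (-(((n : ℝ) + (2 - γ)) / 2)) := by positivity
    have h8 : 0 < ‖z‖ ^ (γ - n) := by positivity
    nlinarith [mul_le_mul_of_nonneg_left h6 h8.le, mul_le_mul_of_nonneg_left h1' h8.le]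
  · have h6 : ‖z‖ ^ (γ - n) * (ρ + 1)⁻¹ ≤ 2 ^ (n : ℝ) *
        (ρ + 1) ^ (-(((n : ℝ) + (2 - γ)) / 2)) := by
      rw [show -(((n : ℝ) + (2 - γ)) / 2) = -(((n : ℝ) - γ) / 2) + -1 by ring,
        Real.rpow_add (by positivity), Real.rpow_neg_one, ← mul_assoc, h1]
      refine mul_le_mul_of_nonneg_right ?_ (by positivity)
      calc ρ ^ (-(((n : ℝ) - γ) / 2)) ≤ ((ρ + 1) / 2) ^ (-(((n : ℝ) - γ) / 2)) :=
            Real.rpow_le_rpow_of_nonpos (by positivity) (by linarith) (by linarith)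
        _ = 2 ^ (((n : ℝ) - γ) / 2) * (ρ + 1) ^ (-(((n : ℝ) - γ) / 2)) := by
            rw [Real.div_rpow (by positivity) (by positivity), Real.rpow_neg two_pos.le]
            field_simp
        _ ≤ _ := mul_le_mul_of_nonneg_right
            (Real.rpow_le_rpow_of_exponent_le (by norm_num) (by linarith)) (by positivity)
    have h7 : 0 ≤ 2 ^ (n : ℝ) * (‖z‖ ^ (γ - n) * (ρ + 1) ^ (-((n + γ) / 2))) := by positivity
    linarith

theorem integrable_rpow_norm_sq_add_one (hγ : 0 < γ) :
    Integrable fun z : EuclideanSpace ℝ (Fin n) => (‖z‖ ^ 2 + 1) ^ (-((n + γ) / 2)) := by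
  have h := (integrable_poissonDensity (n := n) hγ one_pos).const_mul
    (Real.Gamma ((n + γ) / 2) / (Real.pi ^ ((n : ℝ) / 2) * Real.Gamma (γ / 2)))⁻¹
  refine h.congr (Eventually.of_forall fun z => ?_)
  have h1 : 0 < Real.Gamma ((n + γ) / 2) := Real.Gamma_pos_of_pos (by positivity)
  have h2 : 0 < Real.Gamma (γ / 2) := Real.Gamma_pos_of_pos (by positivity)
  simp only [poissonDensity, one_pow, Real.one_rpow, mul_one]
  field_simp

theorem nontrivial_of_pos (hn : (0 : ℝ) < n) : Nontrivial (EuclideanSpace ℝ (Fin n)) := by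
  have : Nonempty (Fin n) := ⟨⟨0, by exact_mod_cast hn⟩⟩
  infer_instance

theorem integrable_rieszDefect (hγ : 0 < γ) (hγ2 : γ < 2) (hn : γ < n) :
    Integrable (rieszDefect n γ) := by
  have hnt := nontrivial_of_pos (hγ.trans hn)
  have h1 : Integrable fun z : EuclideanSpace ℝ (Fin n) =>
      ‖z‖ ^ (γ - n) * (‖z‖ ^ 2 + 1) ^ (-((n + γ) / 2)) := by
    have h := (integrable_riesz_mul_poisson (n := n) hγ hn one_pos 0).const_mul
      (Real.Gamma ((n + γ) / 2) / (Real.pi ^ ((n : ℝ) / 2) * Real.Gamma (γ / 2)))⁻¹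
    refine h.congr (Eventually.of_forall fun z => ?_)
    have h1 : 0 < Real.Gamma ((n + γ) / 2) := Real.Gamma_pos_of_pos (by positivity)
    have h2 : 0 < Real.Gamma (γ / 2) := Real.Gamma_pos_of_pos (by positivity)
    simp only [poissonDensity, one_pow, Real.one_rpow, mul_one, zero_sub, norm_neg]
    field_simp
  have h2 := integrable_rpow_norm_sq_add_one (n := n) (γ := 2 - γ) (by linarith)
  refine ((h1.add h2).const_mul (((n - γ) / 2 + 1) * 2 ^ (n : ℝ))).mono'
    measurable_rieszDefect.aestronglyMeasurable ?_
  filter_upwards [Measure.ae_ne volume 0] with z hz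
  rw [Real.norm_of_nonneg (rieszDefect_pos hn hz).le]
  exact rieszDefect_le hγ hn hz

theorem integral_rieszDefect_pos (hγ : 0 < γ) (hγ2 : γ < 2) (hn : γ < n) :
    0 < ∫ z, rieszDefect n γ z := by
  have hnt := nontrivial_of_pos (hγ.trans hn)
  rw [integral_pos_iff_support_of_nonneg_ae _ (integrable_rieszDefect hγ hγ2 hn)]
  · refine lt_of_lt_of_le ?_ (measure_mono (fun z hz => (rieszDefect_pos hn hz).ne' :
      ({0}ᶜ : Set (EuclideanSpace ℝ (Fin n))) ⊆ Function.support (rieszDefect n γ)))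
    exact isOpen_compl_singleton.measure_pos _ (exists_ne 0)
  · filter_upwards [Measure.ae_ne volume 0] with z hz
    exact (rieszDefect_pos hn hz).le

end RieszDefect

section Green

variable {n : ℕ} {γ : ℝ}

theorem poissonDensity_le (hγ : 0 < γ) {t : ℝ} (ht : 0 < t) (z : EuclideanSpace ℝ (Fin n)) :
    poissonDensity n γ t z ≤ poissonDensity n γ t 0 := by
  unfold poissonDensity
  have h1 : 0 < Real.Gamma ((n + γ) / 2) := Real.Gamma_pos_of_pos (by positivity)
  have h2 : 0 < Real.Gamma (γ / 2) := Real.Gamma_pos_of_pos (by positivity)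
  have hn : (0 : ℝ) ≤ n := n.cast_nonneg
  refine mul_le_mul_of_nonneg_left
    (Real.rpow_le_rpow_of_nonpos (by positivity) ?_ (by linarith)) (by positivity)
  simp

theorem abs_rpow_sub_rpow_le {a m r s : ℝ} (ha : 0 < a) (hm : 0 < m) (hr : m ≤ r) (hs : m ≤ s) :
    |r ^ (-a) - s ^ (-a)| ≤ a * m ^ (-a - 1) * |r - s| := by
  refine (convex_Ici m).norm_image_sub_le_of_norm_hasDerivWithin_le (f := fun u : ℝ => u ^ (-a))
    (f' := fun u => -a * u ^ (-a - 1)) (fun u hu => ?_) (fun u hu => ?_) hs hr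
  · have hu0 : 0 < u := lt_of_lt_of_le hm hu
    exact (Real.hasDerivAt_rpow_const (Or.inl hu0.ne')).hasDerivWithinAt
  · have hu0 : 0 < u := lt_of_lt_of_le hm hu
    rw [norm_mul, norm_neg, Real.norm_of_nonneg ha.le, Real.norm_of_nonneg (by positivity)]
    exact mul_le_mul_of_nonneg_left
      (Real.rpow_le_rpow_of_nonpos hm hu (by linarith)) ha.le

/-- The difference of the Riesz potentials of `δ_x` and of its balayage to the hyperplane. -/
noncomputable def greenDefect (n : ℕ) (γ : ℝ) (x w : EuclideanSpace ℝ (Fin (n + 1))) : ℝ :=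
  ‖x - w‖ ^ (γ - n) - ∫ z, poissonDensity n γ |x (Fin.last n)| (z - horizontalPart x) *
    (‖horizontalPart w - z‖ ^ 2 + w (Fin.last n) ^ 2) ^ ((γ - n) / 2)

theorem horizontalPart_sub (x w : EuclideanSpace ℝ (Fin (n + 1))) :
    horizontalPart (x - w) = horizontalPart x - horizontalPart w := by
  ext i
  simp [horizontalPart_apply]

/-- Insert the potential of the harmonic measure at the foot of `w`, which balayage evaluates. The
remaining integral compares Riesz kernels at heights `0` and `σ = |w_d|`, and the dilation `z = a -
σ v` extracts its homogeneity. -/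
theorem greenDefect_eq (hγ : 0 < γ) (hn : γ < n) {x w : EuclideanSpace ℝ (Fin (n + 1))}
    (hx : x (Fin.last n) ≠ 0) (hw : w (Fin.last n) ≠ 0) :
    greenDefect n γ x w =
      ((‖horizontalPart x - horizontalPart w‖ ^ 2 + (x (Fin.last n) - w (Fin.last n)) ^ 2) ^
          (-((n - γ) / 2)) -
        (‖horizontalPart x - horizontalPart w‖ ^ 2 + x (Fin.last n) ^ 2) ^ (-((n - γ) / 2))) +
      |w (Fin.last n)| ^ γ * ∫ v, poissonDensity n γ |x (Fin.last n)|
        (horizontalPart w - |w (Fin.last n)| • v - horizontalPart x) * rieszDefect n γ v := by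
  have ht := abs_pos.2 hx
  have hσ := abs_pos.2 hw
  set t := |x (Fin.last n)| with htdef
  set σ := |w (Fin.last n)| with hσdef
  set c := horizontalPart x
  set a := horizontalPart w
  have hp0 : ∀ z, 0 < poissonDensity n γ t z := poissonDensity_pos hγ ht
  have hpm : Continuous fun z => poissonDensity n γ t (z - c) :=
    (continuous_poissonDensity ht).comp (by fun_prop)
  have hA : (γ - n) / 2 = -((n - γ) / 2) := by ring
  -- the potential of the harmonic measure at the foot of `w`
  have hI1 : Integrable fun z => poissonDensity n γ t (z - c) * ‖a - z‖ ^ (γ - n) := by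
    refine ((integrable_riesz_mul_poisson hγ hn ht (a - c)).comp_sub_right c).congr
      (Eventually.of_forall fun z => ?_)
    simp only [sub_sub_sub_cancel_right]
    rw [mul_comm]
  have hV1 : ∫ z, poissonDensity n γ t (z - c) * ‖a - z‖ ^ (γ - n) =
      (‖c - a‖ ^ 2 + x (Fin.last n) ^ 2) ^ (-((n - γ) / 2)) := by
    rw [← hA, ← sq_abs (x (Fin.last n)), norm_sub_rev c a,
      ← integral_riesz_mul_poisson hγ hn ht (a - c),
      ← integral_sub_right_eq_self
        (fun z => ‖a - c - z‖ ^ (γ - n) * poissonDensity n γ t z) c]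
    refine integral_congr_ae (Eventually.of_forall fun z => ?_)
    simp only [sub_sub_sub_cancel_right]
    rw [mul_comm]
  have hI2 : Integrable fun z => poissonDensity n γ t (z - c) *
      (‖a - z‖ ^ 2 + σ ^ 2) ^ ((γ - n) / 2) := by
    refine (((integrable_poissonDensity hγ ht).comp_sub_right c).mul_const
      ((σ ^ 2) ^ ((γ - n) / 2))).mono' (hpm.measurable.mul (by fun_prop)).aestronglyMeasurable
      (Eventually.of_forall fun z => ?_)
    rw [norm_mul, Real.norm_of_nonneg (hp0 _).le, Real.norm_of_nonneg (by positivity)]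
    exact mul_le_mul_of_nonneg_left (Real.rpow_le_rpow_of_nonpos (by positivity)
      (by nlinarith [sq_nonneg ‖a - z‖]) (by linarith)) (hp0 _).le
  have hD : (∫ z, poissonDensity n γ t (z - c) * ‖a - z‖ ^ (γ - n)) -
      ∫ z, poissonDensity n γ t (z - c) * (‖a - z‖ ^ 2 + σ ^ 2) ^ ((γ - n) / 2) =
      σ ^ γ * ∫ v, poissonDensity n γ t (a - σ • v - c) * rieszDefect n γ v := by
    rw [← integral_sub hI1 hI2]
    set g : EuclideanSpace ℝ (Fin n) → ℝ := fun z => poissonDensity n γ t (z - c) *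
      ‖a - z‖ ^ (γ - n) - poissonDensity n γ t (z - c) * (‖a - z‖ ^ 2 + σ ^ 2) ^ ((γ - n) / 2)
      with hg
    have h1 := Measure.integral_comp_smul volume (fun z => g (a - z)) σ
    rw [integral_sub_left_eq_self g volume a, finrank_euclideanSpace, Fintype.card_fin,
      abs_of_pos (by positivity), smul_eq_mul] at h1
    have h2 : ∀ v, g (a - σ • v) = σ ^ (γ - n) *
        (poissonDensity n γ t (a - σ • v - c) * rieszDefect n γ v) := by
      intro v
      simp only [hg, sub_sub_cancel]
      rw [← mul_sub, rieszDefect_smul hσ]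
      ring
    simp_rw [h2] at h1
    rw [integral_const_mul] at h1
    -- The Jacobian of the dilation times the homogeneity of the Riesz kernel.
    have h3 : σ ^ γ = σ ^ n * σ ^ (γ - n) := by
      rw [← Real.rpow_natCast, ← Real.rpow_add hσ]
      congr 1
      ring
    rw [h3, mul_assoc, h1]
    field_simp
  have hnorm : ‖x - w‖ ^ (γ - n) =
      (‖c - a‖ ^ 2 + (x (Fin.last n) - w (Fin.last n)) ^ 2) ^ (-((n - γ) / 2)) := by
    rw [← sq_rpow_half (norm_nonneg _), norm_sq_eq_horizontal, horizontalPart_sub, hA]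
    rfl
  rw [greenDefect, hnorm, ← hD, hV1, hσdef, sq_abs]
  ring

/-- After division by `|w_d| ^ γ` the bracket in `greenDefect_eq` is of order `|w_d| ^ (1 - γ)` and
vanishes as `γ < 1`. In the integral the Poisson density is bounded and tends to its value at `y`,
with `rieszDefect` as integrable weight. -/
theorem tendsto_greenDefect_div (hγ : 0 < γ) (hγ1 : γ < 1) (hn : γ < n)
    {x : EuclideanSpace ℝ (Fin (n + 1))} (hx : x (Fin.last n) ≠ 0)
    (y : EuclideanSpace ℝ (Fin n)) :
    Tendsto (fun w => greenDefect n γ x w / |w (Fin.last n)| ^ γ)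
      (𝓝[hyperplaneCompl n] (boundaryPoint y))
      (𝓝 ((∫ v, rieszDefect n γ v) *
        poissonDensity n γ |x (Fin.last n)| (y - horizontalPart x))) := by
  have ht := abs_pos.2 hx
  set t := |x (Fin.last n)| with htdef
  set c := horizontalPart x
  have hp0 : ∀ z, 0 < poissonDensity n γ t z := poissonDensity_pos hγ ht
  set l := 𝓝[hyperplaneCompl n] (boundaryPoint y)
  have hhor : Tendsto horizontalPart l (𝓝 y) := by
    have := (continuous_horizontalPart (n := n)).tendsto (boundaryPoint y)
    rw [horizontalPart_boundaryPoint] at this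
    exact this.mono_left nhdsWithin_le_nhds
  have hlast : Tendsto (fun w : EuclideanSpace ℝ (Fin (n + 1)) => |w (Fin.last n)|) l (𝓝 0) := by
    have := ((continuous_last (n := n)).tendsto (boundaryPoint y)).abs
    rw [boundaryPoint_last, abs_zero] at this
    exact this.mono_left nhdsWithin_le_nhds
  have hmem : ∀ᶠ w in l, w (Fin.last n) ≠ 0 := self_mem_nhdsWithin
  -- the difference of the two Riesz kernels is of first order in the height
  have hfirst : Tendsto (fun w : EuclideanSpace ℝ (Fin (n + 1)) =>
      ((‖c - horizontalPart w‖ ^ 2 + (x (Fin.last n) - w (Fin.last n)) ^ 2) ^ (-((n - γ) / 2)) -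
        (‖c - horizontalPart w‖ ^ 2 + x (Fin.last n) ^ 2) ^ (-((n - γ) / 2))) /
        |w (Fin.last n)| ^ γ) l (𝓝 0) := by
    have hA : 0 < (n - γ) / 2 := by linarith
    -- The mean value bound on `[t ^ 2 / 4, ∞)`: once `|w_d| < t / 2`, `|x_d - w_d| ≥ t / 2`, and
    -- the two bases differ by `|w_d - 2 x_d| |w_d| ≤ 3 t |w_d|`.
    set C := ((n : ℝ) - γ) / 2 * (t ^ 2 / 4) ^ (-((n - γ) / 2) - 1) * (3 * t) with hC
    have hlim : Tendsto (fun w : EuclideanSpace ℝ (Fin (n + 1)) =>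
        C * |w (Fin.last n)| ^ (1 - γ)) l (𝓝 0) := by
      have := (hlast.rpow_const (p := 1 - γ) (Or.inr (by linarith))).const_mul C
      rwa [Real.zero_rpow (by linarith), mul_zero] at this
    refine squeeze_zero_norm' ?_ hlim
    filter_upwards [hmem, hlast.eventually_lt_const (half_pos ht)] with w hw hws
    have hσ := abs_pos.2 hw
    have h1 := abs_sub_abs_le_abs_sub (x (Fin.last n)) (w (Fin.last n))
    have h2 : t / 2 ≤ |x (Fin.last n) - w (Fin.last n)| := by linarith
    have h3 : t ^ 2 / 4 ≤ (x (Fin.last n) - w (Fin.last n)) ^ 2 := by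
      rw [← sq_abs (x (Fin.last n) - _)]
      nlinarith
    have h4 : x (Fin.last n) ^ 2 = t ^ 2 := (sq_abs _).symm
    have h5 := abs_rpow_sub_rpow_le hA (by positivity : 0 < t ^ 2 / 4)
      (r := ‖c - horizontalPart w‖ ^ 2 + (x (Fin.last n) - w (Fin.last n)) ^ 2)
      (s := ‖c - horizontalPart w‖ ^ 2 + x (Fin.last n) ^ 2)
      (by nlinarith [sq_nonneg ‖c - horizontalPart w‖])
      (by nlinarith [sq_nonneg ‖c - horizontalPart w‖])
    have h6 : |‖c - horizontalPart w‖ ^ 2 + (x (Fin.last n) - w (Fin.last n)) ^ 2 -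
        (‖c - horizontalPart w‖ ^ 2 + x (Fin.last n) ^ 2)| ≤ 3 * t * |w (Fin.last n)| := by
      rw [show ‖c - horizontalPart w‖ ^ 2 + (x (Fin.last n) - w (Fin.last n)) ^ 2 -
        (‖c - horizontalPart w‖ ^ 2 + x (Fin.last n) ^ 2) =
        (w (Fin.last n) - 2 * x (Fin.last n)) * w (Fin.last n) by ring, abs_mul]
      refine mul_le_mul_of_nonneg_right ?_ (abs_nonneg _)
      have := abs_sub (w (Fin.last n)) (2 * x (Fin.last n))
      rw [abs_mul, abs_two] at this
      linarith
    rw [norm_div, Real.norm_eq_abs, Real.norm_of_nonneg (by positivity), div_le_iff₀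
        (by positivity),
      mul_assoc, ← Real.rpow_add hσ, sub_add_cancel, Real.rpow_one]
    refine h5.trans ?_
    rw [hC, mul_assoc _ (3 * t)]
    exact mul_le_mul_of_nonneg_left h6 (by positivity)
  have hsecond : Tendsto (fun w : EuclideanSpace ℝ (Fin (n + 1)) =>
      ∫ v, poissonDensity n γ t (horizontalPart w - |w (Fin.last n)| • v - c) *
        rieszDefect n γ v) l
      (𝓝 (∫ v, poissonDensity n γ t (y - c) * rieszDefect n γ v)) := by
    have hQ := integrable_rieszDefect hγ (by linarith) hn
    refine tendsto_integral_filter_of_dominated_convergence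
      (fun v => poissonDensity n γ t 0 * |rieszDefect n γ v|) ?_ ?_ (hQ.abs.const_mul _) ?_
    · refine Eventually.of_forall fun w => Measurable.aestronglyMeasurable
        (((continuous_poissonDensity ht).comp ?_).measurable.mul measurable_rieszDefect)
      fun_prop
    · refine Eventually.of_forall fun w => Eventually.of_forall fun v => ?_
      rw [norm_mul, Real.norm_of_nonneg (hp0 _).le, Real.norm_eq_abs]
      exact mul_le_mul_of_nonneg_right (poissonDensity_le hγ ht _) (abs_nonneg _)
    · refine Eventually.of_forall fun v => Tendsto.mul_const _ ?_
      refine ((continuous_poissonDensity ht).tendsto (y - c)).comp ?_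
      have := (hhor.sub (hlast.smul_const v)).sub_const c
      rwa [zero_smul, sub_zero] at this
  rw [integral_const_mul] at hsecond
  have := hfirst.add hsecond
  rw [zero_add, mul_comm (poissonDensity _ _ _ _)] at this
  refine this.congr' ?_
  filter_upwards [hmem] with w hw
  have hσ := abs_pos.2 hw
  rw [greenDefect_eq hγ hn hx hw, add_div, mul_div_cancel_left₀ _ (by positivity)]

end Green

section Martin

variable {n : ℕ} {Ω : Type*} [MeasurableSpace Ω] {P : Measure Ω} [IsProbabilityMeasure P] {α : ℝ}
  {X : ℝ≥0 → Ω → EuclideanSpace ℝ (Fin (n + 1))} {x : EuclideanSpace ℝ (Fin (n + 1))}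

theorem IsSymmetricStable.greenFunction_eq (hX : IsSymmetricStable P α X) (hn : 1 ≤ n)
    (hα : 1 < α) (hx : x (Fin.last n) ≠ 0) (w : EuclideanSpace ℝ (Fin (n + 1))) :
    greenFunction P α X (hyperplaneCompl n) x w =
      rieszConst (n + 1) α * greenDefect n (α - 1) x w := by
  have he : α - ((n + 1 : ℕ) : ℝ) = α - 1 - n := by push_cast; ring
  have hm : MeasurableSet (hyperplaneCompl n)ᶜ := by
    have : MeasurableSet (hyperplaneCompl n) :=
      (isOpen_compl_singleton.preimage (continuous_last (n := n)) :
        IsOpen ((fun x : EuclideanSpace ℝ (Fin (n + 1)) => x (Fin.last n)) ⁻¹' {0}ᶜ)).measurableSet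
    exact this.compl
  rw [greenFunction, greenDefect, he, hX.harmonicMeasure_eq hn hα hx,
    setIntegral_map hm (Measurable.aestronglyMeasurable (by fun_prop))
      continuous_boundaryPoint.measurable.aemeasurable]
  have hpre : boundaryPoint ⁻¹' (hyperplaneCompl n)ᶜ =
      (Set.univ : Set (EuclideanSpace ℝ (Fin n))) := by
    refine Set.eq_univ_of_forall fun z => ?_
    simp [hyperplaneCompl, boundaryPoint_last]
  rw [hpre, setIntegral_univ, integral_poissonMeasure (by linarith) hx]
  congr 3
  funext z
  rw [smul_eq_mul, ← sq_rpow_half (norm_nonneg (w - boundaryPoint z)), norm_sq_eq_horizontal,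
    horizontalPart_sub, horizontalPart_boundaryPoint, PiLp.sub_apply, boundaryPoint_last, sub_zero]

theorem rieszConst_pos (hn : 1 ≤ n) (hα : 1 < α) (hα₂ : α < 2) : 0 < rieszConst (n + 1) α := by
  have hn' : (1 : ℝ) ≤ n := by exact_mod_cast hn
  have h1 : 0 < Real.Gamma ((((n + 1 : ℕ) : ℝ) - α) / 2) :=
    Real.Gamma_pos_of_pos (by push_cast; linarith)
  have h2 : 0 < Real.Gamma (α / 2) := Real.Gamma_pos_of_pos (by linarith)
  unfold rieszConst
  positivity

theorem referencePoint_last : referencePoint n (Fin.last n) = 1 := by simp [referencePoint]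

theorem horizontalPart_referencePoint : horizontalPart (referencePoint n) = 0 := by
  ext i
  simp [horizontalPart_apply, referencePoint, (Fin.castSucc_lt_last i).ne]

/-- In the quotient `rieszConst`, the integral of `rieszDefect` and the power of `|w_d|` all cancel,
so only their positivity matters. -/
theorem IsSymmetricStable.tendsto_greenFunction_div (hX : IsSymmetricStable P α X) (hn : 1 ≤ n)
    (hα : 1 < α) (hα₂ : α < 2) (hx : x (Fin.last n) ≠ 0) (y : EuclideanSpace ℝ (Fin n)) :
    Tendsto (fun w => greenFunction P α X (hyperplaneCompl n) x w /
        greenFunction P α X (hyperplaneCompl n) (referencePoint n) w)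
      (𝓝[hyperplaneCompl n] (boundaryPoint y))
      (𝓝 (poissonDensity n (α - 1) |x (Fin.last n)| (y - horizontalPart x) /
        poissonDensity n (α - 1) 1 y)) := by
  have hn' : (1 : ℝ) ≤ n := by exact_mod_cast hn
  have hγ : 0 < α - 1 := by linarith
  have href : referencePoint n (Fin.last n) ≠ 0 := by simp [referencePoint_last]
  have hκ := integral_rieszDefect_pos (n := n) hγ (by linarith) (by linarith)
  have hp := poissonDensity_pos (n := n) hγ one_pos y
  have h1 := tendsto_greenDefect_div hγ (by linarith) (by linarith : α - 1 < n) hx y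
  have h2 := tendsto_greenDefect_div hγ (by linarith) (by linarith : α - 1 < n) href y
  rw [referencePoint_last, abs_one, horizontalPart_referencePoint, sub_zero] at h2
  have h3 := h1.div h2 (by positivity)
  rw [mul_div_mul_left _ _ hκ.ne'] at h3
  refine h3.congr' ?_
  filter_upwards [self_mem_nhdsWithin] with w hw
  have hσ : 0 < |w (Fin.last n)| := abs_pos.2 hw
  simp only [Pi.div_apply]
  rw [hX.greenFunction_eq hn hα hx, hX.greenFunction_eq hn hα href,
    mul_div_mul_left _ _ (rieszConst_pos hn hα hα₂).ne', div_div_div_cancel_right₀ (by positivity)]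

/-- A vertical approach stays off the hyperplane. Nontriviality of the filter makes the limit
unique, so `limUnder` returns it. -/
instance neBot_nhdsWithin_hyperplaneCompl (y : EuclideanSpace ℝ (Fin n)) :
    (𝓝[hyperplaneCompl n] (boundaryPoint y)).NeBot := by
  have h : Tendsto (fun s : ℝ => boundaryPoint y + s • referencePoint n) (𝓝[≠] 0)
      (𝓝[hyperplaneCompl n] (boundaryPoint y)) := by
    refine tendsto_nhdsWithin_iff.2 ⟨?_, ?_⟩
    · have : Continuous fun s : ℝ => boundaryPoint y + s • referencePoint n := by fun_prop
      have h := this.tendsto 0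
      rw [zero_smul, add_zero] at h
      exact h.mono_left nhdsWithin_le_nhds
    · filter_upwards [self_mem_nhdsWithin] with s hs
      have hs' : s ≠ 0 := hs
      simpa [hyperplaneCompl, boundaryPoint_last, referencePoint_last] using hs'
  exact h.neBot

theorem IsSymmetricStable.hyperplaneMartinKernel_eq (hX : IsSymmetricStable P α X) (hn : 1 ≤ n)
    (hα : 1 < α) (hα₂ : α < 2) (hx : x (Fin.last n) ≠ 0) (y : EuclideanSpace ℝ (Fin n)) :
    hyperplaneMartinKernel P α X x y =
      poissonDensity n (α - 1) |x (Fin.last n)| (y - horizontalPart x) /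
        poissonDensity n (α - 1) 1 y :=
  (hX.tendsto_greenFunction_div hn hα hα₂ hx y).limUnder_eq

end Martin

end AlphaStable

namespace AlphaStable

/-! ### Fatou estimates for the quotient of Poisson kernels. -/

section Fatou

variable {n : ℕ} {γ : ℝ}

theorem poissonDensity_div (hγ : 0 < γ) (t : ℝ) (u z : EuclideanSpace ℝ (Fin n)) :
    poissonDensity n γ t u / poissonDensity n γ 1 z =
      t ^ γ * ((‖u‖ ^ 2 + t ^ 2) ^ (-((n + γ) / 2)) * (‖z‖ ^ 2 + 1) ^ ((n + γ) / 2)) := by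
  have h1 : 0 < Real.Gamma ((n + γ) / 2) := Real.Gamma_pos_of_pos (by positivity)
  have h2 : 0 < Real.Gamma (γ / 2) := Real.Gamma_pos_of_pos (by positivity)
  rw [poissonDensity, poissonDensity, Real.one_rpow, one_pow,
    Real.rpow_neg (by positivity : (0 : ℝ) ≤ ‖z‖ ^ 2 + 1)]
  field_simp

/-- The growth of `1 / p_1` is compensated by the decay of `p_t`, so away from the singularity at
height zero the quotient is bounded by a constant times `t ^ γ`, uniformly in `z`. -/
theorem poissonDensity_div_le (hγ : 0 < γ) {t δ : ℝ} (ht : 0 < t) (hδ : 0 < δ)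
    {c z : EuclideanSpace ℝ (Fin n)} (h : δ ^ 2 ≤ ‖z - c‖ ^ 2 + t ^ 2) :
    poissonDensity n γ t (z - c) / poissonDensity n γ 1 z ≤
      t ^ γ * (2 + (2 * ‖c‖ ^ 2 + 1) / δ ^ 2) ^ ((n + γ) / 2) := by
  have hn : (0 : ℝ) ≤ n := n.cast_nonneg
  rw [poissonDensity_div hγ, Real.rpow_neg (by positivity), mul_comm (_⁻¹), ← div_eq_mul_inv,
    ← Real.div_rpow (by positivity) (by positivity)]
  refine mul_le_mul_of_nonneg_left (Real.rpow_le_rpow (by positivity) ?_ (by positivity))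
    (by positivity)
  rw [div_le_iff₀ (by positivity)]
  have h1 : ‖z‖ ≤ ‖z - c‖ + ‖c‖ := by simpa using norm_add_le (z - c) c
  have h2 : ‖z‖ ^ 2 ≤ 2 * ‖z - c‖ ^ 2 + 2 * ‖c‖ ^ 2 := by
    nlinarith [sq_nonneg (‖z - c‖ - ‖c‖), norm_nonneg z]
  have h3 : 2 * ‖c‖ ^ 2 + 1 ≤ (2 * ‖c‖ ^ 2 + 1) / δ ^ 2 * (‖z - c‖ ^ 2 + t ^ 2) := by
    rw [div_mul_eq_mul_div, le_div_iff₀ (by positivity)]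
    exact mul_le_mul_of_nonneg_left h (by positivity)
  nlinarith [sq_nonneg t]

/-- A Harnack-type bound: a shift of the centre by at most `b t` changes `‖·‖ ^ 2 + t ^ 2` by a
bounded factor. It reduces approach in a cone to vertical approach. -/
theorem poissonDensity_le_of_norm_le (hγ : 0 < γ) {t b : ℝ} (ht : 0 < t)
    {c y : EuclideanSpace ℝ (Fin n)} (h : ‖c - y‖ ≤ b * t) (z : EuclideanSpace ℝ (Fin n)) :
    poissonDensity n γ t (z - c) ≤
      (2 + 2 * b ^ 2) ^ ((n + γ) / 2) * poissonDensity n γ t (z - y) := by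
  have hn : (0 : ℝ) ≤ n := n.cast_nonneg
  have h1 : 0 < Real.Gamma ((n + γ) / 2) := Real.Gamma_pos_of_pos (by positivity)
  have h2 : 0 < Real.Gamma (γ / 2) := Real.Gamma_pos_of_pos (by positivity)
  rw [poissonDensity, poissonDensity, mul_left_comm]
  refine mul_le_mul_of_nonneg_left ?_ (by positivity)
  have hK : 0 < 2 + 2 * b ^ 2 := by positivity
  rw [← neg_neg (((n : ℝ) + γ) / 2), neg_neg (-(((n : ℝ) + γ) / 2)), Real.rpow_neg hK.le,
    mul_comm, ← div_eq_mul_inv, ← Real.div_rpow (by positivity) hK.le]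
  refine Real.rpow_le_rpow_of_nonpos (by positivity) ?_ (by linarith)
  rw [div_le_iff₀ hK]
  have h3 : ‖z - y‖ ≤ ‖z - c‖ + b * t := by
    have := norm_add_le (z - c) (c - y)
    rw [sub_add_sub_cancel] at this
    linarith
  have h4 : ‖z - y‖ ^ 2 ≤ 2 * ‖z - c‖ ^ 2 + 2 * b ^ 2 * t ^ 2 := by
    nlinarith [sq_nonneg (‖z - c‖ - b * t), norm_nonneg (z - y)]
  nlinarith [mul_nonneg (sq_nonneg b) (sq_nonneg ‖z - c‖), sq_nonneg t]

/-- A measure that is small on balls centred at `y` integrates radially decreasing functions at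
most as well as a small multiple of Lebesgue measure. -/
theorem setLIntegral_closedBall_le_of_antitone {lam : Measure (EuclideanSpace ℝ (Fin n))}
    {y : EuclideanSpace ℝ (Fin n)} {δ : ℝ} {ε : ℝ≥0∞} (hε : ε ≠ ∞)
    (h : ∀ r, 0 ≤ r → r ≤ δ → lam (Metric.closedBall y r) ≤ ε * volume (Metric.closedBall y r))
    {g : EuclideanSpace ℝ (Fin n) → ℝ} (hg0 : ∀ z, 0 ≤ g z) (hgc : Continuous g)
    (hg : ∀ z w, ‖z - y‖ ≤ ‖w - y‖ → g w ≤ g z) :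
    ∫⁻ z in Metric.closedBall y δ, ENNReal.ofReal (g z) ∂lam ≤
      ε * ∫⁻ z, ENNReal.ofReal (g z) := by
  rw [lintegral_eq_lintegral_meas_le _ (Eventually.of_forall hg0) hgc.measurable.aemeasurable,
    lintegral_eq_lintegral_meas_le _ (Eventually.of_forall hg0) hgc.measurable.aemeasurable,
    ← lintegral_const_mul' _ _ hε]
  refine lintegral_mono fun s => ?_
  have hcl : IsClosed {z | s ≤ g z} := isClosed_le continuous_const hgc
  rw [Measure.restrict_apply hcl.measurableSet]
  rcases ({z | s ≤ g z} ∩ Metric.closedBall y δ).eq_empty_or_nonempty with he | hne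
  · rw [he, measure_empty]
    exact zero_le
  have hcomp : IsCompact ({z | s ≤ g z} ∩ Metric.closedBall y δ) :=
    (isCompact_closedBall y δ).inter_left hcl
  -- The point of the truncated superlevel set farthest from `y` fixes the radius: the closed ball
  -- of radius `‖w - y‖` contains the truncated set, and by monotonicity lies inside the full
  -- superlevel set.
  obtain ⟨w, hw, hmax⟩ := hcomp.exists_isMaxOn hne
    (f := fun z => ‖z - y‖) (by fun_prop : Continuous fun z => ‖z - y‖).continuousOn
  calc lam ({z | s ≤ g z} ∩ Metric.closedBall y δ)
      ≤ lam (Metric.closedBall y ‖w - y‖) := measure_mono fun z hz => by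
        rw [mem_closedBall_iff_norm]
        exact hmax hz
    _ ≤ ε * volume (Metric.closedBall y ‖w - y‖) :=
        h _ (norm_nonneg _) (mem_closedBall_iff_norm.1 hw.2)
    _ ≤ ε * volume {z | s ≤ g z} := by
        refine mul_le_mul_right (measure_mono fun z hz => ?_) _
        have hws : s ≤ g w := hw.1
        exact hws.trans (hg z w (mem_closedBall_iff_norm.1 hz))

theorem exists_measure_closedBall_le (hn : 1 ≤ n) {lam : Measure (EuclideanSpace ℝ (Fin n))}
    {y : EuclideanSpace ℝ (Fin n)}
    (h : Tendsto (fun r => lam (Metric.closedBall y r) / volume (Metric.closedBall y r))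
      (𝓝[>] 0) (𝓝 0)) {ε : ℝ≥0∞} (hε : 0 < ε) (hε' : ε ≠ ∞) :
    ∃ δ, 0 < δ ∧ δ ≤ 1 ∧ ∀ r, 0 ≤ r → r ≤ δ →
      lam (Metric.closedBall y r) ≤ ε * volume (Metric.closedBall y r) := by
  have h1 : ∀ᶠ r in 𝓝[>] (0 : ℝ),
      lam (Metric.closedBall y r) ≤ ε * volume (Metric.closedBall y r) := by
    filter_upwards [h.eventually_lt_const hε, self_mem_nhdsWithin] with r hr hr0
    have hv : volume (Metric.closedBall y r) ≠ 0 := (Metric.measure_closedBall_pos _ _ hr0).ne'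
    exact (ENNReal.div_le_iff hv (measure_closedBall_lt_top).ne).1 hr.le
  obtain ⟨δ, hδ, hδs⟩ := mem_nhdsGT_iff_exists_Ioc_subset.1 h1
  have hδ0 : 0 < δ := hδ
  refine ⟨min δ 1, lt_min hδ0 one_pos, min_le_right _ _, fun r hr hrδ => ?_⟩
  -- Radius `0` is needed because a superlevel set may reduce to the centre. Letting `r` decrease to
  -- `0` shows that `lam` has no atom at `y`; here `n ≥ 1` makes the volumes tend to zero.
  rcases hr.eq_or_lt with rfl | hr0
  · have hlim : Tendsto (fun r => ε * volume (Metric.closedBall y r)) (𝓝[>] 0) (𝓝 0) := by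
      have h2 : Tendsto (fun r : ℝ => ENNReal.ofReal (r ^ n)) (𝓝[>] 0) (𝓝 0) := by
        have h3 : Continuous fun r : ℝ => ENNReal.ofReal (r ^ n) :=
        ENNReal.continuous_ofReal.comp (continuous_pow n)
        have h4 := h3.tendsto 0
        rw [zero_pow (by omega), ENNReal.ofReal_zero] at h4
        exact h4.mono_left nhdsWithin_le_nhds
      have h5 := ENNReal.Tendsto.const_mul (a := ε) (ENNReal.Tendsto.mul_const
        (b := volume (Metric.ball (0 : EuclideanSpace ℝ (Fin n)) 1)) h2
        (Or.inr measure_ball_lt_top.ne)) (Or.inr hε')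
      rw [zero_mul, mul_zero] at h5
      refine h5.congr' ?_
      filter_upwards [self_mem_nhdsWithin] with r hr0
      have hr0' : (0 : ℝ) < r := hr0
      rw [Measure.addHaar_closedBall _ _ hr0'.le, finrank_euclideanSpace, Fintype.card_fin]
    have h6 : lam (Metric.closedBall y 0) ≤ 0 := by
      refine ge_of_tendsto hlim ?_
      filter_upwards [h1, self_mem_nhdsWithin] with r hr1 hr0
      have hr0' : (0 : ℝ) < r := hr0
      exact (measure_mono (Metric.closedBall_subset_closedBall hr0'.le)).trans hr1
    exact h6.trans zero_le
  · exact hδs ⟨hr0, hrδ.trans (min_le_left _ _)⟩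

theorem continuous_poissonDensity_div (hγ : 0 < γ) {t : ℝ} (ht : 0 < t)
    (c : EuclideanSpace ℝ (Fin n)) :
    Continuous fun z => poissonDensity n γ t (z - c) / poissonDensity n γ 1 z :=
  ((continuous_poissonDensity ht).comp (by fun_prop)).div (continuous_poissonDensity one_pos)
    fun z => (poissonDensity_pos hγ one_pos z).ne'

/-- Near `y` the factor `1 / p_1` is bounded by `M`, and density at most `e / 2 / (M + 1)` against a
kernel of Lebesgue mass one leaves at most `e / 2`. Outside the `δ`-ball the kernel is at most `K t
^ γ` and `lam` is finite. -/
theorem tendsto_lintegral_poissonDensity_div (hn : 1 ≤ n) (hγ : 0 < γ)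
    {lam : Measure (EuclideanSpace ℝ (Fin n))} [IsFiniteMeasure lam]
    {y : EuclideanSpace ℝ (Fin n)}
    (h : Tendsto (fun r => lam (Metric.closedBall y r) / volume (Metric.closedBall y r))
      (𝓝[>] 0) (𝓝 0)) :
    Tendsto (fun t => ∫⁻ z, ENNReal.ofReal
      (poissonDensity n γ t (z - y) / poissonDensity n γ 1 z) ∂lam) (𝓝[>] 0) (𝓝 0) := by
  have hp0 : ∀ {t : ℝ}, 0 < t → ∀ z : EuclideanSpace ℝ (Fin n), 0 < poissonDensity n γ t z :=
    fun ht => poissonDensity_pos hγ ht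
  obtain ⟨M, hM⟩ := (isCompact_closedBall y 1).exists_bound_of_continuousOn
    (f := fun z => (poissonDensity n γ 1 z)⁻¹)
    ((continuous_poissonDensity one_pos).inv₀ fun z => (hp0 one_pos z).ne').continuousOn
  have hM0 : 0 ≤ M := (norm_nonneg _).trans (hM y (Metric.mem_closedBall_self zero_le_one))
  rw [ENNReal.tendsto_nhds_zero]
  intro ε hε
  obtain ⟨e, he, heε⟩ := ENNReal.lt_iff_exists_real_btwn.1 hε
  have he0 : 0 < e := ENNReal.ofReal_pos.1 heε.1
  obtain ⟨δ, hδ, hδ1, hball⟩ := exists_measure_closedBall_le hn h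
    (ε := ENNReal.ofReal (e / 2 / (M + 1))) (ENNReal.ofReal_pos.2 (by positivity))
    ENNReal.ofReal_ne_top
  set K : ℝ := (2 + (2 * ‖y‖ ^ 2 + 1) / δ ^ 2) ^ (((n : ℝ) + γ) / 2) with hK
  have hfar : Tendsto (fun t : ℝ => ENNReal.ofReal (t ^ γ * K) * lam Set.univ) (𝓝[>] 0) (𝓝 0) := by
    have h1 : Tendsto (fun t : ℝ => ENNReal.ofReal (t ^ γ * K)) (𝓝[>] 0) (𝓝 0) := by
      have h2 : Tendsto (fun t : ℝ => t ^ γ * K) (𝓝[>] 0) (𝓝 (0 ^ γ * K)) :=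
        (((Real.continuous_rpow_const hγ.le).tendsto 0).mono_left nhdsWithin_le_nhds).mul_const _
      rw [Real.zero_rpow hγ.ne', zero_mul] at h2
      simpa using ENNReal.tendsto_ofReal h2
    have h3 := ENNReal.Tendsto.mul_const (b := lam Set.univ) h1 (Or.inr (measure_ne_top _ _))
    rwa [zero_mul] at h3
  filter_upwards [self_mem_nhdsWithin, hfar.eventually_lt_const
    (ENNReal.ofReal_pos.2 (half_pos he0))] with t ht htfar
  have ht0 : (0 : ℝ) < t := ht
  rw [← lintegral_add_compl _ (Metric.isClosed_closedBall (x := y) (ε := δ)).measurableSet]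
  have hnear : ∫⁻ z in Metric.closedBall y δ, ENNReal.ofReal
      (poissonDensity n γ t (z - y) / poissonDensity n γ 1 z) ∂lam ≤ ENNReal.ofReal (e / 2) := by
    calc ∫⁻ z in Metric.closedBall y δ, ENNReal.ofReal
          (poissonDensity n γ t (z - y) / poissonDensity n γ 1 z) ∂lam
        ≤ ∫⁻ z in Metric.closedBall y δ, ENNReal.ofReal (M + 1) *
            ENNReal.ofReal (poissonDensity n γ t (z - y)) ∂lam := by
          refine setLIntegral_mono' Metric.isClosed_closedBall.measurableSet fun z hz => ?_
          rw [← ENNReal.ofReal_mul (by positivity), mul_comm, div_eq_mul_inv]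
          refine ENNReal.ofReal_le_ofReal (mul_le_mul_of_nonneg_left ?_ (hp0 ht0 _).le)
          have := hM z (Metric.closedBall_subset_closedBall hδ1 hz)
          exact (le_abs_self _).trans (this.trans (by linarith))
      _ = ENNReal.ofReal (M + 1) * ∫⁻ z in Metric.closedBall y δ,
            ENNReal.ofReal (poissonDensity n γ t (z - y)) ∂lam :=
          lintegral_const_mul' _ _ ENNReal.ofReal_ne_top
      _ ≤ ENNReal.ofReal (M + 1) * (ENNReal.ofReal (e / 2 / (M + 1)) *
            ∫⁻ z, ENNReal.ofReal (poissonDensity n γ t (z - y))) := by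
          refine mul_le_mul_right (setLIntegral_closedBall_le_of_antitone ENNReal.ofReal_ne_top
            hball (fun z => (hp0 ht0 _).le) ((continuous_poissonDensity ht0).comp (by fun_prop))
            fun z w hzw => ?_) _
          have h1 : 0 < Real.Gamma ((n + γ) / 2) := Real.Gamma_pos_of_pos (by positivity)
          have h2 : 0 < Real.Gamma (γ / 2) := Real.Gamma_pos_of_pos (by positivity)
          have hn' : (0 : ℝ) ≤ n := n.cast_nonneg
          exact mul_le_mul_of_nonneg_left (Real.rpow_le_rpow_of_nonpos (by positivity)
            (by gcongr) (by linarith)) (by positivity)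
      _ = ENNReal.ofReal (e / 2) := by
          rw [← ofReal_integral_eq_lintegral_ofReal
            ((integrable_poissonDensity hγ ht0).comp_sub_right y)
            (Eventually.of_forall fun z => (hp0 ht0 _).le),
            integral_sub_right_eq_self (poissonDensity n γ t), integral_poissonDensity hγ ht0,
            ENNReal.ofReal_one, mul_one, ← ENNReal.ofReal_mul (by positivity)]
          congr 1
          field_simp
  have hfar' : ∫⁻ z in (Metric.closedBall y δ)ᶜ, ENNReal.ofReal
      (poissonDensity n γ t (z - y) / poissonDensity n γ 1 z) ∂lam ≤ ENNReal.ofReal (e / 2) := by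
    calc ∫⁻ z in (Metric.closedBall y δ)ᶜ, ENNReal.ofReal
          (poissonDensity n γ t (z - y) / poissonDensity n γ 1 z) ∂lam
        ≤ ∫⁻ z in (Metric.closedBall y δ)ᶜ, ENNReal.ofReal (t ^ γ * K) ∂lam := by
          refine setLIntegral_mono' Metric.isClosed_closedBall.measurableSet.compl fun z hz =>
            ENNReal.ofReal_le_ofReal (poissonDensity_div_le hγ ht0 hδ ?_)
          rw [Set.mem_compl_iff, mem_closedBall_iff_norm, not_le] at hz
          nlinarith [sq_nonneg t]
      _ ≤ ∫⁻ z, ENNReal.ofReal (t ^ γ * K) ∂lam := setLIntegral_le_lintegral _ _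
      _ = ENNReal.ofReal (t ^ γ * K) * lam Set.univ := lintegral_const _
      _ ≤ _ := htfar.le
  calc _ ≤ ENNReal.ofReal (e / 2) + ENNReal.ofReal (e / 2) := add_le_add hnear hfar'
    _ = ENNReal.ofReal e := by
        rw [← ENNReal.ofReal_add (by positivity) (by positivity), add_halves]
    _ ≤ ε := heε.2.le

theorem norm_horizontalPart_sub_le (x : EuclideanSpace ℝ (Fin (n + 1)))
    (y : EuclideanSpace ℝ (Fin n)) : ‖horizontalPart x - y‖ ≤ ‖x - boundaryPoint y‖ := by
  have h := norm_sq_eq_horizontal (x - boundaryPoint y)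
  rw [horizontalPart_sub, horizontalPart_boundaryPoint] at h
  refine (pow_le_pow_iff_left₀ (norm_nonneg _) (norm_nonneg _) two_ne_zero).1 ?_
  nlinarith [sq_nonneg ((x - boundaryPoint y) (Fin.last n))]

theorem tendsto_cone_lintegral_poissonDensity_div (hn : 1 ≤ n) (hγ : 0 < γ)
    {lam : Measure (EuclideanSpace ℝ (Fin n))} [IsFiniteMeasure lam]
    {y : EuclideanSpace ℝ (Fin n)}
    (h : Tendsto (fun r => lam (Metric.closedBall y r) / volume (Metric.closedBall y r))
      (𝓝[>] 0) (𝓝 0)) (β : ℝ) :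
    Tendsto (fun x => ∫⁻ z, ENNReal.ofReal (poissonDensity n γ |x (Fin.last n)|
      (z - horizontalPart x) / poissonDensity n γ 1 z) ∂lam)
      (𝓝[cone β (boundaryPoint y)] (boundaryPoint y)) (𝓝 0) := by
  have hlast : Tendsto (fun x : EuclideanSpace ℝ (Fin (n + 1)) => |x (Fin.last n)|)
      (𝓝[cone β (boundaryPoint y)] (boundaryPoint y)) (𝓝[>] 0) := by
    refine tendsto_nhdsWithin_iff.2 ⟨?_, ?_⟩
    · have := ((continuous_last (n := n)).tendsto (boundaryPoint y)).abs
      rw [boundaryPoint_last, abs_zero] at this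
      exact this.mono_left nhdsWithin_le_nhds
    · filter_upwards [self_mem_nhdsWithin] with x hx
      exact abs_pos.2 hx.1
  set K : ℝ := (2 + 2 * (1 + β) ^ 2) ^ (((n : ℝ) + γ) / 2) with hK
  have hlim := ENNReal.Tendsto.const_mul (a := ENNReal.ofReal K)
    ((tendsto_lintegral_poissonDensity_div hn hγ h).comp hlast) (Or.inr ENNReal.ofReal_ne_top)
  rw [mul_zero] at hlim
  refine tendsto_of_tendsto_of_tendsto_of_le_of_le' tendsto_const_nhds hlim
    (Eventually.of_forall fun _ => zero_le) ?_
  filter_upwards [self_mem_nhdsWithin] with x hx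
  have ht : 0 < |x (Fin.last n)| := abs_pos.2 hx.1
  simp only [Function.comp]
  rw [← lintegral_const_mul' _ _ ENNReal.ofReal_ne_top]
  refine lintegral_mono fun z => ?_
  rw [← ENNReal.ofReal_mul (by positivity), ← mul_div_assoc]
  exact ENNReal.ofReal_le_ofReal (div_le_div_of_nonneg_right
    (poissonDensity_le_of_norm_le hγ ht ((norm_horizontalPart_sub_le x y).trans hx.2.le) z)
    (poissonDensity_pos hγ one_pos z).le)

end Fatou

end AlphaStable

/-! ### Density points and integration against signed measures. -/

namespace AlphaStable

section SignedMeasure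

variable {n : ℕ} {γ : ℝ}

theorem poissonMeasure_referencePoint : poissonMeasure n γ (referencePoint n) =
    volume.withDensity fun z => ENNReal.ofReal (poissonDensity n γ 1 z) := by
  unfold poissonMeasure
  simp_rw [referencePoint_last, abs_one, horizontalPart_referencePoint, sub_zero]

theorem volume_absolutelyContinuous_poissonMeasure (hγ : 0 < γ) :
    (volume : Measure (EuclideanSpace ℝ (Fin n))) ≪ poissonMeasure n γ (referencePoint n) := by
  rw [poissonMeasure_referencePoint]
  refine withDensity_absolutelyContinuous'
    (continuous_poissonDensity one_pos).measurable.ennreal_ofReal.aemeasurable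
    (Eventually.of_forall fun z => (ENNReal.ofReal_pos.2 (poissonDensity_pos hγ one_pos z)).ne')

theorem poissonMeasure_referencePoint_le (hγ : 0 < γ) : poissonMeasure n γ (referencePoint n) ≤
    ENNReal.ofReal (poissonDensity n γ 1 0) • volume := by
  rw [poissonMeasure_referencePoint, ← withDensity_const]
  exact withDensity_mono (Eventually.of_forall fun z =>
    ENNReal.ofReal_le_ofReal (poissonDensity_le hγ one_pos z))

theorem locallyIntegrable_of_integrable_poissonMeasure (hγ : 0 < γ)
    {f : EuclideanSpace ℝ (Fin n) → ℝ}
    (hf : Integrable f (poissonMeasure n γ (referencePoint n))) : LocallyIntegrable f := by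
  rw [poissonMeasure_referencePoint, integrable_withDensity_iff_integrable_smul'
    (continuous_poissonDensity one_pos).measurable.ennreal_ofReal
    (Eventually.of_forall fun z => ENNReal.ofReal_lt_top)] at hf
  have h := hf.locallyIntegrable.continuous_mul (g := fun z => (poissonDensity n γ 1 z)⁻¹)
    ((continuous_poissonDensity one_pos).inv₀ fun z => (poissonDensity_pos hγ one_pos z).ne')
  refine h.congr (Eventually.of_forall fun z => ?_)
  have hp := poissonDensity_pos hγ one_pos z
  simp only [smul_eq_mul]
  rw [ENNReal.toReal_ofReal hp.le, inv_mul_cancel_left₀ hp.ne']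

/-- The harmonic measure has bounded density, so the averages are dominated by those at Lebesgue
points of `f`. Local integrability of `f` holds because that density is continuous and positive. -/
theorem tendsto_withDensity_closedBall_div (hγ : 0 < γ) {f : EuclideanSpace ℝ (Fin n) → ℝ}
    (hf : Integrable f (poissonMeasure n γ (referencePoint n))) :
    ∀ᵐ y : EuclideanSpace ℝ (Fin n), Tendsto (fun r =>
      (poissonMeasure n γ (referencePoint n)).withDensity (fun z => ‖f z - f y‖ₑ)
        (Metric.closedBall y r) / volume (Metric.closedBall y r)) (𝓝[>] 0) (𝓝 0) := by
  filter_upwards [(Besicovitch.vitaliFamily (volume : Measure (EuclideanSpace ℝ (Fin n)))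
    ).ae_tendsto_lintegral_enorm_sub_div
    (locallyIntegrable_of_integrable_poissonMeasure hγ hf)] with y hy
  have h1 := hy.comp (Besicovitch.tendsto_filterAt volume y)
  have h2 := ENNReal.Tendsto.const_mul (a := ENNReal.ofReal (poissonDensity n γ 1 0)) h1
    (Or.inr ENNReal.ofReal_ne_top)
  rw [mul_zero] at h2
  refine tendsto_of_tendsto_of_tendsto_of_le_of_le tendsto_const_nhds h2
    (fun _ => zero_le) fun r => ?_
  simp only [Function.comp]
  rw [withDensity_apply _ Metric.isClosed_closedBall.measurableSet, ← mul_div_assoc]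
  refine ENNReal.div_le_div_right ?_ _
  rw [← smul_eq_mul, ← lintegral_smul_measure, ← Measure.restrict_smul]
  exact lintegral_mono' (Measure.restrict_mono_measure (poissonMeasure_referencePoint_le hγ) _)
    le_rfl

/-- Positivity of the Poisson density turns singularity to the harmonic measure into singularity to
Lebesgue measure, and then the derivative is zero almost everywhere. -/
theorem tendsto_singular_closedBall_div (hγ : 0 < γ)
    {κ : Measure (EuclideanSpace ℝ (Fin n))} [IsFiniteMeasure κ]
    (hκ : κ ⟂ₘ poissonMeasure n γ (referencePoint n)) :
    ∀ᵐ y : EuclideanSpace ℝ (Fin n), Tendsto (fun r =>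
      κ (Metric.closedBall y r) / volume (Metric.closedBall y r)) (𝓝[>] 0) (𝓝 0) := by
  have hκ' : κ ⟂ₘ volume := hκ.mono_ac Measure.AbsolutelyContinuous.rfl
    (volume_absolutelyContinuous_poissonMeasure hγ)
  filter_upwards [Besicovitch.ae_tendsto_rnDeriv κ volume, hκ'.rnDeriv_ae_eq_zero] with y h1 h2
  rwa [h2] at h1

theorem isFiniteMeasure_variation {S : Type*} [MeasurableSpace S] (μ : SignedMeasure S) :
    IsFiniteMeasure μ.variation := by
  rw [← SignedMeasure.totalVariation_eq_variation]
  infer_instance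

theorem integral_lsmul_toSignedMeasure {S : Type*} [MeasurableSpace S] (μ : Measure S)
    [IsFiniteMeasure μ] (f : S → ℝ) : ∫ᵛ x, f x ∂•μ.toSignedMeasure = ∫ x, f x ∂μ := by
  rw [← VectorMeasure.integral_toSignedMeasure]
  congr 1
  ext
  simp

theorem withDensityᵥ_const {S : Type*} [MeasurableSpace S] (μ : Measure S) [IsFiniteMeasure μ]
    (a : ℝ) : μ.withDensityᵥ (fun _ => a) = a • μ.toSignedMeasure := by
  ext s hs
  rw [withDensityᵥ_apply (integrable_const a) hs, _root_.smul_apply,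
    Measure.toSignedMeasure_apply_measurable hs, setIntegral_const, smul_eq_mul, smul_eq_mul,
    mul_comm]

theorem integrable_variation_poissonDensity_div (hγ : 0 < γ) {t : ℝ} (ht : 0 < t)
    (c : EuclideanSpace ℝ (Fin n)) (μ : SignedMeasure (EuclideanSpace ℝ (Fin n))) :
    μ.Integrable fun z => poissonDensity n γ t (z - c) / poissonDensity n γ 1 z := by
  have := isFiniteMeasure_variation μ
  refine Integrable.of_bound
    (continuous_poissonDensity_div hγ ht c).aestronglyMeasurable
    (t ^ γ * (2 + (2 * ‖c‖ ^ 2 + 1) / t ^ 2) ^ (((n : ℝ) + γ) / 2))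
    (Eventually.of_forall fun z => ?_)
  rw [Real.norm_of_nonneg (div_pos (poissonDensity_pos hγ ht _)
    (poissonDensity_pos hγ one_pos z)).le]
  exact poissonDensity_div_le hγ ht ht (by nlinarith [sq_nonneg ‖z - c‖])

/-- The integral of the Martin kernel against a signed measure is close to `a` when the signed
measure is close to `a` times the harmonic measure. -/
theorem enorm_integral_poissonDensity_div_sub_le (hγ : 0 < γ)
    {x : EuclideanSpace ℝ (Fin (n + 1))} (hx : x (Fin.last n) ≠ 0)
    {f : EuclideanSpace ℝ (Fin n) → ℝ}
    (hf : Integrable f (poissonMeasure n γ (referencePoint n)))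
    (ν : SignedMeasure (EuclideanSpace ℝ (Fin n))) (a : ℝ) :
    ‖(∫ᵛ z, poissonDensity n γ |x (Fin.last n)| (z - horizontalPart x) / poissonDensity n γ 1 z
        ∂•((poissonMeasure n γ (referencePoint n)).withDensityᵥ f + ν)) - a‖ₑ ≤
      ∫⁻ z, ENNReal.ofReal (poissonDensity n γ |x (Fin.last n)| (z - horizontalPart x) /
        poissonDensity n γ 1 z) ∂((poissonMeasure n γ (referencePoint n)).withDensity
          (fun z => ‖f z - a‖ₑ) + ν.variation) := by
  have ht := abs_pos.2 hx
  have href : referencePoint n (Fin.last n) ≠ 0 := by simp [referencePoint_last]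
  set ω := poissonMeasure n γ (referencePoint n) with hω
  have hωf : IsFiniteMeasure ω := isFiniteMeasure_poissonMeasure hγ href
  set M : EuclideanSpace ℝ (Fin n) → ℝ := fun z =>
    poissonDensity n γ |x (Fin.last n)| (z - horizontalPart x) / poissonDensity n γ 1 z with hM
  have hMint : ∀ μ : SignedMeasure (EuclideanSpace ℝ (Fin n)), μ.Integrable M :=
    fun μ => integrable_variation_poissonDensity_div hγ ht (horizontalPart x) μ
  have hM0 : ∀ z, 0 < M z := fun z =>
    div_pos (poissonDensity_pos hγ ht _) (poissonDensity_pos hγ one_pos z)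
  -- The denominator of `M` cancels the density of `ω`, leaving a translated Poisson density of mass
  -- one.
  have hone : ∫ z, M z ∂ω = 1 := by
    rw [hω, integral_poissonMeasure hγ href]
    simp_rw [referencePoint_last, abs_one, horizontalPart_referencePoint, sub_zero]
    refine Eq.trans ?_ ((integral_sub_right_eq_self (poissonDensity n γ |x (Fin.last n)|)
      (horizontalPart x)).trans (integral_poissonDensity hγ ht))
    refine integral_congr_ae (Eventually.of_forall fun z => ?_)
    simp only [hM, smul_eq_mul]
    exact mul_div_cancel₀ _ (poissonDensity_pos hγ one_pos z).ne'
  have hfa : Integrable (fun z => f z - a) ω := hf.sub (integrable_const a)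
  -- By `hone` the constant part `a ω` integrates to exactly `a`; only the density `f - a` and `ν`
  -- remain, to be bounded by their variations.
  have hsplit : ω.withDensityᵥ f + ν =
      (ω.withDensityᵥ (fun z => f z - a) + ν) + a • ω.toSignedMeasure := by
    rw [← withDensityᵥ_const, add_right_comm, ← withDensityᵥ_add' hfa (integrable_const a)]
    simp
  rw [hsplit, VectorMeasure.integral_add_vectorMeasure (hMint _) (hMint _),
    VectorMeasure.integral_smul_vectorMeasure, integral_lsmul_toSignedMeasure, hone, smul_eq_mul,
    mul_one, add_sub_cancel_right]
  refine VectorMeasure.enorm_integral_le_lintegral_enorm_transpose.trans ?_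
  rw [VectorMeasure.variation_transpose_lsmul]
  have hvar : (ω.withDensityᵥ (fun z => f z - a) + ν).variation ≤
      ω.withDensity (fun z => ‖f z - a‖ₑ) + ν.variation := by
    refine VectorMeasure.variation_add_le.trans ?_
    rw [Measure.variation_withDensityᵥ hfa]
  refine lintegral_mono' hvar fun z => ?_
  rw [Real.enorm_of_nonneg (hM0 z).le]

end SignedMeasure

end AlphaStable

/-! ### Conclusion. -/

theorem theorem4p18 {Ω : Type*} [MeasurableSpace Ω] (P : Measure Ω) [IsProbabilityMeasure P]
    (n : ℕ) (hn : 1 ≤ n) (α : ℝ) (hα₁ : 1 < α) (hα₂ : α < 2)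
    (X : ℝ≥0 → Ω → EuclideanSpace ℝ (Fin (n + 1))) (hX : IsSymmetricStable P α X)
    (μ ν : SignedMeasure (EuclideanSpace ℝ (Fin n))) (f : EuclideanSpace ℝ (Fin n) → ℝ)
    (hf : Integrable f (hyperplaneHarmonicMeasure P X))
    (hν : ν ⟂ᵥ (hyperplaneHarmonicMeasure P X).toENNRealVectorMeasure)
    (hμ : μ = (hyperplaneHarmonicMeasure P X).withDensityᵥ f + ν) :
    (∀ x ∈ hyperplaneCompl n, ∀ y : EuclideanSpace ℝ (Fin n),
      Tendsto
        (fun w => greenFunction P α X (hyperplaneCompl n) x w /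
          greenFunction P α X (hyperplaneCompl n) (referencePoint n) w)
        (𝓝[hyperplaneCompl n] (boundaryPoint y)) (𝓝 (hyperplaneMartinKernel P α X x y))) ∧
    (∀ x ∈ hyperplaneCompl n, μ.Integrable (hyperplaneMartinKernel P α X x)) ∧
    ∀ᵐ y : EuclideanSpace ℝ (Fin n),
      HasNontangentialLimit (martinIntegral P α X μ) (boundaryPoint y) (f y) := by
  have hγ : 0 < α - 1 := by linarith
  have hM : ∀ x ∈ hyperplaneCompl n, hyperplaneMartinKernel P α X x = fun y =>
      poissonDensity n (α - 1) |x (Fin.last n)| (y - horizontalPart x) /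
        poissonDensity n (α - 1) 1 y :=
    fun x hx => funext fun y => hX.hyperplaneMartinKernel_eq hn hα₁ hα₂ hx y
  refine ⟨fun x hx y => ?_, fun x hx => ?_, ?_⟩
  · rw [hM x hx]
    exact hX.tendsto_greenFunction_div hn hα₁ hα₂ hx y
  · rw [hM x hx]
    exact integrable_variation_poissonDensity_div hγ (abs_pos.2 hx) _ μ
  rw [hX.hyperplaneHarmonicMeasure_eq hn hα₁] at hf hν hμ
  have href : referencePoint n (Fin.last n) ≠ 0 := by simp [referencePoint_last]
  have hωf : IsFiniteMeasure (poissonMeasure n (α - 1) (referencePoint n)) :=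
    isFiniteMeasure_poissonMeasure hγ href
  have hνf := isFiniteMeasure_variation ν
  rw [SignedMeasure.mutuallySingular_ennreal_iff,
    VectorMeasure.ennrealToMeasure_toENNRealVectorMeasure,
    SignedMeasure.totalVariation_eq_variation] at hν
  filter_upwards [tendsto_withDensity_closedBall_div hγ hf,
    tendsto_singular_closedBall_div hγ hν] with y h1 h2 β _
  -- This measure depends on `y`, yet for almost every `y` it has density zero at that same `y`,
  -- which is all the Fatou estimate requires.
  set lam := (poissonMeasure n (α - 1) (referencePoint n)).withDensity
    (fun z => ‖f z - f y‖ₑ) + ν.variation with hlam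
  have hfin : IsFiniteMeasure ((poissonMeasure n (α - 1) (referencePoint n)).withDensity
      (fun z => ‖f z - f y‖ₑ)) :=
    isFiniteMeasure_withDensity (hf.sub (integrable_const (f y))).2.ne
  have hden : Tendsto (fun r => lam (Metric.closedBall y r) / volume (Metric.closedBall y r))
      (𝓝[>] 0) (𝓝 0) := by
    have := h1.add h2
    rw [add_zero] at this
    refine this.congr fun r => ?_
    rw [hlam, Measure.add_apply, ENNReal.add_div]
  rw [tendsto_iff_edist_tendsto_0]
  refine tendsto_of_tendsto_of_tendsto_of_le_of_le' tendsto_const_nhds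
    (tendsto_cone_lintegral_poissonDensity_div hn hγ hden β)
    (Eventually.of_forall fun _ => zero_le) ?_
  filter_upwards [self_mem_nhdsWithin] with x hx
  rw [edist_eq_enorm_sub, martinIntegral, hM x hx.1, hμ]
  exact enorm_integral_poissonDensity_div_sub_le hγ hx.1 hf ν (f y)
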